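/- Let $M$ be a complex manifold with holomorphic tangent bundle $\Theta_M$, let $\mathbb{P}^1_\lambda$ be the projective line with coordinate $\lambda$, $p:\mathbb{P}^1_\lambda\times M\to M$ the projection, $j(\lambda,t)=(-\lambda,t)$, and $\lambda^k\mathcal{O}:=\mathcal{O}_{\mathbb{P}^1\times M}(-k\{0\}\times M+k\{\infty\}\times M)$ for $k\in\mathbb{Z}$. All filtrations are exhaustive. **Definitions.** (a) A *trTLE-structure* on $M$ is a pair $(\mathcal{H},\nabla)$ of a holomorphic vector bundle $\mathcal{H}$ on $\mathbb{P}^1_\lambda\times M$ such that the adjoint morphism $p^*p_*\mathcal{H}\to\mathcal{H}$ is an isomorphism, and a meromorphic flat connection $\nabla:\mathcal{H}\to\mathcal{H}\otimes\Omega^1_{\mathbb{P}^1\times M}(\log(\{0,\infty\}\times M))\otimes\mathcal{O}_{\mathbb{P}^1\times M}(\{0\}\times M)$. A *trTLEP$(k)$-structure* is a trTLE-structure together with an $\mathcal{O}$-linear pairing $P:\mathcal{H}\otimes j^*\mathcal{H}\to\lambda^k\mathcal{O}$ which is $\nabla$-flat, $(-1)^k$-symmetric ($j^*P=(-1)^kP\circ\sigma$,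 with $\sigma$ the exchange of factors) and non-degenerate ($\lambda^{-k}P$ induces an isomorphism $\mathcal{H}\to(j^*\mathcal{H})^\vee$). A *mixed trTLEP-structure* is a trTLE-structure $(\mathcal{H},\nabla)$ with an increasing filtration $W=(W_k)_{k\in\mathbb{Z}}$ by $\nabla$-flat subbundles such that every $\mathrm{Gr}^W_k\mathcal{H}=W_k/W_{k-1}$ with the induced connection is a trTLE-structure (a *weight filtration*), and with pairings $P_k$ such that $(\mathrm{Gr}^W_k\mathcal{H},\nabla,P_k)$ is a trTLEP$(-k)$-structure for every $k$. (b) A *Saito structure* on $M$ is a tuple $\mathcal{S}=(\theta,\boldsymbol\nabla,e,E)$ of a symmetric Higgs field $\theta$ on $\Theta_M$, a torsion-free flat holomorphic connection $\boldsymbol\nabla$ on $\Theta_M$ and holomorphic vector fields $e,E$ such that $\boldsymbol\nabla e=0$, $\theta_e a=-a$ for all $a$, and the meromorphic connection $$\hat\nabla=p^*\boldsymbol\nabla+\tfrac1\lambda p^*\theta-\Big(\tfrac1\lambda p^*\theta_E+p^*(\boldsymbol\nabla_\bullet E)\Big)\frac{d\lambda}{\lambda}$$ on $p^*\Theta_M$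 is flat. For $d\in\mathbb{C}$ put $\mathcal{H}_{\mathcal{S},d}:=\big(p^*\Theta_M,\ \hat\nabla+\tfrac{2-d}{2}\,\mathrm{id}\,\tfrac{d\lambda}{\lambda}\big)$. (c) A *mixed Frobenius structure* of charge $d\in\mathbb{C}$ on $M$ is a triple $\mathscr{F}=(\mathcal{S},\mathcal{I},g)$ of a Saito structure $\mathcal{S}$, an increasing filtration $\mathcal{I}=(\mathcal{I}_k)_{k\in\mathbb{Z}}$ of $\Theta_M$ by subbundles that are $\theta$-invariant, $\boldsymbol\nabla$-flat and $E$-closed ($[E,y]\in\mathcal{I}_k$ for $y\in\mathcal{I}_k$), and a sequence of holomorphic, $\boldsymbol\nabla$-flat, symmetric, non-degenerate pairings $g_k:\mathrm{Gr}^{\mathcal{I}}_k\Theta_M\otimes\mathrm{Gr}^{\mathcal{I}}_k\Theta_M\to\mathcal{O}_M$ with $g_k(\theta_xy,z)=g_k(y,\theta_xz)$ and $\mathrm{Lie}_E(g_k)=(2-d+k)g_k$ for all $k\in\mathbb{Z}$. **Proposition.** Let $\mathscr{F}=(\mathcal{S},\mathcal{I},g)$ be a mixed Frobenius structure of charge $d$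 on a complex manifold $M$. Put $W_{\mathcal{I},k}:=p^*\mathcal{I}_k$, and let $P_{g,k}$ be the composition $$\mathrm{Gr}^{W_{\mathcal{I}}}_k\otimes j^*\mathrm{Gr}^{W_{\mathcal{I}}}_k\xrightarrow{\ \mathrm{id}\otimes j^*\ }\mathrm{Gr}^{W_{\mathcal{I}}}_k\otimes\mathrm{Gr}^{W_{\mathcal{I}}}_k\xrightarrow{\ \lambda^{-k}p^*(g_k)\ }\lambda^{-k}\mathcal{O},\qquad \mathrm{Gr}^{W_{\mathcal{I}}}_k\simeq p^*\mathrm{Gr}^{\mathcal{I}}_k\Theta_M .$$ Then $\mathcal{T}(\mathscr{F}):=\big((\mathcal{H}_{\mathcal{S},d},W_{\mathcal{I}}),(P_{g,k})_{k\in\mathbb{Z}}\big)$ is a mixed trTLEP-structure on $M$. -/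

import Mathlib

open Set Filter Topology Bundle
open scoped Manifold ContDiff

noncomputable section

namespace RiemannSphere

/-- The involution `λ ↦ 1/λ` of the Riemann sphere. -/
def inv : OnePoint ℂ → OnePoint ℂ
  | OnePoint.infty => ((0 : ℂ) : OnePoint ℂ)
  | (z : ℂ) => if z = 0 then OnePoint.infty else ((z⁻¹ : ℂ) : OnePoint ℂ)

lemma inv_infty : inv OnePoint.infty = ((0 : ℂ) : OnePoint ℂ) := rfl
lemma inv_coe (z : ℂ) : inv (z : OnePoint ℂ) = if z = 0 then OnePoint.infty else ((z⁻¹ : ℂ) : OnePoint ℂ) := rfl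

lemma inv_inv (p : OnePoint ℂ) : inv (inv p) = p := by
  induction p using OnePoint.rec with
  | infty => simp [inv_infty, inv_coe]
  | coe z =>
    by_cases hz : z = 0
    · simp [inv_coe, hz, inv_infty]
    · simp [inv_coe, hz]

lemma continuous_inv : Continuous inv := by
  rw [OnePoint.continuous_iff]
  constructor
  · rw [← Metric.cobounded_eq_cocompact.trans (Filter.coclosedCompact_eq_cocompact).symm]
    have h : Tendsto (fun z : ℂ => ((z⁻¹ : ℂ) : OnePoint ℂ)) (Bornology.cobounded ℂ)
        (𝓝 (inv OnePoint.infty)) :=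
      (OnePoint.continuous_coe.tendsto (0 : ℂ)).comp Filter.tendsto_inv₀_cobounded
    refine h.congr' ?_
    filter_upwards [Bornology.isBounded_def.1 (Bornology.isBounded_singleton (x := (0 : ℂ)))] with z hz
    have : z ≠ 0 := hz
    simp [inv_coe, this]
  · rw [continuous_iff_continuousAt]
    intro z
    by_cases hz : z = 0
    · subst hz
      rw [continuousAt_iff_punctured_nhds]
      have h : Tendsto (fun z : ℂ => ((z⁻¹ : ℂ) : OnePoint ℂ)) (𝓝[≠] 0) (𝓝 OnePoint.infty) := by
        refine Tendsto.comp ?_ Filter.tendsto_inv₀_nhdsNE_zero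
        rw [Metric.cobounded_eq_cocompact, ← Filter.coclosedCompact_eq_cocompact]
        exact OnePoint.tendsto_coe_infty
      have h0 : inv ((0 : ℂ) : OnePoint ℂ) = OnePoint.infty := by simp [inv_coe]
      rw [h0]
      refine h.congr' ?_
      filter_upwards [self_mem_nhdsWithin] with z hz
      have : z ≠ 0 := hz
      simp [inv_coe, this]
    · have h : ContinuousAt (fun z : ℂ => ((z⁻¹ : ℂ) : OnePoint ℂ)) z :=
        OnePoint.continuous_coe.continuousAt.comp (continuousAt_inv₀ hz)
      refine h.congr ?_
      filter_upwards [isOpen_ne.mem_nhds hz] with w hw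
      have : w ≠ 0 := hw
      simp [inv_coe, this]

def invHomeo : OnePoint ℂ ≃ₜ OnePoint ℂ where
  toFun := inv
  invFun := inv
  left_inv := inv_inv
  right_inv := inv_inv
  continuous_toFun := continuous_inv
  continuous_invFun := continuous_inv

/-- The chart `λ` on the complement of `∞`. -/
def chartZero : OpenPartialHomeomorph (OnePoint ℂ) ℂ :=
  (OnePoint.isOpenEmbedding_coe.toOpenPartialHomeomorph ((↑) : ℂ → OnePoint ℂ)).symm

/-- The chart `1/λ` on the complement of `0`. -/
def chartInfty : OpenPartialHomeomorph (OnePoint ℂ) ℂ :=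
  invHomeo.toOpenPartialHomeomorph.trans chartZero

lemma chartZero_source : chartZero.source = range ((↑) : ℂ → OnePoint ℂ) := by
  simp [chartZero]
lemma chartZero_coe (z : ℂ) : chartZero (z : OnePoint ℂ) = z :=
  OnePoint.isOpenEmbedding_coe.toOpenPartialHomeomorph_left_inv _
lemma chartZero_symm (z : ℂ) : chartZero.symm z = (z : OnePoint ℂ) := by
  simp [chartZero]
lemma chartZero_mem (z : ℂ) : (z : OnePoint ℂ) ∈ chartZero.source := by
  rw [chartZero_source]; exact ⟨z, rfl⟩
lemma chartInfty_mem : (OnePoint.infty : OnePoint ℂ) ∈ chartInfty.source := by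
  simp only [chartInfty, OpenPartialHomeomorph.trans_source, mem_inter_iff, mem_preimage]
  refine ⟨by simp, ?_⟩
  exact chartZero_mem 0
lemma chartInfty_apply (p : OnePoint ℂ) : chartInfty p = chartZero (inv p) := rfl
lemma chartInfty_symm (z : ℂ) : chartInfty.symm z = inv (z : OnePoint ℂ) := by
  have : chartInfty.symm z = inv (chartZero.symm z) := rfl
  rw [this, chartZero_symm]

open Classical in
/-- The Riemann sphere `ℙ¹ = ℂ ∪ {∞}` with the charts `λ` and `1/λ`. -/
instance : ChartedSpace ℂ (OnePoint ℂ) where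
  atlas := {chartZero, chartInfty}
  chartAt p := if p = OnePoint.infty then chartInfty else chartZero
  mem_chart_source p := by
    induction p using OnePoint.rec with
    | infty => simpa using chartInfty_mem
    | coe z => simpa using chartZero_mem z
  chart_mem_atlas p := by
    by_cases h : p = OnePoint.infty <;> simp [h]

lemma transition {z : ℂ} (hz : inv (z : OnePoint ℂ) ∈ chartZero.source) :
    z ≠ 0 ∧ chartZero (inv (z : OnePoint ℂ)) = z⁻¹ := by
  have h0 : z ≠ 0 := by
    rintro rfl
    rw [chartZero_source] at hz
    simp [inv_coe] at hz
  exact ⟨h0, by rw [inv_coe, if_neg h0, chartZero_coe]⟩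

instance : IsManifold 𝓘(ℂ, ℂ) ω (OnePoint ℂ) := by
  apply isManifold_of_contDiffOn
  have key : ∀ (s : Set ℂ) (f : ℂ → ℂ), (∀ z ∈ s, z ≠ 0 ∧ f z = z⁻¹) → ContDiffOn ℂ ω f s := by
    intro s f h
    refine ContDiffOn.congr (f := fun z => z⁻¹) ?_ fun z hz => (h z hz).2
    exact contDiffOn_id.inv fun z hz => (h z hz).1
  have idem : ∀ (s : Set ℂ) (f : ℂ → ℂ), (∀ z ∈ s, f z = z) → ContDiffOn ℂ ω f s :=
    fun s f h => contDiffOn_id.congr h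
  rintro e e' (rfl | rfl) (rfl | rfl)
  · refine idem _ _ fun z hz => ?_
    simp [chartZero_symm, chartZero_coe]
  · refine key _ _ fun z hz => ?_
    simp only [chartInfty, mfld_simps, chartZero_symm] at hz
    simpa [chartZero_symm, chartInfty_apply] using transition hz.2
  · refine key _ _ fun z hz => ?_
    have hz' : chartInfty.symm z ∈ chartZero.source := by
      simp only [mfld_simps] at hz; exact hz.2
    rw [chartInfty_symm] at hz'
    simpa [chartInfty_symm] using transition hz'
  · refine idem _ _ fun z hz => ?_
    simp [chartInfty_symm, chartInfty_apply, inv_inv, chartZero_coe]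

end RiemannSphere

/-! ### Holomorphic vector bundles as locally free sheaves of sections

Everything below is holomorphic: "`ω`-regular over `ℂ`" is Mathlib's way to say it. A holomorphic
vector bundle is treated through its sheaf of holomorphic sections: a family of complex vector
spaces `F x` together with the predicate `HolAt s x`, "the section `s` is holomorphic near `x`".
Arbitrary set-theoretic sections are allowed as arguments; their values off a neighbourhood of `x`
play no role for `HolAt s x`. -/

namespace MixedFrob

section General

variable {B : Type*} [NormedAddCommGroup B] [NormedSpace ℂ B] {H : Type*} [TopologicalSpace H]
  (I : ModelWithCorners ℂ B H) {X : Type*} [TopologicalSpace X] [ChartedSpace H X]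

/-- The function `f` is holomorphic near `x`. -/
abbrev HolFunAt (f : X → ℂ) (x : X) : Prop := ContMDiffAt I 𝓘(ℂ, ℂ) ω f x

/-- A sheaf of `𝒪_X`-modules consisting of sections of a family of complex vector spaces. -/
structure HolSheaf (F : X → Type*) [∀ x, AddCommGroup (F x)] [∀ x, Module ℂ (F x)] where
  HolAt : (Π x, F x) → X → Prop
  zero_holAt : ∀ x, HolAt 0 x
  add_holAt : ∀ {s t x}, HolAt s x → HolAt t x → HolAt (s + t) x
  smul_holAt : ∀ {f : X → ℂ} {s x}, HolFunAt I f x → HolAt s x → HolAt (f • s) x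
  congr_holAt : ∀ {s t x}, HolAt s x → (∀ᶠ y in 𝓝 x, s y = t y) → HolAt t x
  eventually_holAt : ∀ {s x}, HolAt s x → ∀ᶠ y in 𝓝 x, HolAt s y

namespace HolSheaf

/-- The sheaf of holomorphic sections of the pull-back `f^* E` of a holomorphic vector bundle `E`
(in the sense of Mathlib) along a holomorphic map `f`. -/
def ofBundle {B' : Type*} [NormedAddCommGroup B'] [NormedSpace ℂ B'] {H' : Type*}
    [TopologicalSpace H'] (I' : ModelWithCorners ℂ B' H') {Y : Type*} [TopologicalSpace Y]
    [ChartedSpace H' Y] [IsManifold I ω X] [IsManifold I' ω Y]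
    (F₀ : Type*) [NormedAddCommGroup F₀] [NormedSpace ℂ F₀] (E : X → Type*)
    [∀ x, AddCommGroup (E x)] [∀ x, Module ℂ (E x)] [∀ x, TopologicalSpace (E x)]
    [TopologicalSpace (TotalSpace F₀ E)] [FiberBundle F₀ E] [VectorBundle ℂ F₀ E]
    [ContMDiffVectorBundle ω F₀ E I] (f : Y → X) (hf : ContMDiff I' I ω f) :
    HolSheaf I' (fun y : Y => E (f y)) where
  HolAt s y := ContMDiffAt I' (I.prod 𝓘(ℂ, F₀)) ω (fun y => TotalSpace.mk' F₀ (f y) (s y)) y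
  zero_holAt y := by
    have h := (contMDiff_zeroSection (n := ω) (IB := I) ℂ (F := F₀) E).comp hf
    exact h y
  add_holAt {s t y} hs ht := by
    rw [contMDiffAt_totalSpace] at hs ht ⊢
    refine ⟨hf y, ?_⟩
    refine (hs.2.add ht.2).congr_of_eventuallyEq ?_
    have ho := (trivializationAt F₀ E (f y)).open_baseSet.mem_nhds
      (FiberBundle.mem_baseSet_trivializationAt' (f y))
    filter_upwards [hf.continuous.continuousAt.preimage_mem_nhds ho] with z hz
    exact ((trivializationAt F₀ E (f y)).linear ℂ hz).1 _ _
  smul_holAt {g s y} hg hs := by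
    rw [contMDiffAt_totalSpace] at hs ⊢
    refine ⟨hf y, ?_⟩
    refine (hg.smul hs.2).congr_of_eventuallyEq ?_
    have ho := (trivializationAt F₀ E (f y)).open_baseSet.mem_nhds
      (FiberBundle.mem_baseSet_trivializationAt' (f y))
    filter_upwards [hf.continuous.continuousAt.preimage_mem_nhds ho] with z hz
    exact ((trivializationAt F₀ E (f y)).linear ℂ hz).2 _ _
  congr_holAt {s t y} hs h := by
    refine hs.congr_of_eventuallyEq ?_
    filter_upwards [h] with z hz
    rw [hz]
  eventually_holAt {s y} hs := (contMDiffAt_iff_contMDiffAt_nhds (by simp)).1 hs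

/-- The structure sheaf `𝒪_X`. -/
def structureSheaf [IsManifold I ω X] : HolSheaf I (fun _ : X => ℂ) where
  HolAt f x := HolFunAt I f x
  zero_holAt _ := contMDiffAt_const
  add_holAt hf hg := hf.add hg
  smul_holAt hf hg := hf.smul hg
  congr_holAt hf h := hf.congr_of_eventuallyEq (h.mono fun _ h => h.symm)
  eventually_holAt hf := (contMDiffAt_iff_contMDiffAt_nhds (by simp)).1 hf

/-- The sheaf `Θ_X` of holomorphic vector fields. -/
def tangent (X : Type*) [TopologicalSpace X] [ChartedSpace H X] [IsManifold I ω X] :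
    HolSheaf I (fun x : X => TangentSpace I x) :=
  ofBundle I I B (TangentSpace I : X → Type _) id contMDiff_id

variable {I} {F : X → Type*} [∀ x, AddCommGroup (F x)] [∀ x, Module ℂ (F x)] (𝓗 : HolSheaf I F)

/-- The sections `e 1, …, e n` form a holomorphic frame on `U`. -/
structure IsFrameOn {n : ℕ} (e : Fin n → Π x, F x) (U : Set X) : Prop where
  linearIndependent : ∀ x ∈ U, LinearIndependent ℂ fun i => e i x
  span_eq_top : ∀ x ∈ U, Submodule.span ℂ (range fun i => e i x) = ⊤
  holAt_iff : ∀ x ∈ U, ∀ s : Π x, F x, 𝓗.HolAt s x ↔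
    ∃ c : Fin n → X → ℂ, (∀ i, HolFunAt I (c i) x) ∧ ∀ᶠ y in 𝓝 x, s y = ∑ i, c i y • e i y

/-- The sheaf is a holomorphic vector bundle (of finite, locally constant rank). -/
def IsVectorBundle : Prop :=
  ∀ x, ∃ U ∈ 𝓝 x, ∃ (n : ℕ) (e : Fin n → Π x, F x), 𝓗.IsFrameOn e U

/-- The family `W` of subspaces is a holomorphic subbundle: locally it is spanned by a part of a
frame. -/
def IsSubbundle (W : Π x, Submodule ℂ (F x)) : Prop :=
  ∀ x, ∃ U ∈ 𝓝 x, ∃ (n : ℕ) (e : Fin n → Π x, F x) (S : Set (Fin n)), 𝓗.IsFrameOn e U ∧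
    ∀ y ∈ U, W y = Submodule.span ℂ ((fun i => e i y) '' S)

end HolSheaf

/-! ### Graded pieces of a filtration -/

section Gr

variable {I} {F : X → Type*} [∀ x, AddCommGroup (F x)] [∀ x, Module ℂ (F x)]

/-- The fibre of `Gr_k^W = W_k / W_{k-1}` at `x`. -/
abbrev Gr (W : ℤ → Π x, Submodule ℂ (F x)) (k : ℤ) (x : X) : Type _ :=
  ↥(W k x) ⧸ (W (k - 1) x).submoduleOf (W k x)

open Classical in
/-- The class in `Gr_k^W` of a vector of `W_k` (and `0` for a vector that is not in `W_k`). -/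
def toGr (W : ℤ → Π x, Submodule ℂ (F x)) (k : ℤ) (x : X) (v : F x) : Gr W k x :=
  if h : v ∈ W k x then Submodule.Quotient.mk ⟨v, h⟩ else 0

set_option linter.unusedSectionVars false in
lemma toGr_of_mem (W : ℤ → Π x, Submodule ℂ (F x)) (k : ℤ) {x : X} {v : F x} (h : v ∈ W k x) :
    toGr W k x v = Submodule.Quotient.mk ⟨v, h⟩ := dif_pos h

/-- Near `x`, the section `s` is a holomorphic section of `W_k` that represents the section `q` of
`Gr_k^W`. -/
def IsLiftAt (𝓗 : HolSheaf I F) (W : ℤ → Π x, Submodule ℂ (F x)) (k : ℤ) (q : Π x, Gr W k x)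
    (s : Π x, F x) (x : X) : Prop :=
  𝓗.HolAt s x ∧ ∀ᶠ y in 𝓝 x, s y ∈ W k y ∧ q y = toGr W k y (s y)

/-- The quotient sheaf `Gr_k^W = W_k / W_{k-1}`. -/
def HolSheaf.gr (𝓗 : HolSheaf I F) (W : ℤ → Π x, Submodule ℂ (F x)) (k : ℤ) :
    HolSheaf I (Gr W k) where
  HolAt q x := ∃ s, IsLiftAt 𝓗 W k q s x
  zero_holAt x := ⟨0, 𝓗.zero_holAt x, Eventually.of_forall fun y => by
    refine ⟨zero_mem _, ?_⟩
    rw [toGr_of_mem W k (by exact zero_mem _)]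
    rfl⟩
  add_holAt := by
    rintro q q' x ⟨s, hs, h⟩ ⟨s', hs', h'⟩
    refine ⟨s + s', 𝓗.add_holAt hs hs', ?_⟩
    filter_upwards [h, h'] with y hy hy'
    refine ⟨add_mem hy.1 hy'.1, ?_⟩
    obtain ⟨hm, hq⟩ := hy
    obtain ⟨hm', hq'⟩ := hy'
    rw [Pi.add_apply, hq, hq', toGr_of_mem W k hm, toGr_of_mem W k hm',
      toGr_of_mem W k (by exact add_mem hm hm')]
    rfl
  smul_holAt := by
    rintro f q x hf ⟨s, hs, h⟩
    refine ⟨f • s, 𝓗.smul_holAt hf hs, ?_⟩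
    filter_upwards [h] with y hy
    refine ⟨Submodule.smul_mem _ _ hy.1, ?_⟩
    obtain ⟨hm, hq⟩ := hy
    rw [Pi.smul_apply', hq, toGr_of_mem W k hm,
      toGr_of_mem W k (by exact Submodule.smul_mem _ _ hm)]
    rfl
  congr_holAt := by
    rintro q q' x ⟨s, hs, h⟩ hq
    refine ⟨s, hs, ?_⟩
    filter_upwards [h, hq] with y hy hqy
    exact ⟨hy.1, hqy ▸ hy.2⟩
  eventually_holAt := by
    rintro q x ⟨s, hs, h⟩
    filter_upwards [𝓗.eventually_holAt hs, h.eventually_nhds] with y hy hy'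
    exact ⟨s, hy, hy'⟩

end Gr

/-! ### Connections -/

section Connections

variable {F : X → Type*} [∀ x, AddCommGroup (F x)] [∀ x, Module ℂ (F x)]

/-- The underlying operator of a connection: `D s x v` stands for `(∇_v s)(x)`, where `v` is a
tangent vector at `x`. -/
abbrev ConnOp (F : X → Type*) [∀ x, AddCommGroup (F x)] [∀ x, Module ℂ (F x)] :=
  (Π x, F x) → Π x : X, TangentSpace I x →ₗ[ℂ] F x

variable {I}

/-- `D` is a holomorphic connection over the open set `U`. -/
structure IsConnectionOn [IsManifold I ω X] (𝓗 : HolSheaf I F) (D : ConnOp I F) (U : Set X) :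
    Prop where
  congr : ∀ x ∈ U, ∀ s t, 𝓗.HolAt s x → (∀ᶠ y in 𝓝 x, s y = t y) → D s x = D t x
  add : ∀ x ∈ U, ∀ s t, 𝓗.HolAt s x → 𝓗.HolAt t x → D (s + t) x = D s x + D t x
  leibniz : ∀ x ∈ U, ∀ (f : X → ℂ) s, HolFunAt I f x → 𝓗.HolAt s x → ∀ v : TangentSpace I x,
    D (f • s) x v = f x • D s x v + mvfderiv I f x v • s x
  holomorphic : ∀ x ∈ U, ∀ s, 𝓗.HolAt s x → ∀ ξ : Π y : X, TangentSpace I y,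
    (HolSheaf.tangent I X).HolAt ξ x → 𝓗.HolAt (fun y => D s y (ξ y)) x

/-- The curvature `D_ξ D_η - D_η D_ξ - D_[ξ,η]` vanishes over `U`. -/
def IsFlatOn [IsManifold I ω X] (𝓗 : HolSheaf I F) (D : ConnOp I F) (U : Set X) : Prop :=
  ∀ x ∈ U, ∀ s, 𝓗.HolAt s x → ∀ ξ η : Π y : X, TangentSpace I y,
    (HolSheaf.tangent I X).HolAt ξ x → (HolSheaf.tangent I X).HolAt η x →
      D (fun y => D s y (η y)) x (ξ x) - D (fun y => D s y (ξ y)) x (η x)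
        - D s x (VectorField.mlieBracket I ξ η x) = 0

/-- Over `U`, the subbundle `W` is preserved by `D`. -/
def IsFlatSubbundleOn (𝓗 : HolSheaf I F) (D : ConnOp I F) (W : Π x, Submodule ℂ (F x))
    (U : Set X) : Prop :=
  ∀ x ∈ U, ∀ s, 𝓗.HolAt s x → (∀ᶠ y in 𝓝 x, s y ∈ W y) → ∀ v : TangentSpace I x, D s x v ∈ W x

open Classical in
/-- The connection induced by `D` on `Gr_k^W`: the class of `D_v s` for a local holomorphic
section `s` of `W_k` that represents the given section of `Gr_k^W`. -/
def grConn (𝓗 : HolSheaf I F) (D : ConnOp I F) (W : ℤ → Π x, Submodule ℂ (F x)) (k : ℤ) :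
    ConnOp I (Gr W k) := fun q x =>
  if h : ∃ s, IsLiftAt 𝓗 W k q s x ∧ ∀ v : TangentSpace I x, D s x v ∈ W k x then
    Submodule.mkQ _ ∘ₗ LinearMap.codRestrict (W k x) (D h.choose x) h.choose_spec.2
  else 0

end Connections

end General

/-! ### Objects over `ℙ¹ × M` -/

section Sphere

/-- The coordinate function `λ` (its value at `∞` is irrelevant). -/
def coord : OnePoint ℂ → ℂ
  | OnePoint.infty => 0
  | (z : ℂ) => z

variable {V : Type*} [NormedAddCommGroup V] [NormedSpace ℂ V]

/-- The model of the complex manifold `ℙ¹ × M`, for `M` modelled on `V`. -/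
abbrev sphereModel (V : Type*) [NormedAddCommGroup V] [NormedSpace ℂ V] :
    ModelWithCorners ℂ (ℂ × V) (ModelProd ℂ V) := 𝓘(ℂ, ℂ).prod 𝓘(ℂ, V)

variable {M : Type*} [TopologicalSpace M] [ChartedSpace V M]

/-- The coordinate `λ` on `ℙ¹ × M`. -/
def lam (x : OnePoint ℂ × M) : ℂ := coord x.1

/-- The involution `j(λ, t) = (-λ, t)`. -/
def invol (x : OnePoint ℂ × M) : OnePoint ℂ × M := (OnePoint.map (fun z : ℂ => -z) x.1, x.2)

/-- The complement `ℂ^* × M` of the divisor `{0, ∞} × M`. -/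
def cstar (M : Type*) : Set (OnePoint ℂ × M) :=
  {x | x.1 ≠ ((0 : ℂ) : OnePoint ℂ) ∧ x.1 ≠ OnePoint.infty}

/-- Near `x`, the vector field `ξ` is tangent to the divisor `{0, ∞} × M`. -/
def IsLogAt (ξ : Π y : OnePoint ℂ × M, TangentSpace (sphereModel V) y) (x : OnePoint ℂ × M) :
    Prop :=
  ∀ᶠ y in 𝓝 x, y ∉ cstar M → mfderiv (sphereModel V) 𝓘(ℂ, ℂ) Prod.fst y (ξ y) = 0

/-! #### The adjoint morphism `p^* p_* 𝓗 → 𝓗` -/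

section Adjoint

/-- Functions on `M` that are holomorphic near `t`, as a subalgebra of all functions. -/
def holAlg (V : Type*) [NormedAddCommGroup V] [NormedSpace ℂ V] {M : Type*} [TopologicalSpace M]
    [ChartedSpace V M] (t : M) : Subalgebra ℂ (M → ℂ) where
  carrier := {f | HolFunAt 𝓘(ℂ, V) f t}
  mul_mem' hf hg := ContMDiffAt.mul hf hg
  add_mem' hf hg := ContMDiffAt.add hf hg
  algebraMap_mem' _ := contMDiffAt_const

/-- The ring of functions on `M` that are holomorphic near `t`. It acts on everything below through
its quotient `𝒪_{M,t}`, so that tensor products over it are tensor products over `𝒪_{M,t}`. -/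
def HolRing (V : Type*) [NormedAddCommGroup V] [NormedSpace ℂ V] {M : Type*} [TopologicalSpace M]
    [ChartedSpace V M] (t : M) : Type _ := ↥(holAlg V t)

instance (t : M) : CommRing (HolRing V t) := inferInstanceAs (CommRing ↥(holAlg V t))

/-- Sections over `ℙ¹ × M` as a module over functions on `M`, through the pull-back of functions. -/
def Sections (V : Type*) [NormedAddCommGroup V] [NormedSpace ℂ V] {M : Type*} [TopologicalSpace M]
    [ChartedSpace V M] (_t : M) (F : OnePoint ℂ × M → Type*) : Type _ :=
  Π x, F x

variable {F : OnePoint ℂ × M → Type*} [∀ x, AddCommGroup (F x)] [∀ x, Module ℂ (F x)]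

instance (t : M) : AddCommGroup (Sections V t F) := inferInstanceAs (AddCommGroup (Π x, F x))

instance (t : M) : Module (HolRing V t) (Sections V t F) where
  smul f s := fun x => f.1 x.2 • s x
  one_smul _ := funext fun _ => one_smul ℂ _
  mul_smul _ _ _ := funext fun _ => mul_smul _ _ _
  smul_zero _ := funext fun _ => smul_zero _
  smul_add _ _ _ := funext fun _ => smul_add _ _ _
  add_smul _ _ _ := funext fun _ => add_smul _ _ _
  zero_smul _ := funext fun _ => zero_smul ℂ _

lemma holFunAt_pullback {t : M} (f : HolRing V t) (x : OnePoint ℂ × M) (hx : x.2 = t) :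
    HolFunAt (sphereModel V) (fun y : OnePoint ℂ × M => f.1 y.2) x := by
  subst hx
  exact ContMDiffAt.comp x f.2 contMDiffAt_snd

lemma eventually_holAlg [IsManifold 𝓘(ℂ, V) ω M] {t : M} (f : HolRing V t) :
    ∀ᶠ t' in 𝓝 t, HolFunAt 𝓘(ℂ, V) f.1 t' :=
  (contMDiffAt_iff_contMDiffAt_nhds (by simp)).1 f.2

/-- Sections that are holomorphic near `x`. -/
def holSections (𝓗 : HolSheaf (sphereModel V) F) (x : OnePoint ℂ × M) :
    Submodule (HolRing V x.2) (Sections V x.2 F) where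
  carrier := {s | 𝓗.HolAt s x}
  add_mem' hs ht := 𝓗.add_holAt hs ht
  zero_mem' := 𝓗.zero_holAt x
  smul_mem' f _ hs := 𝓗.smul_holAt (holFunAt_pullback f x rfl) hs

/-- Sections that vanish near `x`. -/
def nullSections (V : Type*) [NormedAddCommGroup V] [NormedSpace ℂ V] {M : Type*}
    [TopologicalSpace M] [ChartedSpace V M] (F : OnePoint ℂ × M → Type*)
    [∀ x, AddCommGroup (F x)] [∀ x, Module ℂ (F x)] (x : OnePoint ℂ × M) :
    Submodule (HolRing V x.2) (Sections V x.2 F) where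
  carrier := {s | ∀ᶠ y in 𝓝 x, s y = 0}
  add_mem' {s t} hs ht := by
    filter_upwards [hs, ht] with y h h'
    change s y + t y = 0
    rw [h, h', add_zero]
  zero_mem' := Eventually.of_forall fun _ => rfl
  smul_mem' f s hs := by
    filter_upwards [hs] with y h
    change f.1 y.2 • s y = 0
    rw [h, smul_zero]

/-- The stalk `𝓗_x`. -/
abbrev Stalk (𝓗 : HolSheaf (sphereModel V) F) (x : OnePoint ℂ × M) : Type _ :=
  ↥(holSections 𝓗 x) ⧸ (nullSections V F x).submoduleOf (holSections 𝓗 x)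

variable [IsManifold 𝓘(ℂ, V) ω M]

/-- Sections that are holomorphic on `ℙ¹ × N` for a neighbourhood `N` of `t`. -/
def pushSections (𝓗 : HolSheaf (sphereModel V) F) (t : M) :
    Submodule (HolRing V t) (Sections V t F) where
  carrier := {s | ∀ᶠ t' in 𝓝 t, ∀ l : OnePoint ℂ, 𝓗.HolAt s (l, t')}
  add_mem' hs ht := by
    filter_upwards [hs, ht] with t' h h' l
    exact 𝓗.add_holAt (h l) (h' l)
  zero_mem' := Eventually.of_forall fun t' l => 𝓗.zero_holAt (l, t')
  smul_mem' f s hs := by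
    filter_upwards [hs, eventually_holAlg f] with t' h hf l
    exact 𝓗.smul_holAt (ContMDiffAt.comp (l, t') hf contMDiffAt_snd) (h l)

/-- Sections that vanish on `ℙ¹ × N` for a neighbourhood `N` of `t`. -/
def pushNull (V : Type*) [NormedAddCommGroup V] [NormedSpace ℂ V] {M : Type*}
    [TopologicalSpace M] [ChartedSpace V M] (F : OnePoint ℂ × M → Type*)
    [∀ x, AddCommGroup (F x)] [∀ x, Module ℂ (F x)] (t : M) :
    Submodule (HolRing V t) (Sections V t F) where
  carrier := {s | ∀ᶠ t' in 𝓝 t, ∀ l : OnePoint ℂ, s (l, t') = 0}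
  add_mem' {s s'} hs ht := by
    filter_upwards [hs, ht] with t' h h' l
    change s _ + s' _ = 0
    rw [h, h', add_zero]
  zero_mem' := Eventually.of_forall fun _ _ => rfl
  smul_mem' f s hs := by
    filter_upwards [hs] with t' h l
    change f.1 t' • s _ = 0
    rw [h, smul_zero]

/-- The stalk `(p_* 𝓗)_t`. -/
abbrev PushStalk (𝓗 : HolSheaf (sphereModel V) F) (t : M) : Type _ :=
  ↥(pushSections 𝓗 t) ⧸ (pushNull V F t).submoduleOf (pushSections 𝓗 t)

lemma eventually_of_push {t : M} {p : OnePoint ℂ × M → Prop}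
    (h : ∀ᶠ t' in 𝓝 t, ∀ l : OnePoint ℂ, p (l, t')) {x : OnePoint ℂ × M} (hx : x.2 = t) :
    ∀ᶠ y in 𝓝 x, p y := by
  subst hx
  filter_upwards [(continuous_snd.tendsto x).eventually h] with y hy
  exact hy y.1

variable (𝓗 : HolSheaf (sphereModel V) F) (x : OnePoint ℂ × M)

/-- `(f, s) ↦ [f s] ∈ 𝓗_x` for functions `f` holomorphic near `x` and sections `s` holomorphic
along `ℙ¹ × {t}`, `x = (λ, t)`. -/
def preAdjoint : ↥(holSections (V := V) (HolSheaf.structureSheaf (sphereModel V)) x) →ₗ[HolRing V x.2]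
    ↥(pushSections 𝓗 x.2) →ₗ[HolRing V x.2] Stalk 𝓗 x :=
  LinearMap.mk₂ (HolRing V x.2)
    (fun f s => Submodule.Quotient.mk (p := (nullSections V F x).submoduleOf (holSections 𝓗 x))
      (⟨fun y => (f.1 y : ℂ) • s.1 y, 𝓗.smul_holAt f.2 (eventually_of_push s.2 rfl).self_of_nhds⟩ :
        ↥(holSections 𝓗 x)))
    (fun f f' s => congrArg _ (Subtype.ext (funext fun y => add_smul (f.1 y : ℂ) (f'.1 y) (s.1 y))))
    (fun c f s => congrArg _ (Subtype.ext (funext fun y =>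
      mul_smul (c.1 y.2) (f.1 y : ℂ) (s.1 y))))
    (fun f s s' => congrArg _ (Subtype.ext (funext fun y => smul_add (f.1 y : ℂ) (s.1 y) (s'.1 y))))
    (fun c f s => congrArg _ (Subtype.ext (funext fun y =>
      smul_comm (f.1 y : ℂ) (c.1 y.2) (s.1 y))))

/-- The bilinear map `𝒪_{ℙ¹×M,x} × (p_* 𝓗)_t → 𝓗_x`, `x = (λ, t)`, that induces the adjoint morphism
on stalks. -/
def adjointBilin : Stalk (V := V) (HolSheaf.structureSheaf (sphereModel V)) x →ₗ[HolRing V x.2]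
    PushStalk 𝓗 x.2 →ₗ[HolRing V x.2] Stalk 𝓗 x :=
  Submodule.liftQ _ (Submodule.liftQ _ (preAdjoint 𝓗 x).flip (by
      intro s hs
      refine LinearMap.ext fun f => ?_
      refine (Submodule.Quotient.mk_eq_zero _).2 ?_
      have h := eventually_of_push (p := fun y => (s.1 : Π y, F y) y = 0) hs (x := x) rfl
      change ∀ᶠ y in 𝓝 x, (f.1 y : ℂ) • s.1 y = 0
      filter_upwards [h] with y hy
      rw [hy, smul_zero])).flip (by
    intro f hf
    refine LinearMap.ext fun s => ?_
    induction s using Submodule.Quotient.induction_on with | H s => ?_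
    refine (Submodule.Quotient.mk_eq_zero _).2 ?_
    have h : ∀ᶠ y in 𝓝 x, (f.1 y : ℂ) = 0 := hf
    change ∀ᶠ y in 𝓝 x, (f.1 y : ℂ) • s.1 y = 0
    filter_upwards [h] with y hy
    rw [hy, zero_smul])

/-- The adjoint morphism `p^* p_* 𝓗 → 𝓗` is an isomorphism: on stalks, the map
`𝒪_{ℙ¹×M,x} ⊗_{𝒪_{M,t}} (p_* 𝓗)_t → 𝓗_x` is bijective for every `x = (λ, t)`. -/
def IsAdjointIso : Prop := ∀ x, IsTensorProduct (adjointBilin 𝓗 x)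

end Adjoint

/-! #### trTLE-structures and pairings -/

section TrTLE

variable {F : OnePoint ℂ × M → Type*} [∀ x, AddCommGroup (F x)] [∀ x, Module ℂ (F x)]

/-- `(𝓗, D)` is a trTLE-structure on `M`. The meromorphic connection `D` is given by its restriction
to `ℂ^* × M` (its values elsewhere are irrelevant). That it is a morphism
`𝓗 → 𝓗 ⊗ Ω¹(log {0,∞} × M) ⊗ 𝒪({0} × M)` means that for vector fields `ξ` tangent to the divisor
`λ D_ξ s` extends holomorphically over `λ = 0` and `D_ξ s` extends holomorphically over `λ = ∞`. -/
structure IsTrTLE [IsManifold 𝓘(ℂ, V) ω M] (𝓗 : HolSheaf (sphereModel V) F)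
    (D : ConnOp (sphereModel V) F) : Prop where
  vectorBundle : 𝓗.IsVectorBundle
  adjointIso : IsAdjointIso 𝓗
  connection : IsConnectionOn 𝓗 D (cstar M)
  flat : IsFlatOn 𝓗 D (cstar M)
  pole_zero : ∀ x : OnePoint ℂ × M, x.1 = ((0 : ℂ) : OnePoint ℂ) → ∀ s, 𝓗.HolAt s x →
    ∀ ξ : Π y : OnePoint ℂ × M, TangentSpace (sphereModel V) y,
      (HolSheaf.tangent (sphereModel V) (OnePoint ℂ × M)).HolAt ξ x → IsLogAt ξ x →
        ∃ r, 𝓗.HolAt r x ∧ ∀ᶠ y in 𝓝 x, y ∈ cstar M → r y = lam y • D s y (ξ y)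
  log_infty : ∀ x : OnePoint ℂ × M, x.1 = OnePoint.infty → ∀ s, 𝓗.HolAt s x →
    ∀ ξ : Π y : OnePoint ℂ × M, TangentSpace (sphereModel V) y,
      (HolSheaf.tangent (sphereModel V) (OnePoint ℂ × M)).HolAt ξ x → IsLogAt ξ x →
        ∃ r, 𝓗.HolAt r x ∧ ∀ᶠ y in 𝓝 x, y ∈ cstar M → r y = D s y (ξ y)

/-- `(𝓗, D, P)` is a trTLEP(`k`)-structure. The pairing `P : 𝓗 ⊗ j^*𝓗 → λ^k 𝒪` is given by its
values on the fibres `𝓗_x ⊗ 𝓗_{j x}` over `x ∈ ℂ^* × M` (its values elsewhere are irrelevant);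
it takes values in `λ^k 𝒪`, and is non-degenerate, when `λ^{-k} P` extends to a holomorphic pairing
`Q : 𝓗 ⊗ j^*𝓗 → 𝒪` on `ℙ¹ × M` which induces an isomorphism `𝓗 → (j^*𝓗)^∨`. -/
structure IsTrTLEP [IsManifold 𝓘(ℂ, V) ω M] (k : ℤ) (𝓗 : HolSheaf (sphereModel V) F)
    (D : ConnOp (sphereModel V) F) (P : Π x, F x →ₗ[ℂ] F (invol x) →ₗ[ℂ] ℂ) : Prop where
  trTLE : IsTrTLE 𝓗 D
  flat : ∀ x ∈ cstar M, ∀ s s', 𝓗.HolAt s x → 𝓗.HolAt s' (invol x) →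
    ∀ v : TangentSpace (sphereModel V) x,
      mvfderiv (sphereModel V) (fun y => P y (s y) (s' (invol y))) x v =
        P x (D s x v) (s' (invol x)) +
          P x (s x) (D s' (invol x) (mfderiv (sphereModel V) (sphereModel V) invol x v))
  symm : ∀ x ∈ cstar M, ∀ s s' : Π y, F y,
    P (invol x) (s' (invol x)) (s (invol (invol x))) = (-1) ^ k * P x (s x) (s' (invol x))
  extends_nondegenerate : ∃ Q : Π x, F x →ₗ[ℂ] F (invol x) →ₗ[ℂ] ℂ,
    (∀ x ∈ cstar M, Q x = lam x ^ (-k) • P x) ∧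
    (∀ x s s', 𝓗.HolAt s x → 𝓗.HolAt s' (invol x) →
      HolFunAt (sphereModel V) (fun y => Q y (s y) (s' (invol y))) x) ∧
    ∀ x, Function.Bijective (Q x)

/-- `(𝓗, D, W, P)` is a mixed trTLEP-structure: `(𝓗, D)` is a trTLE-structure, `W` is an increasing
exhaustive filtration by `D`-flat subbundles, and every `(Gr_k^W, D, P_k)` is a
trTLEP(`-k`)-structure (in particular every `Gr_k^W` is a trTLE-structure). -/
structure IsMixedTrTLEP [IsManifold 𝓘(ℂ, V) ω M] (𝓗 : HolSheaf (sphereModel V) F)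
    (D : ConnOp (sphereModel V) F) (W : ℤ → Π x, Submodule ℂ (F x))
    (P : Π (k : ℤ) x, Gr W k x →ₗ[ℂ] Gr W k (invol x) →ₗ[ℂ] ℂ) : Prop where
  trTLE : IsTrTLE 𝓗 D
  increasing : ∀ k x, W k x ≤ W (k + 1) x
  exhaustive : ∀ x v, ∃ k, v ∈ W k x
  subbundle : ∀ k, 𝓗.IsSubbundle (W k)
  flat : ∀ k, IsFlatSubbundleOn 𝓗 D (W k) (cstar M)
  graded : ∀ k, IsTrTLEP (-k) (𝓗.gr W k) (grConn 𝓗 D W k) (P k)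

end TrTLE

/-! ### Saito structures and mixed Frobenius structures -/

section Frobenius

variable (V M)

/-- The bundle `p^* Θ_M` on `ℙ¹ × M`. -/
def pullTangent [IsManifold 𝓘(ℂ, V) ω M] :
    HolSheaf (sphereModel V) (fun x : OnePoint ℂ × M => TangentSpace 𝓘(ℂ, V) x.2) :=
  HolSheaf.ofBundle 𝓘(ℂ, V) (sphereModel V) V (TangentSpace 𝓘(ℂ, V) : M → Type _) Prod.snd
    contMDiff_snd

variable {V M}

/-- The connection
`p^*∇ + λ⁻¹ p^*θ - (λ⁻¹ p^*θ_E + p^*(∇_• E)) dλ/λ` on `p^* Θ_M` over `ℂ^* × M`. For a section `s`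
of `p^* Θ_M` and a tangent vector `w = (w₁, w₂)` of `ℙ¹ × M` at `(λ, t)`, the vector `(p^*∇)_w s`
is the derivative of `s(·, t)` (with values in the fixed vector space `T_t M`) along `w₁` plus the
covariant derivative of `s(λ, ·)` along `w₂`. -/
def hatConn [IsManifold 𝓘(ℂ, V) ω M]
    (θ : Π t : M, TangentSpace 𝓘(ℂ, V) t →ₗ[ℂ] TangentSpace 𝓘(ℂ, V) t →ₗ[ℂ] TangentSpace 𝓘(ℂ, V) t)
    (cov : CovariantDerivative 𝓘(ℂ, V) V (TangentSpace 𝓘(ℂ, V) : M → Type _))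
    (E : Π t : M, TangentSpace 𝓘(ℂ, V) t) :
    ConnOp (sphereModel V) (fun x : OnePoint ℂ × M => TangentSpace 𝓘(ℂ, V) x.2) := fun s x =>
  let d₁ := (mfderiv (sphereModel V) 𝓘(ℂ, ℂ) (Prod.fst : OnePoint ℂ × M → _) x).toLinearMap
  let d₂ := (mfderiv (sphereModel V) 𝓘(ℂ, V) (Prod.snd : OnePoint ℂ × M → _) x).toLinearMap
  let dlam := (mvfderiv (sphereModel V) (lam (M := M)) x).toLinearMap
  let vert : TangentSpace 𝓘(ℂ, ℂ) x.1 →ₗ[ℂ] TangentSpace 𝓘(ℂ, V) x.2 :=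
    (mvfderiv 𝓘(ℂ, ℂ) (fun l : OnePoint ℂ => (s (l, x.2) : V)) x.1).toLinearMap
  vert ∘ₗ d₁
    + (cov (fun t => s (x.1, t)) x.2).toLinearMap ∘ₗ d₂
    + (lam x)⁻¹ • (θ x.2).flip (s x) ∘ₗ d₂
    - dlam.smulRight
        ((lam x)⁻¹ • ((lam x)⁻¹ • θ x.2 (E x.2) (s x) + cov E x.2 (s x)))

variable (V M)

/-- A Saito structure `(θ, ∇, e, E)` (without metric) on the complex manifold `M`. -/
structure SaitoStructure [IsManifold 𝓘(ℂ, V) ω M] where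
  /-- the Higgs field: `higgs t a b = θ_a b` -/
  higgs : Π t : M,
    TangentSpace 𝓘(ℂ, V) t →ₗ[ℂ] TangentSpace 𝓘(ℂ, V) t →ₗ[ℂ] TangentSpace 𝓘(ℂ, V) t
  /-- the connection: `cov b t a = (∇_a b)(t)` -/
  cov : CovariantDerivative 𝓘(ℂ, V) V (TangentSpace 𝓘(ℂ, V) : M → Type _)
  /-- the unit vector field -/
  e : Π t : M, TangentSpace 𝓘(ℂ, V) t
  /-- the Euler vector field -/
  E : Π t : M, TangentSpace 𝓘(ℂ, V) t
  higgs_holomorphic : ∀ t a b, (HolSheaf.tangent 𝓘(ℂ, V) M).HolAt a t →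
    (HolSheaf.tangent 𝓘(ℂ, V) M).HolAt b t →
      (HolSheaf.tangent 𝓘(ℂ, V) M).HolAt (fun u => higgs u (a u) (b u)) t
  higgs_comm : ∀ t a b c, higgs t a (higgs t b c) = higgs t b (higgs t a c)
  higgs_symm : ∀ t a b, higgs t a b = higgs t b a
  cov_holomorphic : IsConnectionOn (HolSheaf.tangent 𝓘(ℂ, V) M) (fun s t => (cov s t).toLinearMap)
    Set.univ
  cov_flat : IsFlatOn (HolSheaf.tangent 𝓘(ℂ, V) M) (fun s t => (cov s t).toLinearMap) Set.univ
  torsion_free : ∀ t a b, (HolSheaf.tangent 𝓘(ℂ, V) M).HolAt a t →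
    (HolSheaf.tangent 𝓘(ℂ, V) M).HolAt b t →
      cov b t (a t) - cov a t (b t) = VectorField.mlieBracket 𝓘(ℂ, V) a b t
  e_holomorphic : ∀ t, (HolSheaf.tangent 𝓘(ℂ, V) M).HolAt e t
  E_holomorphic : ∀ t, (HolSheaf.tangent 𝓘(ℂ, V) M).HolAt E t
  e_flat : ∀ t, cov e t = 0
  higgs_e : ∀ t a, higgs t (e t) a = -a
  hat_flat : IsFlatOn (pullTangent V M) (hatConn higgs cov E) (cstar M)

/-- A mixed Frobenius structure `(𝒮, 𝓘, g)` of charge `d` on the complex manifold `M`. -/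
structure MixedFrobeniusStructure [IsManifold 𝓘(ℂ, V) ω M] (d : ℂ) extends
    SaitoStructure V M where
  /-- the filtration `𝓘_k` of the tangent bundle -/
  fil : ℤ → Π t : M, Submodule ℂ (TangentSpace 𝓘(ℂ, V) t)
  /-- the pairings `g_k` on `Gr_k` -/
  g : Π (k : ℤ) (t : M), Gr fil k t →ₗ[ℂ] Gr fil k t →ₗ[ℂ] ℂ
  increasing : ∀ k t, fil k t ≤ fil (k + 1) t
  exhaustive : ∀ t v, ∃ k, v ∈ fil k t
  subbundle : ∀ k, (HolSheaf.tangent 𝓘(ℂ, V) M).IsSubbundle (fil k)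
  higgs_invariant : ∀ k t a, ∀ b ∈ fil k t, higgs t a b ∈ fil k t
  cov_invariant : ∀ k, IsFlatSubbundleOn (HolSheaf.tangent 𝓘(ℂ, V) M)
    (fun s t => (cov s t).toLinearMap) (fil k) Set.univ
  E_closed : ∀ k t a, (HolSheaf.tangent 𝓘(ℂ, V) M).HolAt a t → (∀ᶠ u in 𝓝 t, a u ∈ fil k u) →
    VectorField.mlieBracket 𝓘(ℂ, V) E a t ∈ fil k t
  g_holomorphic : ∀ k t q q', ((HolSheaf.tangent 𝓘(ℂ, V) M).gr fil k).HolAt q t →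
    ((HolSheaf.tangent 𝓘(ℂ, V) M).gr fil k).HolAt q' t →
      HolFunAt 𝓘(ℂ, V) (fun u => g k u (q u) (q' u)) t
  g_symm : ∀ k t a b, g k t a b = g k t b a
  g_nondegenerate : ∀ k t, (g k t).Nondegenerate
  g_flat : ∀ k t a b, (HolSheaf.tangent 𝓘(ℂ, V) M).HolAt a t →
    (HolSheaf.tangent 𝓘(ℂ, V) M).HolAt b t →
    (∀ᶠ u in 𝓝 t, a u ∈ fil k u) → (∀ᶠ u in 𝓝 t, b u ∈ fil k u) →
      ∀ v : TangentSpace 𝓘(ℂ, V) t,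
        mvfderiv 𝓘(ℂ, V) (fun u => g k u (toGr fil k u (a u)) (toGr fil k u (b u))) t v =
          g k t (toGr fil k t (cov a t v)) (toGr fil k t (b t)) +
            g k t (toGr fil k t (a t)) (toGr fil k t (cov b t v))
  /-- `g_k(θ_x y, z) = g_k(y, θ_x z)` -/
  g_higgs : ∀ k t x, ∀ y ∈ fil k t, ∀ z ∈ fil k t,
    g k t (toGr fil k t (higgs t x y)) (toGr fil k t z) =
      g k t (toGr fil k t y) (toGr fil k t (higgs t x z))
  /-- `Lie_E g_k = (2 - d + k) g_k` -/
  g_lie : ∀ (k : ℤ) t a b, (HolSheaf.tangent 𝓘(ℂ, V) M).HolAt a t →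
    (HolSheaf.tangent 𝓘(ℂ, V) M).HolAt b t →
    (∀ᶠ u in 𝓝 t, a u ∈ fil k u) → (∀ᶠ u in 𝓝 t, b u ∈ fil k u) →
      mvfderiv 𝓘(ℂ, V) (fun u => g k u (toGr fil k u (a u)) (toGr fil k u (b u))) t (E t)
        - g k t (toGr fil k t (VectorField.mlieBracket 𝓘(ℂ, V) E a t)) (toGr fil k t (b t))
        - g k t (toGr fil k t (a t)) (toGr fil k t (VectorField.mlieBracket 𝓘(ℂ, V) E b t))
        = (2 - d + k) * g k t (toGr fil k t (a t)) (toGr fil k t (b t))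

variable {V M}

/-- The connection of the trTLE-structure `𝓗_{𝒮,d}` on `p^* Θ_M`: the connection `hatConn` plus
`c · id · dλ/λ` with `c = (2 - d)/2`. -/
def SaitoStructure.trTLEConn [IsManifold 𝓘(ℂ, V) ω M] (𝒮 : SaitoStructure V M) (d : ℂ) :
    ConnOp (sphereModel V) (fun x : OnePoint ℂ × M => TangentSpace 𝓘(ℂ, V) x.2) := fun s x =>
  hatConn 𝒮.higgs 𝒮.cov 𝒮.E s x +
    (mvfderiv (sphereModel V) (lam (M := M)) x).toLinearMap.smulRight
      ((((2 - d) / 2) * (lam x)⁻¹) • s x)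

namespace MixedFrobeniusStructure

variable [IsManifold 𝓘(ℂ, V) ω M] {d : ℂ} (𝓕 : MixedFrobeniusStructure V M d)

/-- The filtration `p^* 𝓘_k` of `p^* Θ_M`. -/
def weight (k : ℤ) (x : OnePoint ℂ × M) : Submodule ℂ (TangentSpace 𝓘(ℂ, V) x.2) := 𝓕.fil k x.2

/-- The pairing `λ^{-k} p^*(g_k) ∘ (id ⊗ j^*)` on `Gr_k ⊗ j^* Gr_k`. The fibre of `Gr_k` at
`j(λ, t) = (-λ, t)` is literally the one at `(λ, t)`. -/
def pairing (k : ℤ) (x : OnePoint ℂ × M) :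
    Gr 𝓕.weight k x →ₗ[ℂ] Gr 𝓕.weight k (invol x) →ₗ[ℂ] ℂ :=
  lam x ^ (-k) • (𝓕.g k x.2 : Gr 𝓕.fil k x.2 →ₗ[ℂ] Gr 𝓕.fil k x.2 →ₗ[ℂ] ℂ)

end MixedFrobeniusStructure

end Frobenius

end Sphere

end MixedFrob

end

/-! All conditions are local on `M`, and over a small open `N ⊆ M` everything can be tested on
sections of `p^*Θ_M` that are pulled back from vector fields on `N`. A frame of `Θ_M` over `N` pulls
back to a frame over `ℙ¹ × N` (`HolSheaf.IsFrameOn.pull`). By compactness of `ℙ¹` the coefficients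
of a section holomorphic along `ℙ¹ × {t}` do not depend on `λ`, which makes the adjoint morphism an
isomorphism (`isTensorProduct_adjointBilin`). A frame adapted to `𝓘_{k-1} ⊆ 𝓘_k` gives the same for
`Gr_k`.

On the pull-back of a field `a` the connection is algebraic in `λ⁻¹` and `dλ/λ`: `D a = ∇a + λ⁻¹ θ a
- (λ⁻¹ θ_E a + ∇_a E) dλ/λ + ((2 - d)/2) a dλ/λ`. For a logarithmic field `ξ` the function `dλ(ξ)/λ`
is holomorphic, because a holomorphic function vanishing on a smooth divisor is divisible by its
equation (`exists_analyticAt_eq_fst_mul`). Hence `λ D_ξ` extends over `0`, and `D_ξ` over `∞`, where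
`1/λ` is holomorphic. Flatness is assumed for `d = 2`; for other `d` the connection is locally
conjugate to that one by a branch of `λ^((2 - d)/2)` (`exists_conjugation`).

The filtration is preserved because `𝓘_k` is stable under `θ` and `∇`, and under `a ↦ ∇_a E`:
torsion-freeness gives `∇_a E = ∇_E a - [E, a]`, and `𝓘_k` is `E`-closed (`cov_E_mem`). So `D`
descends to `Gr_k`.

For the pairing, `j` changes the sign of `λ⁻¹` and fixes `dλ/λ`. As `θ` is self-adjoint for `g_k`,
all Higgs terms of `P(D a, b) + P(a, D b)` cancel. The condition on `Lie_E g_k` becomes `g(∇_a E, b)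
+ g(a, ∇_b E) = (2 - d + k) g(a, b)` (`g_cov_E`), so the coefficient of `g(a, b) dλ/λ` is `-(2 - d +
k) + (2 - d) = -k`, exactly the logarithmic derivative of `λ^{-k}` (`pairing_flat_toGr`). Symmetry
follows from `(-λ)^{-k} = (-1)^{-k} λ^{-k}`, and non-degeneracy from `λ^k P = p^*g_k`. -/

noncomputable section

namespace MixedFrob

/-! ### Frames, change of frame, and frames adapted to subbundles. -/

section Frames

variable {B : Type*} [NormedAddCommGroup B] [NormedSpace ℂ B] {H : Type*} [TopologicalSpace H]
  {I : ModelWithCorners ℂ B H} {X : Type*} [TopologicalSpace X] [ChartedSpace H X]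
  {F : X → Type*} [∀ x, AddCommGroup (F x)] [∀ x, Module ℂ (F x)]

namespace HolSheaf

variable (𝓗 : HolSheaf I F)

lemma holAt_congr {s t : Π x, F x} {x : X} (h : ∀ᶠ y in 𝓝 x, s y = t y) :
    𝓗.HolAt s x ↔ 𝓗.HolAt t x :=
  ⟨fun hs => 𝓗.congr_holAt hs h, fun ht => 𝓗.congr_holAt ht (h.mono fun _ h => h.symm)⟩

lemma const_smul_holAt {s : Π x, F x} {x : X} (c : ℂ) (hs : 𝓗.HolAt s x) : 𝓗.HolAt (c • s) x :=
  𝓗.smul_holAt (f := fun _ => c) contMDiffAt_const hs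

lemma sub_holAt {s t : Π x, F x} {x : X} (hs : 𝓗.HolAt s x) (ht : 𝓗.HolAt t x) :
    𝓗.HolAt (s - t) x := by
  have h := 𝓗.add_holAt hs (𝓗.const_smul_holAt (-1) ht)
  rwa [neg_one_smul, ← sub_eq_add_neg] at h

lemma sum_holAt {ι : Type*} (u : Finset ι) {s : ι → Π x, F x} {x : X}
    (hs : ∀ i ∈ u, 𝓗.HolAt (s i) x) : 𝓗.HolAt (∑ i ∈ u, s i) x := by
  classical
  induction u using Finset.induction_on with
  | empty => simpa using 𝓗.zero_holAt x
  | insert a u ha ih =>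
    rw [Finset.sum_insert ha]
    exact 𝓗.add_holAt (hs a (Finset.mem_insert_self a u))
      (ih fun i hi => hs i (Finset.mem_insert_of_mem hi))

lemma sum_smul_holAt {ι : Type*} (u : Finset ι) {c : ι → X → ℂ} {s : ι → Π x, F x} {x : X}
    (hc : ∀ i ∈ u, HolFunAt I (c i) x) (hs : ∀ i ∈ u, 𝓗.HolAt (s i) x) :
    𝓗.HolAt (fun y => ∑ i ∈ u, c i y • s i y) x := by
  have h := 𝓗.sum_holAt u fun i hi => 𝓗.smul_holAt (hc i hi) (hs i hi)
  refine 𝓗.congr_holAt h (Eventually.of_forall fun y => ?_)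
  simp

end HolSheaf

open Classical in
/-- The coefficients of the section `s` with respect to the sections `e 1, …, e n` (and `0` at the
points where they are not a basis). -/
def frameCoeff {n : ℕ} (e : Fin n → Π x, F x) (s : Π x, F x) (i : Fin n) (x : X) : ℂ :=
  if h : LinearIndependent ℂ (fun i => e i x) ∧ ⊤ ≤ Submodule.span ℂ (range fun i => e i x) then
    (Module.Basis.mk h.1 h.2).repr (s x) i
  else 0

namespace HolSheaf.IsFrameOn

variable {𝓗 : HolSheaf I F} {n : ℕ} {e : Fin n → Π x, F x} {U : Set X}

lemma mono (he : 𝓗.IsFrameOn e U) {U' : Set X} (h : U' ⊆ U) : 𝓗.IsFrameOn e U' where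
  linearIndependent x hx := he.linearIndependent x (h hx)
  span_eq_top x hx := he.span_eq_top x (h hx)
  holAt_iff x hx := he.holAt_iff x (h hx)

/-- The basis of the fibre given by a frame. -/
def basis (he : 𝓗.IsFrameOn e U) {x : X} (hx : x ∈ U) : Module.Basis (Fin n) ℂ (F x) :=
  Module.Basis.mk (he.linearIndependent x hx) (he.span_eq_top x hx).ge

@[simp]
lemma basis_apply (he : 𝓗.IsFrameOn e U) {x : X} (hx : x ∈ U) (i : Fin n) :
    he.basis hx i = e i x := by
  simp [basis]

lemma coe_basis (he : 𝓗.IsFrameOn e U) {x : X} (hx : x ∈ U) :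
    ⇑(he.basis hx) = fun i => e i x := funext fun i => he.basis_apply hx i

lemma basis_repr (he : 𝓗.IsFrameOn e U) {x : X} (hx : x ∈ U) (s : Π x, F x) (i : Fin n) :
    (he.basis hx).repr (s x) i = frameCoeff e s i x := by
  rw [frameCoeff, dif_pos ⟨he.linearIndependent x hx, (he.span_eq_top x hx).ge⟩, basis]

lemma sum_coeff (he : 𝓗.IsFrameOn e U) {x : X} (hx : x ∈ U) (s : Π x, F x) :
    ∑ i, frameCoeff e s i x • e i x = s x := by
  conv_rhs => rw [← (he.basis hx).sum_repr (s x)]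
  simp [he.basis_repr hx]

lemma coeff_eq (he : 𝓗.IsFrameOn e U) {x : X} (hx : x ∈ U) {s : Π x, F x} {c : Fin n → ℂ}
    (h : s x = ∑ i, c i • e i x) (i : Fin n) : frameCoeff e s i x = c i := by
  have h' : s x = ∑ i, c i • he.basis hx i := by simpa using h
  rw [← he.basis_repr hx, h', (he.basis hx).repr_sum_self c]

lemma holAt (he : 𝓗.IsFrameOn e U) {x : X} (hx : x ∈ U) (i : Fin n) : 𝓗.HolAt (e i) x := by
  classical
  refine (he.holAt_iff x hx (e i)).2 ⟨fun j _ => if j = i then 1 else 0,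
    fun j => contMDiffAt_const, Eventually.of_forall fun y => ?_⟩
  simp

/-- `holAt_iff` only provides some holomorphic coefficients; by linear independence they agree with
`frameCoeff` on the part of `U` where the expansion holds, which is a neighbourhood of `x`. -/
lemma coeff_holFunAt (he : 𝓗.IsFrameOn e U) {x : X} (hx : U ∈ 𝓝 x) {s : Π x, F x}
    (hs : 𝓗.HolAt s x) (i : Fin n) : HolFunAt I (frameCoeff e s i) x := by
  obtain ⟨c, hc, h⟩ := (he.holAt_iff x (mem_of_mem_nhds hx) s).1 hs
  refine (hc i).congr_of_eventuallyEq ?_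
  filter_upwards [h, hx] with y hy hyU
  exact he.coeff_eq hyU hy i

lemma eventually_sum_coeff (he : 𝓗.IsFrameOn e U) {x : X} (hx : U ∈ 𝓝 x) (s : Π x, F x) :
    ∀ᶠ y in 𝓝 x, s y = ∑ i, frameCoeff e s i y • e i y := by
  filter_upwards [hx] with y hy
  exact (he.sum_coeff hy s).symm

lemma mem_span_iff (he : 𝓗.IsFrameOn e U) {x : X} (hx : x ∈ U) (S : Set (Fin n)) (s : Π x, F x) :
    s x ∈ Submodule.span ℂ ((fun i => e i x) '' S) ↔ ∀ i ∉ S, frameCoeff e s i x = 0 := by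
  rw [← he.coe_basis hx, Module.Basis.mem_span_image]
  constructor
  · intro h i hi
    rw [← he.basis_repr hx]
    by_contra h0
    exact hi (h (by simpa using h0))
  · intro h i hi
    by_contra hS
    simp [he.basis_repr hx, h i hS] at hi

lemma finrank_eq (he : 𝓗.IsFrameOn e U) {x : X} (hx : x ∈ U) : Module.finrank ℂ (F x) = n := by
  simpa using Module.finrank_eq_card_basis (he.basis hx)

lemma finrank_span (he : 𝓗.IsFrameOn e U) {x : X} (hx : x ∈ U) (S : Set (Fin n)) :
    Module.finrank ℂ (Submodule.span ℂ ((fun i => e i x) '' S)) = S.ncard := by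
  classical
  have h := (he.linearIndependent x hx).comp ((↑) : S → Fin n) Subtype.val_injective
  have h2 := finrank_span_eq_card h
  rw [← Nat.card_eq_fintype_card, Nat.card_coe_set_eq] at h2
  rw [← h2, image_eq_range]
  rfl

end HolSheaf.IsFrameOn

lemma holFunAt_det {ι : Type*} [Fintype ι] [DecidableEq ι] {A : X → Matrix ι ι ℂ} {x : X}
    (hA : ∀ i j, HolFunAt I (fun y => A y i j) x) : HolFunAt I (fun y => (A y).det) x := by
  simp only [Matrix.det_apply']
  refine contMDiffAt_finsetSum fun σ _ => ?_
  exact ContMDiffAt.mul contMDiffAt_const (contMDiffAt_finsetProd fun i _ => hA _ _)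

/-- Cramer's rule: the entries of the adjugate are determinants of matrices with holomorphic
entries, and the determinant does not vanish at `x`. -/
lemma holFunAt_inv_matrix {ι : Type*} [Fintype ι] [DecidableEq ι] {A : X → Matrix ι ι ℂ} {x : X}
    (hA : ∀ i j, HolFunAt I (fun y => A y i j) x) (hx : (A x).det ≠ 0) (i j : ι) :
    HolFunAt I (fun y => (A y)⁻¹ i j) x := by
  simp only [Matrix.inv_def, Matrix.smul_apply, Ring.inverse_eq_inv', smul_eq_mul]
  refine ContMDiffAt.mul ?_ ?_
  · exact (contMDiffAt_iff_contDiffAt.2 (contDiffAt_inv ℂ hx)).comp x (holFunAt_det hA)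
  · simp only [Matrix.adjugate_apply]
    refine holFunAt_det fun a b => ?_
    by_cases h : a = j
    · subst h
      simpa using contMDiffAt_const
    · simpa [Matrix.updateRow_ne h] using hA a b

/-- Holomorphic sections, as many as the rank, that are linearly independent at a point form a frame
near that point. -/
lemma HolSheaf.IsFrameOn.exists_frame_of_linearIndependent {𝓗 : HolSheaf I F} {n : ℕ}
    {e : Fin n → Π x, F x} {U : Set X} (he : 𝓗.IsFrameOn e U) {x : X} (hx : U ∈ 𝓝 x)
    {g : Fin n → Π x, F x} (hg : ∀ j, 𝓗.HolAt (g j) x)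
    (hli : LinearIndependent ℂ fun j => g j x) : ∃ U' ∈ 𝓝 x, 𝓗.IsFrameOn g U' := by
  classical
  -- `A` is the matrix of the `g j` in the frame `e`. It is holomorphic and invertible at `x`, hence
  -- near `x`, and its inverse carries expansions in `e` to expansions in `g`.
  let A : X → Matrix (Fin n) (Fin n) ℂ := fun y => .of fun i j => frameCoeff e (g j) i y
  have hA : ∀ i j, HolFunAt I (fun y => A y i j) x := fun i j => he.coeff_holFunAt hx (hg j) i
  have hdet : (A x).det ≠ 0 := by
    have hxU := mem_of_mem_nhds hx
    have hcard : Fintype.card (Fin n) = Module.finrank ℂ (F x) := by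
      rw [he.finrank_eq hxU, Fintype.card_fin]
    have := Module.Finite.of_basis (he.basis hxU)
    let b := basisOfLinearIndependentOfCardEqFinrank' (fun j => g j x) hli hcard
    have hb : A x = (he.basis hxU).toMatrix b := by
      ext i j
      simp [A, b, Module.Basis.toMatrix_apply, he.basis_repr hxU]
    rw [hb]
    have := Module.Basis.isUnit_det (he.basis hxU) b
    rw [Module.Basis.det_apply] at this
    exact this.ne_zero
  -- The interior is needed because coefficients are holomorphic only at points that have `U` as a
  -- neighbourhood.
  have hU : ∀ᶠ y in 𝓝 x, y ∈ interior U ∧ (A y).det ≠ 0 ∧ ∀ j, 𝓗.HolAt (g j) y := by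
    refine Eventually.and (isOpen_interior.mem_nhds (mem_interior_iff_mem_nhds.2 hx))
      (Eventually.and ?_ ?_)
    · exact (holFunAt_det hA).continuousAt.eventually_ne hdet
    · exact eventually_all.2 fun j => 𝓗.eventually_holAt (hg j)
  have hexp : ∀ y ∈ U, ∀ j, g j y = ∑ i, A y i j • e i y := fun y hy j =>
    (he.sum_coeff hy (g j)).symm
  have hinv : ∀ y ∈ U, (A y).det ≠ 0 → ∀ i, e i y = ∑ j, (A y)⁻¹ j i • g j y := by
    intro y hy hd i
    have h1 : A y * (A y)⁻¹ = 1 := Matrix.mul_nonsing_inv _ (isUnit_iff_ne_zero.2 hd)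
    simp_rw [hexp y hy, Finset.smul_sum, smul_smul]
    rw [Finset.sum_comm]
    simp_rw [← Finset.sum_smul]
    have : ∀ k, ∑ j, (A y)⁻¹ j i * A y k j = (1 : Matrix (Fin n) (Fin n) ℂ) k i := by
      intro k
      rw [← h1, Matrix.mul_apply]
      exact Finset.sum_congr rfl fun j _ => mul_comm _ _
    simp [this, Matrix.one_apply]
  refine ⟨_, hU, ?_, ?_, ?_⟩
  · rintro y ⟨hyU, hd, hh⟩
    have hyU := interior_subset hyU
    refine linearIndependent_of_top_le_span_of_card_eq_finrank ?_ (by simp [he.finrank_eq hyU])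
    rw [← he.span_eq_top y hyU, Submodule.span_le]
    rintro _ ⟨i, rfl⟩
    simp only [hinv y hyU hd i]
    exact Submodule.sum_mem _ fun j _ =>
      Submodule.smul_mem _ _ (Submodule.subset_span ⟨j, rfl⟩)
  · rintro y ⟨hyU, hd, hh⟩
    have hyU := interior_subset hyU
    rw [eq_top_iff, ← he.span_eq_top y hyU, Submodule.span_le]
    rintro _ ⟨i, rfl⟩
    simp only [hinv y hyU hd i]
    exact Submodule.sum_mem _ fun j _ =>
      Submodule.smul_mem _ _ (Submodule.subset_span ⟨j, rfl⟩)
  · rintro y ⟨hyU, hd, hh⟩ s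
    have hyn : U ∈ 𝓝 y := mem_interior_iff_mem_nhds.1 hyU
    have hAy : ∀ i j, HolFunAt I (fun y => A y i j) y := fun i j => he.coeff_holFunAt hyn (hh j) i
    constructor
    · intro hs
      refine ⟨fun j z => ∑ i, frameCoeff e s i z * (A z)⁻¹ j i, fun j => ?_, ?_⟩
      · exact contMDiffAt_finsetSum fun i _ =>
          (he.coeff_holFunAt hyn hs i).mul (holFunAt_inv_matrix hAy hd j i)
      · filter_upwards [hyn, (holFunAt_det hAy).continuousAt.eventually_ne hd] with z hz hdz
        rw [← he.sum_coeff hz s]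
        simp_rw [Finset.sum_smul, mul_smul]
        rw [Finset.sum_comm]
        refine Finset.sum_congr rfl fun i _ => ?_
        rw [← Finset.smul_sum, ← hinv z hz hdz i]
    · rintro ⟨c, hc, h⟩
      rw [𝓗.holAt_congr h]
      exact 𝓗.sum_smul_holAt _ (fun i _ => hc i) fun i _ => hh i

/-- Near every point there is a frame that is adapted to two given subbundles `W' ≤ W`. -/
lemma HolSheaf.IsSubbundle.exists_adapted_frame {𝓗 : HolSheaf I F} {W' W : Π x, Submodule ℂ (F x)}
    (hW' : 𝓗.IsSubbundle W') (hW : 𝓗.IsSubbundle W) (hle : ∀ x, W' x ≤ W x) (x : X) :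
    ∃ U, IsOpen U ∧ x ∈ U ∧ ∃ (n : ℕ) (g : Fin n → Π x, F x) (T S : Set (Fin n)),
      𝓗.IsFrameOn g U ∧ (∀ y ∈ U, W' y = Submodule.span ℂ ((fun i => g i y) '' T)) ∧
      ∀ y ∈ U, W y = Submodule.span ℂ ((fun i => g i y) '' S) := by
  classical
  obtain ⟨U₁, hU₁, m, f, T₀, hf, hfW⟩ := hW' x
  obtain ⟨U₂, hU₂, n, e, S₀, he, heW⟩ := hW x
  have hx₁ := mem_of_mem_nhds hU₁
  have hx₂ := mem_of_mem_nhds hU₂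
  -- The two subbundles come with unrelated frames `f` and `e`. At the single point `x`, the part of
  -- `f` that spans `W'` is extended by vectors of `e` lying in `W` to a basis `b₁` of `W x`, and
  -- then to a basis `b₂` of the whole fibre. The same sections remain a frame near `x`.
  let h : Fin m ⊕ Fin n → Π x, F x := Sum.elim f e
  let v : Fin m ⊕ Fin n → F x := fun i => h i x
  have hT : LinearIndepOn ℂ v (Sum.inl '' T₀) :=
    LinearIndepOn.image_of_comp Sum.inl v ((hf.linearIndependent x hx₁).linearIndepOn T₀)
  obtain ⟨b₁, hb₁, hTb, hspan₁, hli₁⟩ := exists_linearIndepOn_extension hT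
    (subset_union_left (t := Sum.inr '' S₀))
  obtain ⟨b₂, -, hb, hspan₂, hli₂⟩ := exists_linearIndepOn_extension hli₁ (subset_univ b₁)
  have htop : Submodule.span ℂ (v '' b₂) = ⊤ := by
    rw [eq_top_iff, ← he.span_eq_top x hx₂, Submodule.span_le]
    rintro _ ⟨i, rfl⟩
    exact hspan₂ ⟨Sum.inr i, mem_univ _, rfl⟩
  have hcard : Fintype.card b₂ = n := by
    have h1 := finrank_span_eq_card hli₂
    have h2 : Submodule.span ℂ (range fun i : b₂ => v i) = ⊤ := by rw [← htop, image_eq_range]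
    rw [h2, finrank_top, he.finrank_eq hx₂] at h1
    exact h1.symm
  let φ : Fin n ≃ b₂ := (Fintype.equivFinOfCardEq hcard).symm
  let g : Fin n → Π x, F x := fun j => h (φ j)
  obtain ⟨U₃, hU₃, hg⟩ := he.exists_frame_of_linearIndependent hU₂ (g := g)
    (fun j => by
      change 𝓗.HolAt (h (φ j).1) x
      rcases (φ j).1 with i | i
      exacts [hf.holAt hx₁ i, he.holAt hx₂ i])
    (LinearIndependent.comp hli₂ φ φ.injective)
  have him : ∀ (b : Set (Fin m ⊕ Fin n)) (_ : b ⊆ b₂) (y : X),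
      (fun j => g j y) '' {j | (φ j).1 ∈ b} = (fun i => h i y) '' b := by
    intro b hbb y
    ext w
    constructor
    · rintro ⟨j, hj, rfl⟩
      exact ⟨(φ j).1, hj, rfl⟩
    · rintro ⟨i, hi, rfl⟩
      exact ⟨φ.symm ⟨i, hbb hi⟩, by simpa using hi, by simp [g]⟩
  have hT' : ∀ y ∈ U₁, W' y =
      Submodule.span ℂ ((fun j => g j y) '' {j | (φ j).1 ∈ Sum.inl '' T₀}) := by
    intro y hy
    rw [hfW y hy, him _ (hTb.trans hb), image_image]
    rfl
  have hS : ∀ y ∈ U₂, y ∈ U₁ → Submodule.span ℂ ((fun j => g j y) '' {j | (φ j).1 ∈ b₁}) ≤ W y := by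
    intro y hy hy'
    rw [him _ hb, Submodule.span_le]
    rintro _ ⟨i, hi, rfl⟩
    rcases hb₁ hi with ⟨t, ht, rfl⟩ | ⟨t, ht, rfl⟩
    · refine hle y ?_
      rw [hfW y hy']
      exact Submodule.subset_span ⟨t, ht, rfl⟩
    · change e t y ∈ W y
      rw [heW y hy]
      exact Submodule.subset_span ⟨t, ht, rfl⟩
  have hx₃ := mem_of_mem_nhds hU₃
  -- Near `x` the sections in `b₁` lie in `W`, using `W' ≤ W`. They span it because the dimension of
  -- either space there is the cardinality of an index set, and these agree since the spaces agree
  -- at `x`.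
  have hncard : ({j | (φ j).1 ∈ b₁} : Set (Fin n)).ncard = S₀.ncard := by
    rw [← hg.finrank_span hx₃, ← he.finrank_span hx₂, ← heW x hx₂]
    refine congrArg (fun p : Submodule ℂ (F x) => Module.finrank ℂ p) ?_
    refine le_antisymm (hS x hx₂ hx₁) ?_
    rw [heW x hx₂, him _ hb, Submodule.span_le]
    rintro _ ⟨i, hi, rfl⟩
    exact hspan₁ ⟨Sum.inr i, Or.inr ⟨i, hi, rfl⟩, rfl⟩
  refine ⟨interior (U₁ ∩ U₂ ∩ U₃), isOpen_interior,
    mem_interior_iff_mem_nhds.2 (inter_mem (inter_mem hU₁ hU₂) hU₃), n, g,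
    {j | (φ j).1 ∈ Sum.inl '' T₀}, {j | (φ j).1 ∈ b₁}, hg.mono (interior_subset.trans inter_subset_right),
    fun y hy => hT' y (interior_subset hy).1.1, fun y hy => ?_⟩
  obtain ⟨⟨hy₁, hy₂⟩, hy₃⟩ := interior_subset hy
  have := Module.Finite.of_basis (he.basis hy₂)
  refine (Submodule.eq_of_le_of_finrank_eq (hS y hy₂ hy₁) ?_).symm
  rw [hg.finrank_span hy₃, hncard, heW y hy₂, he.finrank_span hy₂]

end Frames

/-! ### Graded pieces and their frames. -/

section Graded

variable {B : Type*} [NormedAddCommGroup B] [NormedSpace ℂ B] {H : Type*} [TopologicalSpace H]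
  {I : ModelWithCorners ℂ B H} {X : Type*} [TopologicalSpace X] [ChartedSpace H X]
  {F : X → Type*} [∀ x, AddCommGroup (F x)] [∀ x, Module ℂ (F x)]
  {W : ℤ → Π x, Submodule ℂ (F x)} {k : ℤ} {x : X}

lemma toGr_add {v w : F x} (hv : v ∈ W k x) (hw : w ∈ W k x) :
    toGr W k x (v + w) = toGr W k x v + toGr W k x w := by
  rw [toGr_of_mem W k hv, toGr_of_mem W k hw, toGr_of_mem W k (add_mem hv hw)]
  rfl

lemma toGr_smul (c : ℂ) {v : F x} (hv : v ∈ W k x) :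
    toGr W k x (c • v) = c • toGr W k x v := by
  rw [toGr_of_mem W k hv, toGr_of_mem W k (Submodule.smul_mem _ c hv)]
  rfl

lemma toGr_sub {v w : F x} (hv : v ∈ W k x) (hw : w ∈ W k x) :
    toGr W k x (v - w) = toGr W k x v - toGr W k x w := by
  rw [toGr_of_mem W k hv, toGr_of_mem W k hw, toGr_of_mem W k (sub_mem hv hw)]
  rfl

lemma toGr_zero : toGr W k x 0 = 0 := by
  rw [toGr_of_mem W k (zero_mem _)]
  rfl

lemma toGr_sum {ι : Type*} (u : Finset ι) {v : ι → F x} (hv : ∀ i ∈ u, v i ∈ W k x) :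
    toGr W k x (∑ i ∈ u, v i) = ∑ i ∈ u, toGr W k x (v i) := by
  classical
  induction u using Finset.induction_on with
  | empty => simpa using toGr_zero
  | insert a u ha ih =>
    have h := fun i hi => hv i (Finset.mem_insert_of_mem hi)
    rw [Finset.sum_insert ha, Finset.sum_insert ha,
      toGr_add (hv a (Finset.mem_insert_self a u)) (sum_mem h), ih h]

lemma toGr_eq_zero_iff {v : F x} (hv : v ∈ W k x) : toGr W k x v = 0 ↔ v ∈ W (k - 1) x := by
  rw [toGr_of_mem W k hv, Submodule.Quotient.mk_eq_zero]
  rfl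

lemma exists_toGr_eq (q : Gr W k x) : ∃ v ∈ W k x, toGr W k x v = q := by
  obtain ⟨⟨v, hv⟩, rfl⟩ := Submodule.Quotient.mk_surjective _ q
  exact ⟨v, hv, toGr_of_mem W k hv⟩

variable {𝓗 : HolSheaf I F} {n : ℕ} {g : Fin n → Π x, F x} {U : Set X} {T S : Set (Fin n)}

/-- A frame that is adapted to `W_{k-1} ⊆ W_k` induces a frame of `Gr_k^W`. -/
lemma HolSheaf.IsFrameOn.gr (hg : 𝓗.IsFrameOn g U) (hU : IsOpen U)
    (hT : ∀ y ∈ U, W (k - 1) y = Submodule.span ℂ ((fun i => g i y) '' T))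
    (hS : ∀ y ∈ U, W k y = Submodule.span ℂ ((fun i => g i y) '' S)) {r : ℕ}
    (φ : Fin r ≃ ↥(S \ T)) :
    (𝓗.gr W k).IsFrameOn (fun a y => toGr W k y (g (φ a) y)) U := by
  classical
  have hmem : ∀ y ∈ U, ∀ i ∈ S, g i y ∈ W k y := fun y hy i hi => by
    rw [hS y hy]; exact Submodule.subset_span ⟨i, hi, rfl⟩
  -- In the class of a combination of the `g i` with `i ∈ S`, the terms with `i ∈ T` die because
  -- they lie in `W (k - 1)`; only `S \ T` is left.
  have hsum : ∀ y ∈ U, ∀ c : Fin n → ℂ, (∀ i ∉ S, c i = 0) → ∑ i, c i • g i y ∈ W k y ∧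
      toGr W k y (∑ i, c i • g i y) = ∑ a, c (φ a) • toGr W k y (g (φ a) y) := by
    intro y hy c hc
    have hm : ∀ i ∈ Finset.univ, c i • g i y ∈ W k y := fun i _ => by
      by_cases hi : i ∈ S
      · exact Submodule.smul_mem _ _ (hmem y hy i hi)
      · simp [hc i hi]
    refine ⟨sum_mem hm, ?_⟩
    rw [toGr_sum _ hm]
    refine (Fintype.sum_of_injective (fun a => (φ a : Fin n))
      (Subtype.val_injective.comp φ.injective) _ _ (fun i hi => ?_) fun a => ?_).symm
    · by_cases hiS : i ∈ S
      · have hiT : i ∈ T := by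
          by_contra hiT
          exact hi ⟨φ.symm ⟨i, hiS, hiT⟩, by simp⟩
        rw [toGr_eq_zero_iff (hm i (Finset.mem_univ i)), hT y hy]
        exact Submodule.smul_mem _ _ (Submodule.subset_span ⟨i, hiT, rfl⟩)
      · rw [hc i hiS, zero_smul, toGr_zero]
    · exact (toGr_smul _ (hmem y hy _ (φ a).2.1)).symm
  refine ⟨fun y hy => ?_, fun y hy => ?_, fun y hy q => ?_⟩
  · rw [Fintype.linearIndependent_iff]
    intro c hc a
    -- Extended by zero, a relation between the classes becomes a combination of the `g i` that lies
    -- in the span of `T`. Its coefficients off `T` must then vanish.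
    let c' : Fin n → ℂ := fun i => if h : i ∈ S \ T then c (φ.symm ⟨i, h⟩) else 0
    have hc' : ∀ a, c' (φ a) = c a := fun a => by
      simp only [c', dif_pos (φ a).2, Subtype.coe_eta, Equiv.symm_apply_apply]
    obtain ⟨h1, h2⟩ := hsum y hy c' fun i hi => dif_neg fun h => hi h.1
    simp only [hc', hc] at h2
    rw [toGr_eq_zero_iff h1, hT y hy] at h2
    have h3 := (hg.mem_span_iff hy T fun z => ∑ i, c' i • g i z).1 h2 (φ a) (φ a).2.2
    rwa [hg.coeff_eq hy (c := c') rfl, hc'] at h3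
  · rw [eq_top_iff]
    rintro q -
    obtain ⟨v, hv, rfl⟩ := exists_toGr_eq q
    -- The vector is made the value of a section, since `frameCoeff` takes sections; nothing is
    -- required of this section off `y`.
    obtain ⟨s, rfl⟩ : ∃ s : Π x, F x, s y = v := ⟨Function.update 0 y v, by simp⟩
    rw [hS y hy] at hv
    have h := (hsum y hy (fun i => frameCoeff g s i y) ((hg.mem_span_iff hy S s).1 hv)).2
    rw [hg.sum_coeff hy s] at h
    rw [h]
    exact sum_mem fun a _ => Submodule.smul_mem _ _ (Submodule.subset_span ⟨a, rfl⟩)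
  · have hyU := hU.mem_nhds hy
    constructor
    · rintro ⟨s, hs, h⟩
      refine ⟨fun a => frameCoeff g s (φ a), fun a => hg.coeff_holFunAt hyU hs _, ?_⟩
      filter_upwards [hyU, h] with z hz hsz
      have hsz' := hsz.1
      rw [hS z hz] at hsz'
      have h := (hsum z hz (fun i => frameCoeff g s i z) ((hg.mem_span_iff hz S s).1 hsz')).2
      rw [hg.sum_coeff hz s] at h
      rw [hsz.2, h]
    · rintro ⟨c, hc, h⟩
      refine ⟨fun z => ∑ a, c a z • g (φ a) z,
        𝓗.sum_smul_holAt _ (fun a _ => hc a) fun a _ => hg.holAt hy _, ?_⟩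
      filter_upwards [hyU, h] with z hz hqz
      have hm : ∀ a ∈ Finset.univ, c a z • g (φ a) z ∈ W k z := fun a _ =>
        Submodule.smul_mem _ _ (hmem z hz _ (φ a).2.1)
      refine ⟨sum_mem hm, ?_⟩
      rw [hqz, toGr_sum _ hm]
      exact Finset.sum_congr rfl fun a _ => (toGr_smul _ (hmem z hz _ (φ a).2.1)).symm

end Graded

/-! ### Connections in terms of frames, and the induced connections on graded pieces. -/

section ConnectionLemmas

set_option linter.unusedSectionVars false

variable {B : Type*} [NormedAddCommGroup B] [NormedSpace ℂ B] {H : Type*} [TopologicalSpace H]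
  {I : ModelWithCorners ℂ B H} {X : Type*} [TopologicalSpace X] [ChartedSpace H X]
  {F : X → Type*} [∀ x, AddCommGroup (F x)] [∀ x, Module ℂ (F x)]

lemma HolFunAt.mdifferentiableAt {f : X → ℂ} {x : X} (hf : HolFunAt I f x) :
    MDifferentiableAt I 𝓘(ℂ, ℂ) f x :=
  ContMDiffAt.mdifferentiableAt hf (by simp)

variable [IsManifold I ω X]

/-- The properties of a connection that determine it on the sections spanned by given ones. -/
structure IsLeibnizOn (𝓗 : HolSheaf I F) (D : ConnOp I F) (U : Set X) : Prop where
  congr : ∀ x ∈ U, ∀ s t, 𝓗.HolAt s x → (∀ᶠ y in 𝓝 x, s y = t y) → D s x = D t x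
  add : ∀ x ∈ U, ∀ s t, 𝓗.HolAt s x → 𝓗.HolAt t x → D (s + t) x = D s x + D t x
  leibniz : ∀ x ∈ U, ∀ (f : X → ℂ) s, HolFunAt I f x → 𝓗.HolAt s x → ∀ v : TangentSpace I x,
    D (f • s) x v = f x • D s x v + mvfderiv I f x v • s x

lemma IsConnectionOn.isLeibnizOn {𝓗 : HolSheaf I F} {D : ConnOp I F} {U : Set X}
    (hD : IsConnectionOn 𝓗 D U) : IsLeibnizOn 𝓗 D U :=
  ⟨hD.congr, hD.add, hD.leibniz⟩

namespace IsLeibnizOn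

variable {𝓗 : HolSheaf I F} {D : ConnOp I F} {U : Set X} {x : X}

lemma const_smul (hD : IsLeibnizOn 𝓗 D U) (hx : x ∈ U) (c : ℂ) {s : Π x, F x}
    (hs : 𝓗.HolAt s x) (v : TangentSpace I x) : D (c • s) x v = c • D s x v := by
  have h := hD.leibniz x hx (fun _ => c) s contMDiffAt_const hs v
  rw [mvfderiv_const] at h
  simpa using! h

lemma sub (hD : IsLeibnizOn 𝓗 D U) (hx : x ∈ U) {s t : Π x, F x}
    (hs : 𝓗.HolAt s x) (ht : 𝓗.HolAt t x) (v : TangentSpace I x) :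
    D (s - t) x v = D s x v - D t x v := by
  have h : s - t = s + (-1 : ℂ) • t := by rw [neg_one_smul, sub_eq_add_neg]
  rw [h, hD.add x hx _ _ hs (𝓗.const_smul_holAt _ ht), LinearMap.add_apply,
    hD.const_smul hx _ ht, neg_one_smul, sub_eq_add_neg]

lemma sum (hD : IsLeibnizOn 𝓗 D U) (hx : x ∈ U) {ι : Type*} (u : Finset ι) {s : ι → Π x, F x}
    (hs : ∀ i ∈ u, 𝓗.HolAt (s i) x) (v : TangentSpace I x) :
    D (∑ i ∈ u, s i) x v = ∑ i ∈ u, D (s i) x v := by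
  classical
  induction u using Finset.induction_on with
  | empty =>
    have h := hD.const_smul hx 0 (𝓗.zero_holAt x) v
    simpa using h
  | insert a u ha ih =>
    have h := fun i hi => hs i (Finset.mem_insert_of_mem hi)
    rw [Finset.sum_insert ha, Finset.sum_insert ha,
      hD.add x hx _ _ (hs a (Finset.mem_insert_self a u)) (𝓗.sum_holAt u h), LinearMap.add_apply,
      ih h]

lemma eq_sum (hD : IsLeibnizOn 𝓗 D U) (hx : x ∈ U) {ι : Type*} (u : Finset ι)
    {s : Π x, F x} {c : ι → X → ℂ} {e : ι → Π x, F x} (hs : 𝓗.HolAt s x)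
    (hc : ∀ i ∈ u, HolFunAt I (c i) x) (he : ∀ i ∈ u, 𝓗.HolAt (e i) x)
    (h : ∀ᶠ y in 𝓝 x, s y = ∑ i ∈ u, c i y • e i y) (v : TangentSpace I x) :
    D s x v = ∑ i ∈ u, (c i x • D (e i) x v + mvfderiv I (c i) x v • e i x) := by
  have h1 : D s x = D (∑ i ∈ u, c i • e i) x := hD.congr x hx _ _ hs (by simpa using h)
  rw [h1, hD.sum hx u fun i hi => 𝓗.smul_holAt (hc i hi) (he i hi)]
  exact Finset.sum_congr rfl fun i hi => hD.leibniz x hx _ _ (hc i hi) (he i hi) v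

end IsLeibnizOn

variable {𝓗 : HolSheaf I F} {D : ConnOp I F} {W : ℤ → Π x, Submodule ℂ (F x)} {k : ℤ} {U : Set X}

omit [IsManifold I ω X] in
lemma IsLiftAt.eventually {q : Π x, Gr W k x} {s : Π x, F x} {x : X} (h : IsLiftAt 𝓗 W k q s x) :
    ∀ᶠ y in 𝓝 x, IsLiftAt 𝓗 W k q s y := by
  filter_upwards [𝓗.eventually_holAt h.1, h.2.eventually_nhds] with y h1 h2
  exact ⟨h1, h2⟩

/-- `grConn` is defined by an arbitrary choice of lift. Two lifts differ by a section of `W (k -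
1)`, which `D` preserves, so any lift computes it. -/
lemma grConn_apply (hD : IsConnectionOn 𝓗 D U) (hW : IsFlatSubbundleOn 𝓗 D (W k) U)
    (hW' : IsFlatSubbundleOn 𝓗 D (W (k - 1)) U) {x : X} (hx : x ∈ U) {q : Π x, Gr W k x}
    {s : Π x, F x} (hs : IsLiftAt 𝓗 W k q s x) (v : TangentSpace I x) :
    D s x v ∈ W k x ∧ grConn 𝓗 D W k q x v = toGr W k x (D s x v) := by
  have hmem : ∀ s, IsLiftAt 𝓗 W k q s x → ∀ v, D s x v ∈ W k x := fun s hs v =>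
    hW x hx s hs.1 (hs.2.mono fun y hy => hy.1) v
  refine ⟨hmem s hs v, ?_⟩
  have h : ∃ s, IsLiftAt 𝓗 W k q s x ∧ ∀ v : TangentSpace I x, D s x v ∈ W k x :=
    ⟨s, hs, hmem s hs⟩
  have h1 : grConn 𝓗 D W k q x v = toGr W k x (D h.choose x v) := by
    rw [grConn, dif_pos h, toGr_of_mem W k (h.choose_spec.2 v)]
    rfl
  have ht := h.choose_spec.1
  rw [h1, ← sub_eq_zero, ← toGr_sub (hmem _ ht v) (hmem _ hs v),
    toGr_eq_zero_iff (sub_mem (hmem _ ht v) (hmem _ hs v)), ← hD.isLeibnizOn.sub hx ht.1 hs.1]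
  refine hW' x hx _ (𝓗.sub_holAt ht.1 hs.1) ?_ v
  filter_upwards [ht.2, hs.2] with y h1 h2
  rw [Pi.sub_apply, ← toGr_eq_zero_iff (sub_mem h1.1 h2.1), toGr_sub h1.1 h2.1, ← h1.2, ← h2.2,
    sub_self]

/-- If `a D_ξ s` extends to a holomorphic section of `𝓗`, then `a D_ξ q` extends to a holomorphic
section of `Gr_k^W`, for the class `q` of `s`. -/
lemma exists_gr_extension (hD : IsConnectionOn 𝓗 D U) (hW : IsFlatSubbundleOn 𝓗 D (W k) U)
    (hW' : IsFlatSubbundleOn 𝓗 D (W (k - 1)) U) (hsub : 𝓗.IsSubbundle (W k)) {x : X}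
    {q : Π x, Gr W k x} {s : Π x, F x} (hs : IsLiftAt 𝓗 W k q s x) (a : X → ℂ)
    (ξ : Π x : X, TangentSpace I x)
    (h : ∃ r, 𝓗.HolAt r x ∧ ∀ᶠ y in 𝓝 x, y ∈ U → r y = a y • D s y (ξ y)) :
    ∃ r, (𝓗.gr W k).HolAt r x ∧
      ∀ᶠ y in 𝓝 x, y ∈ U → r y = a y • grConn 𝓗 D W k q y (ξ y) := by
  classical
  obtain ⟨r, hr, hrD⟩ := h
  obtain ⟨N, hN, n, e, S, he, hS⟩ := hsub x
  have hxN := mem_of_mem_nhds hN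
  -- The section `r` lies in `W k` only over `U`, where it is a multiple of `D_ξ s`. Dropping its
  -- components outside `S` puts it in `W k` also off `U`, and changes nothing over `U`.
  let r' : Π x, F x := fun y => ∑ i ∈ Finset.univ.filter (· ∈ S), frameCoeff e r i y • e i y
  have hr' : 𝓗.HolAt r' x :=
    𝓗.sum_smul_holAt _ (fun i _ => he.coeff_holFunAt hN hr i) fun i _ => he.holAt hxN i
  have hmem : ∀ y ∈ N, r' y ∈ W k y := fun y hy => by
    rw [hS y hy]
    exact sum_mem fun i hi => Submodule.smul_mem _ _
      (Submodule.subset_span ⟨i, (Finset.mem_filter.1 hi).2, rfl⟩)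
  refine ⟨fun y => toGr W k y (r' y), ⟨r', hr', ?_⟩, ?_⟩
  · filter_upwards [hN] with y hy
    exact ⟨hmem y hy, rfl⟩
  · filter_upwards [hN, hrD, hs.eventually] with y hy hyr hys hyU
    obtain ⟨h1, h2⟩ := grConn_apply hD hW hW' hyU hys (ξ y)
    rw [h2, ← toGr_smul _ h1, ← hyr hyU]
    have h3 : r y ∈ W k y := by
      rw [hyr hyU]
      exact Submodule.smul_mem _ _ h1
    rw [hS y hy, he.mem_span_iff hy] at h3
    congr 1
    rw [← he.sum_coeff hy r]
    refine Finset.sum_subset (Finset.filter_subset _ _) fun i _ hi => ?_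
    rw [h3 i fun hiS => hi (Finset.mem_filter.2 ⟨Finset.mem_univ i, hiS⟩), zero_smul]

lemma grConn_isConnectionOn (hU : IsOpen U) (hD : IsConnectionOn 𝓗 D U)
    (hW : IsFlatSubbundleOn 𝓗 D (W k) U) (hW' : IsFlatSubbundleOn 𝓗 D (W (k - 1)) U) :
    IsConnectionOn (𝓗.gr W k) (grConn 𝓗 D W k) U where
  congr := by
    rintro x hx q q' ⟨s, hs⟩ h
    have hs' : IsLiftAt 𝓗 W k q' s x := ⟨hs.1, by
      filter_upwards [hs.2, h] with y h1 h2
      exact ⟨h1.1, h2 ▸ h1.2⟩⟩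
    ext v
    rw [(grConn_apply hD hW hW' hx hs v).2, (grConn_apply hD hW hW' hx hs' v).2]
  add := by
    rintro x hx q q' ⟨s, hs⟩ ⟨s', hs'⟩
    have h : IsLiftAt 𝓗 W k (q + q') (s + s') x := ⟨𝓗.add_holAt hs.1 hs'.1, by
      filter_upwards [hs.2, hs'.2] with y h1 h2
      refine ⟨add_mem h1.1 h2.1, ?_⟩
      rw [Pi.add_apply, Pi.add_apply, toGr_add h1.1 h2.1, h1.2, h2.2]⟩
    ext v
    obtain ⟨h1, h2⟩ := grConn_apply hD hW hW' hx hs v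
    obtain ⟨h1', h2'⟩ := grConn_apply hD hW hW' hx hs' v
    rw [(grConn_apply hD hW hW' hx h v).2, LinearMap.add_apply, h2, h2',
      hD.add x hx _ _ hs.1 hs'.1, LinearMap.add_apply, toGr_add h1 h1']
  leibniz := by
    rintro x hx f q hf ⟨s, hs⟩ v
    have h : IsLiftAt 𝓗 W k (f • q) (f • s) x := ⟨𝓗.smul_holAt hf hs.1, by
      filter_upwards [hs.2] with y h1
      refine ⟨Submodule.smul_mem _ _ h1.1, ?_⟩
      rw [Pi.smul_apply', Pi.smul_apply', toGr_smul _ h1.1, h1.2]⟩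
    obtain ⟨h1, h2⟩ := grConn_apply hD hW hW' hx hs v
    have h3 := hs.2.self_of_nhds
    rw [(grConn_apply hD hW hW' hx h v).2, h2, h3.2, hD.leibniz x hx f s hf hs.1,
      toGr_add (Submodule.smul_mem _ _ h1) (Submodule.smul_mem _ _ h3.1), toGr_smul _ h1,
      toGr_smul _ h3.1]
  holomorphic := by
    rintro x hx q ⟨s, hs⟩ ξ hξ
    refine ⟨fun y => D s y (ξ y), hD.holomorphic x hx s hs.1 ξ hξ, ?_⟩
    filter_upwards [hU.mem_nhds hx, hs.eventually] with y hy hys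
    exact grConn_apply hD hW hW' hy hys (ξ y)

/-- If `s` lifts `q`, then `D_ζ s` lifts the derivative of `q` along `ζ`. The curvature on `q` is
therefore the class of the curvature on `s`. -/
lemma grConn_isFlatOn (hU : IsOpen U) (hD : IsConnectionOn 𝓗 D U) (hflat : IsFlatOn 𝓗 D U)
    (hW : IsFlatSubbundleOn 𝓗 D (W k) U) (hW' : IsFlatSubbundleOn 𝓗 D (W (k - 1)) U) :
    IsFlatOn (𝓗.gr W k) (grConn 𝓗 D W k) U := by
  rintro x hx q ⟨s, hs⟩ ξ η hξ hη
  have key : ∀ ζ : Π x : X, TangentSpace I x, (HolSheaf.tangent I X).HolAt ζ x →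
      IsLiftAt 𝓗 W k (fun y => grConn 𝓗 D W k q y (ζ y)) (fun y => D s y (ζ y)) x := by
    refine fun ζ hζ => ⟨hD.holomorphic x hx s hs.1 ζ hζ, ?_⟩
    filter_upwards [hU.mem_nhds hx, hs.eventually] with y hy hys
    exact grConn_apply hD hW hW' hy hys (ζ y)
  obtain ⟨h1, h1'⟩ := grConn_apply hD hW hW' hx (key η hη) (ξ x)
  obtain ⟨h2, h2'⟩ := grConn_apply hD hW hW' hx (key ξ hξ) (η x)
  obtain ⟨h3, h3'⟩ := grConn_apply hD hW hW' hx hs (VectorField.mlieBracket I ξ η x)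
  rw [h1', h2', h3', ← toGr_sub h1 h2, ← toGr_sub (sub_mem h1 h2) h3, hflat x hx s hs.1 ξ η hξ hη,
    toGr_zero]

end ConnectionLemmas

end MixedFrob

/-! ### The coordinates `λ`, `1/λ` and the involution on `ℙ¹`. -/

namespace RiemannSphere

lemma contMDiff_coe : ContMDiff 𝓘(ℂ, ℂ) 𝓘(ℂ, ℂ) ω ((↑) : ℂ → OnePoint ℂ) := by
  have h : ContMDiffOn 𝓘(ℂ, ℂ) 𝓘(ℂ, ℂ) ω chartZero.symm chartZero.target :=
    contMDiffOn_symm_of_mem_maximalAtlas (IsManifold.subset_maximalAtlas (Or.inl rfl))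
  have ht : chartZero.target = univ := by simp [chartZero]
  rw [ht, contMDiffOn_univ] at h
  exact h.congr fun z => (chartZero_symm z).symm

lemma contMDiff_inv_coe : ContMDiff 𝓘(ℂ, ℂ) 𝓘(ℂ, ℂ) ω (fun z : ℂ => inv (z : OnePoint ℂ)) := by
  have h : ContMDiffOn 𝓘(ℂ, ℂ) 𝓘(ℂ, ℂ) ω chartInfty.symm chartInfty.target :=
    contMDiffOn_symm_of_mem_maximalAtlas (IsManifold.subset_maximalAtlas (Or.inr rfl))
  have ht : chartInfty.target = univ := by simp [chartInfty, chartZero]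
  rw [ht, contMDiffOn_univ] at h
  exact h.congr fun z => (chartInfty_symm z).symm

lemma chartAt_coe (z : ℂ) : chartAt ℂ (z : OnePoint ℂ) = chartZero :=
  if_neg (OnePoint.coe_ne_infty z)

lemma chartAt_infty : chartAt ℂ (OnePoint.infty : OnePoint ℂ) = chartInfty := if_pos rfl

end RiemannSphere

namespace MixedFrob

open RiemannSphere

section SphereLemmas

set_option linter.unusedSectionVars false

lemma coord_coe (z : ℂ) : coord (z : OnePoint ℂ) = z := rfl

lemma coord_infty : coord OnePoint.infty = 0 := rfl

lemma coe_coord {p : OnePoint ℂ} (hp : p ≠ OnePoint.infty) : (coord p : OnePoint ℂ) = p := by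
  induction p using OnePoint.rec with
  | infty => exact absurd rfl hp
  | coe z => rfl

lemma chartZero_eq_coord {p : OnePoint ℂ} (hp : p ≠ OnePoint.infty) : chartZero p = coord p := by
  rw [← coe_coord hp, chartZero_coe, coord_coe]

lemma coord_inv (p : OnePoint ℂ) : coord (inv p) = (coord p)⁻¹ := by
  induction p using OnePoint.rec with
  | infty => simp [inv_infty, coord_coe, coord_infty]
  | coe z =>
    by_cases hz : z = 0
    · simp [inv_coe, hz, coord_coe, coord_infty]
    · simp [inv_coe, hz, coord_coe]

lemma coord_ne_zero {p : OnePoint ℂ} (h0 : p ≠ ((0 : ℂ) : OnePoint ℂ))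
    (h1 : p ≠ OnePoint.infty) : coord p ≠ 0 := by
  intro h
  rw [← coe_coord h1, h] at h0
  exact h0 rfl

lemma chartInfty_eq_coord_inv {p : OnePoint ℂ} (hp : p ≠ ((0 : ℂ) : OnePoint ℂ)) :
    chartInfty p = (coord p)⁻¹ := by
  rw [chartInfty_apply, chartZero_eq_coord, coord_inv]
  intro h
  rw [← inv_inv p, h, inv_infty] at hp
  exact hp rfl

lemma holFunAt_coord {p : OnePoint ℂ} (hp : p ≠ OnePoint.infty) : HolFunAt 𝓘(ℂ, ℂ) coord p := by
  have h : ContMDiffAt 𝓘(ℂ, ℂ) 𝓘(ℂ, ℂ) ω (extChartAt 𝓘(ℂ, ℂ) p) p := contMDiffAt_extChartAt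
  refine h.congr_of_eventuallyEq ?_
  filter_upwards [isOpen_ne.mem_nhds hp] with q hq
  rw [← coe_coord hp]
  simp [chartAt_coe, chartZero_eq_coord hq]

/-- The conventions `coord ∞ = 0` and `0⁻¹ = 0` give this function the value `0` at `∞`, so it
coincides with the chart `1/λ` there and not only near it. -/
lemma holFunAt_coord_inv {p : OnePoint ℂ} (hp : p ≠ ((0 : ℂ) : OnePoint ℂ)) :
    HolFunAt 𝓘(ℂ, ℂ) (fun q => (coord q)⁻¹) p := by
  by_cases h1 : p = OnePoint.infty
  · subst h1
    have h : ContMDiffAt 𝓘(ℂ, ℂ) 𝓘(ℂ, ℂ) ω (extChartAt 𝓘(ℂ, ℂ) (OnePoint.infty : OnePoint ℂ))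
      OnePoint.infty := contMDiffAt_extChartAt
    refine h.congr_of_eventuallyEq ?_
    filter_upwards [isOpen_ne.mem_nhds hp] with q hq
    simp [chartAt_infty, chartInfty_eq_coord_inv hq]
  · exact (contMDiffAt_iff_contDiffAt.2 (contDiffAt_inv ℂ (coord_ne_zero hp h1))).comp p
      (holFunAt_coord h1)

lemma map_neg_map_neg (p : OnePoint ℂ) :
    OnePoint.map (fun z : ℂ => -z) (OnePoint.map (fun z : ℂ => -z) p) = p := by
  induction p using OnePoint.rec with
  | infty => rfl
  | coe z => simp [OnePoint.map_some]

lemma coord_map_neg (p : OnePoint ℂ) : coord (OnePoint.map (fun z : ℂ => -z) p) = -coord p := by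
  induction p using OnePoint.rec with
  | infty => simp [coord_infty]
  | coe z => simp [OnePoint.map_some, coord_coe]

lemma contMDiff_map_neg :
    ContMDiff 𝓘(ℂ, ℂ) 𝓘(ℂ, ℂ) ω (OnePoint.map (fun z : ℂ => -z) : OnePoint ℂ → OnePoint ℂ) := by
  intro p
  have hneg : ContMDiff 𝓘(ℂ, ℂ) 𝓘(ℂ, ℂ) ω (fun z : ℂ => -z) := contDiff_neg.contMDiff
  by_cases hp : p = OnePoint.infty
  · subst hp
    have h0 : (OnePoint.infty : OnePoint ℂ) ≠ ((0 : ℂ) : OnePoint ℂ) := OnePoint.infty_ne_coe _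
    refine ((contMDiff_inv_coe.comp hneg).contMDiffAt.comp _
      (holFunAt_coord_inv h0)).congr_of_eventuallyEq ?_
    filter_upwards [isOpen_ne.mem_nhds h0] with q hq
    induction q using OnePoint.rec with
    | infty => simp [coord_infty, inv_coe]
    | coe z =>
      have hz : z ≠ 0 := fun h => hq (by rw [h])
      simp [inv_coe, coord_coe, hz, OnePoint.map_some, inv_neg]
  · refine ((contMDiff_coe.comp hneg).contMDiffAt.comp p
      (holFunAt_coord hp)).congr_of_eventuallyEq ?_
    filter_upwards [isOpen_ne.mem_nhds hp] with q hq
    conv_lhs => rw [← coe_coord hq]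
    simp [OnePoint.map_some]

variable {V : Type*} [NormedAddCommGroup V] [NormedSpace ℂ V]
  {M : Type*} [TopologicalSpace M] [ChartedSpace V M]

lemma isOpen_cstar : IsOpen (cstar M) :=
  (isOpen_ne.preimage continuous_fst).inter (isOpen_ne.preimage continuous_fst)

lemma lam_ne_zero {x : OnePoint ℂ × M} (hx : x ∈ cstar M) : lam x ≠ 0 := coord_ne_zero hx.1 hx.2

lemma holFunAt_lam {x : OnePoint ℂ × M} (hx : x.1 ≠ OnePoint.infty) :
    HolFunAt (sphereModel V) lam x :=
  ContMDiffAt.comp x (holFunAt_coord hx) contMDiffAt_fst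

lemma holFunAt_lam_inv {x : OnePoint ℂ × M} (hx : x.1 ≠ ((0 : ℂ) : OnePoint ℂ)) :
    HolFunAt (sphereModel V) (fun y => (lam y)⁻¹) x :=
  ContMDiffAt.comp (g := fun q : OnePoint ℂ => (coord q)⁻¹) x (holFunAt_coord_inv hx)
    contMDiffAt_fst

lemma contMDiff_invol : ContMDiff (sphereModel V) (sphereModel V) ω (invol (M := M)) :=
  (contMDiff_map_neg.comp contMDiff_fst).prodMk contMDiff_snd

lemma lam_invol (x : OnePoint ℂ × M) : lam (invol x) = -lam x := coord_map_neg x.1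

lemma invol_mem_cstar {x : OnePoint ℂ × M} (hx : x ∈ cstar M) : invol x ∈ cstar M := by
  obtain ⟨p, t⟩ := x
  induction p using OnePoint.rec with
  | infty => exact absurd rfl hx.2
  | coe z =>
    refine ⟨fun h => hx.1 ?_, OnePoint.coe_ne_infty (-z)⟩
    have h' : -z = 0 := OnePoint.coe_injective h
    simp [neg_eq_zero.1 h']

/-- A function that is holomorphic along `ℙ¹ × {t}` is constant there. -/
lemma eq_of_holFunAt_sphere {f : OnePoint ℂ × M → ℂ} {t : M}
    (hf : ∀ l : OnePoint ℂ, HolFunAt (sphereModel V) f (l, t)) (l l' : OnePoint ℂ) :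
    f (l, t) = f (l', t) := by
  have h : MDifferentiable 𝓘(ℂ, ℂ) 𝓘(ℂ, ℂ) fun l : OnePoint ℂ => f (l, t) := fun l =>
    (ContMDiffAt.comp (f := fun l : OnePoint ℂ => (l, t)) l (hf l)
      (contMDiffAt_id.prodMk contMDiffAt_const)).mdifferentiableAt (by simp)
  exact MDifferentiable.apply_eq_of_compactSpace h l l'

end SphereLemmas

/-! ### The adjoint morphism. -/

lemma isTensorProduct_of_span {R A P Q ι : Type*} [Fintype ι] [CommRing R] [AddCommGroup A]
    [Module R A] [AddCommGroup P] [Module R P] [AddCommGroup Q] [Module R Q]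
    (f : A →ₗ[R] P →ₗ[R] Q) (v : ι → P) (hv : ∀ p, ∃ c : ι → R, p = ∑ i, c i • v i)
    (hinj : ∀ a : ι → A, ∑ i, f (a i) (v i) = 0 → a = 0)
    (hsurj : ∀ q, ∃ a : ι → A, ∑ i, f (a i) (v i) = q) : IsTensorProduct f := by
  -- Since the `v i` generate `P`, every tensor is a sum of `a i ⊗ v i`. Injectivity then only has
  -- to be tested on such sums, and freeness of `P` is not needed beforehand.
  have hsum : ∀ z : TensorProduct R A P, ∃ a : ι → A, z = ∑ i, TensorProduct.tmul R (a i) (v i) := by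
    intro z
    induction z using TensorProduct.induction_on with
    | zero => exact ⟨0, by simp⟩
    | tmul a p =>
      obtain ⟨c, rfl⟩ := hv p
      refine ⟨fun i => c i • a, ?_⟩
      rw [TensorProduct.tmul_sum]
      exact Finset.sum_congr rfl fun i _ => by rw [TensorProduct.tmul_smul, TensorProduct.smul_tmul']
    | add z w hz hw =>
      obtain ⟨a, rfl⟩ := hz
      obtain ⟨b, rfl⟩ := hw
      exact ⟨a + b, by simp [TensorProduct.add_tmul, Finset.sum_add_distrib]⟩
  constructor
  · rw [injective_iff_map_eq_zero]
    intro z hz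
    obtain ⟨a, rfl⟩ := hsum z
    have h := hinj a (by simpa using hz)
    simp [h]
  · intro q
    obtain ⟨a, rfl⟩ := hsurj q
    exact ⟨∑ i, TensorProduct.tmul R (a i) (v i), by simp⟩

section AdjointLemmas

set_option linter.unusedSectionVars false

variable {V : Type*} [NormedAddCommGroup V] [NormedSpace ℂ V]
  {M : Type*} [TopologicalSpace M] [ChartedSpace V M] [IsManifold 𝓘(ℂ, V) ω M]
  {F : OnePoint ℂ × M → Type*} [∀ x, AddCommGroup (F x)] [∀ x, Module ℂ (F x)]
  {𝓗 : HolSheaf (sphereModel V) F}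

lemma univ_prod_mem_nhds {N : Set M} {x : OnePoint ℂ × M} (h : N ∈ 𝓝 x.2) :
    (univ : Set (OnePoint ℂ)) ×ˢ N ∈ 𝓝 x := by
  rw [univ_prod]
  exact continuous_snd.continuousAt.preimage_mem_nhds h

lemma sections_sum_apply {t : M} {ι : Type*} (u : Finset ι) (s : ι → Sections V t F)
    (y : OnePoint ℂ × M) : (∑ i ∈ u, s i : Sections V t F) y = ∑ i ∈ u, s i y :=
  Finset.sum_apply (M := F) y u s

/-- A frame over `ℙ¹ × N` for a neighbourhood `N` of `t` makes the adjoint morphism an isomorphism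
on the stalks at the points of `ℙ¹ × {t}`. -/
lemma isTensorProduct_adjointBilin {x : OnePoint ℂ × M} {N : Set M} (hN : N ∈ 𝓝 x.2) {n : ℕ}
    {e : Fin n → Π x, F x} (he : 𝓗.IsFrameOn e (univ ×ˢ N)) :
    IsTensorProduct (adjointBilin 𝓗 x) := by
  have hN' : ∀ᶠ t' in 𝓝 x.2, N ∈ 𝓝 t' := eventually_mem_nhds_iff.2 hN
  have hpush : ∀ i, (e i : Sections V x.2 F) ∈ pushSections 𝓗 x.2 := fun i => by
    filter_upwards [hN] with t' ht' l
    exact he.holAt ⟨mem_univ _, ht'⟩ i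
  have hx : x ∈ (univ : Set (OnePoint ℂ)) ×ˢ N := ⟨mem_univ _, mem_of_mem_nhds hN⟩
  have hxn := univ_prod_mem_nhds hN
  have hcomb : ∀ (f : Fin n → ↥(holSections (V := V) (HolSheaf.structureSheaf (sphereModel V)) x)),
      ∃ h, ∑ i, adjointBilin 𝓗 x (Submodule.Quotient.mk (f i))
        (Submodule.Quotient.mk ⟨e i, hpush i⟩) = Submodule.Quotient.mk
          (⟨fun y => ∑ i, ((f i).1 y : ℂ) • e i y, h⟩ : ↥(holSections 𝓗 x)) := by
    intro f
    have hm := fun i => 𝓗.smul_holAt (f i).2 (he.holAt hx i)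
    refine ⟨𝓗.sum_smul_holAt _ (fun i _ => (f i).2) fun i _ => he.holAt hx i,
      (map_sum (Submodule.mkQ _) (fun i => (⟨_, hm i⟩ : ↥(holSections 𝓗 x)))
        Finset.univ).symm.trans (congrArg _ (Subtype.ext ?_))⟩
    rw [AddSubmonoidClass.coe_finsetSum]
    exact funext fun y => sections_sum_apply _ _ y
  refine isTensorProduct_of_span _ (fun i => Submodule.Quotient.mk ⟨e i, hpush i⟩) ?_ ?_ ?_
  · intro p
    obtain ⟨⟨s, hs⟩, rfl⟩ := Submodule.Quotient.mk_surjective _ p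
    -- The coefficients in `𝒪_{M,t}` are the frame coefficients restricted to `λ = 0`; any other
    -- value of `λ` would serve, as they are constant along `ℙ¹`.
    have hcoeff : ∀ i, HolFunAt 𝓘(ℂ, V) (fun t' => frameCoeff e s i (((0 : ℂ) : OnePoint ℂ), t'))
        x.2 := fun i => by
      have h := he.coeff_holFunAt (x := (((0 : ℂ) : OnePoint ℂ), x.2)) (univ_prod_mem_nhds hN)
        (hs.self_of_nhds _) i
      exact ContMDiffAt.comp (f := fun t' : M => (((0 : ℂ) : OnePoint ℂ), t')) x.2 h
        (contMDiffAt_const.prodMk contMDiffAt_id)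
    let c : Fin n → HolRing V x.2 := fun i => ⟨_, hcoeff i⟩
    refine ⟨c, ?_⟩
    refine Eq.trans ?_ (map_sum (Submodule.mkQ _)
      (fun i => c i • (⟨e i, hpush i⟩ : ↥(pushSections 𝓗 x.2))) Finset.univ)
    refine (Submodule.Quotient.eq _).2 ?_
    change ∀ᶠ t' in 𝓝 x.2, ∀ l : OnePoint ℂ, s (l, t') -
      (∑ i, c i • (⟨e i, hpush i⟩ : ↥(pushSections 𝓗 x.2)) : ↥(pushSections 𝓗 x.2)).1 (l, t') = 0
    filter_upwards [hs, hN'] with t' ht' hNt l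
    rw [AddSubmonoidClass.coe_finsetSum, sections_sum_apply, sub_eq_zero]
    refine (he.sum_coeff ⟨mem_univ l, mem_of_mem_nhds hNt⟩ s).symm.trans
      (Finset.sum_congr rfl fun i _ => ?_)
    change _ = frameCoeff e s i (((0 : ℂ) : OnePoint ℂ), t') • e i (l, t')
    -- Here compactness of `ℙ¹` enters: the coefficient at `l` equals the one at `0`.
    rw [eq_of_holFunAt_sphere (fun l => he.coeff_holFunAt (univ_prod_mem_nhds hNt) (ht' l) i) l]
  · intro a ha
    choose f hf using fun i => Submodule.Quotient.mk_surjective _ (a i)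
    obtain rfl : (fun i => Submodule.Quotient.mk (f i)) = a := funext hf
    obtain ⟨h, h'⟩ := hcomb f
    rw [h', Submodule.Quotient.mk_eq_zero] at ha
    replace ha : ∀ᶠ y in 𝓝 x, ∑ i, ((f i).1 y : ℂ) • e i y = 0 := ha
    funext i
    refine (Submodule.Quotient.mk_eq_zero _).2 ?_
    change ∀ᶠ y in 𝓝 x, ((f i).1 y : ℂ) = 0
    filter_upwards [ha, hxn] with y hy hyN
    exact Fintype.linearIndependent_iff.1 (he.linearIndependent y hyN) _ hy i
  · intro q
    obtain ⟨⟨s, hs⟩, rfl⟩ := Submodule.Quotient.mk_surjective _ q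
    let f : Fin n → ↥(holSections (V := V) (HolSheaf.structureSheaf (sphereModel V)) x) :=
      fun i => ⟨frameCoeff e s i, he.coeff_holFunAt hxn hs i⟩
    obtain ⟨h, h'⟩ := hcomb f
    refine ⟨fun i => Submodule.Quotient.mk (f i), h'.trans ?_⟩
    refine (Submodule.Quotient.eq _).2 ?_
    change ∀ᶠ y in 𝓝 x, ∑ i, frameCoeff e s i y • e i y - s y = 0
    filter_upwards [hxn] with y hy
    exact sub_eq_zero.2 (he.sum_coeff hy s)

lemma isVectorBundle_of_frames (h : ∀ t : M, ∃ N ∈ 𝓝 t, ∃ (n : ℕ) (e : Fin n → Π x, F x),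
    𝓗.IsFrameOn e (univ ×ˢ N)) : 𝓗.IsVectorBundle := fun x => by
  obtain ⟨N, hN, n, e, he⟩ := h x.2
  exact ⟨_, univ_prod_mem_nhds hN, n, e, he⟩

lemma isAdjointIso_of_frames (h : ∀ t : M, ∃ N ∈ 𝓝 t, ∃ (n : ℕ) (e : Fin n → Π x, F x),
    𝓗.IsFrameOn e (univ ×ˢ N)) : IsAdjointIso 𝓗 := fun x => by
  obtain ⟨N, hN, n, e, he⟩ := h x.2
  exact isTensorProduct_adjointBilin hN he

end AdjointLemmas

/-! ### Division of an analytic function by a coordinate. -/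

section Division

variable {V : Type*} [NormedAddCommGroup V] [NormedSpace ℂ V]

/-- The projection `(z, v) ↦ (0, v)`. -/
def dropFst (V : Type*) [NormedAddCommGroup V] [NormedSpace ℂ V] : ℂ × V →L[ℂ] ℂ × V :=
  (ContinuousLinearMap.inr ℂ ℂ V).comp (ContinuousLinearMap.snd ℂ ℂ V)

lemma dropFst_apply (y : ℂ × V) : dropFst V y = (0, y.2) := rfl

lemma norm_dropFst_le : ‖dropFst V‖ ≤ 1 :=
  ContinuousLinearMap.opNorm_le_bound _ zero_le_one fun y => by
    rw [dropFst_apply, one_mul, Prod.norm_def, Prod.norm_def]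
    simp

/-- The power series of `(f(z, v) - f(0, v)) / z`, for the power series `p` of `f`. -/
def divFst (p : FormalMultilinearSeries ℂ (ℂ × V) ℂ) : FormalMultilinearSeries ℂ (ℂ × V) ℂ :=
  fun n => ∑ i : Fin (n + 1), ((p (n + 1)).curryMid i ((1 : ℂ), (0 : V))).compContinuousLinearMap
    fun j => if j.castSucc < i then ContinuousLinearMap.id ℂ (ℂ × V) else dropFst V

/-- Telescoping: the arguments `y` of the multilinear map are replaced by `(0, y.2)` one slot at a
time. The step at slot `i` contributes the difference `y - (0, y.2) = y.1 • (1, 0)` there, with `y`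
in the earlier slots and the projection in the later ones. -/
lemma fst_mul_divFst (p : FormalMultilinearSeries ℂ (ℂ × V) ℂ) (n : ℕ) (y : ℂ × V) :
    y.1 * divFst p n (fun _ => y) = p (n + 1) (fun _ => y) - p (n + 1) (fun _ => dropFst V y) := by
  have h := (p (n + 1)).toMultilinearMap.map_piecewise_sub_map_piecewise (fun _ => y)
    (fun _ => dropFst V y) 0 Finset.univ
  simp only [Finset.piecewise_univ, Finset.mem_univ, if_true,
    ContinuousMultilinearMap.coe_coe] at h
  rw [h, divFst, sum_apply, Finset.mul_sum]
  refine Finset.sum_congr rfl fun i _ => ?_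
  have h2 : y - dropFst V y = y.1 • ((1 : ℂ), (0 : V)) := by
    rw [dropFst_apply]
    ext <;> simp
  rw [ContinuousMultilinearMap.compContinuousLinearMap_apply, ← smul_eq_mul,
    ← smul_apply, ← map_smul, ← h2,
    ContinuousMultilinearMap.curryMid_apply]
  congr 1
  funext j
  induction j using Fin.succAboveCases i with
  | x => simp
  | p j =>
    rw [Fin.insertNth_apply_succAbove]
    simp only [Fin.succAbove_lt_iff_castSucc_lt, Fin.succAbove_ne, if_false]
    split_ifs <;> rfl

lemma norm_divFst_le (p : FormalMultilinearSeries ℂ (ℂ × V) ℂ) (n : ℕ) :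
    ‖divFst p n‖ ≤ (n + 1) * ‖p (n + 1)‖ := by
  suffices h : ∀ i ∈ (Finset.univ : Finset (Fin (n + 1))),
      ‖((p (n + 1)).curryMid i ((1 : ℂ), (0 : V))).compContinuousLinearMap fun j =>
        if j.castSucc < i then ContinuousLinearMap.id ℂ (ℂ × V) else dropFst V‖ ≤ ‖p (n + 1)‖ from
    (norm_sum_le_of_le _ h).trans (by simp)
  intro i _
  refine (ContinuousMultilinearMap.norm_compContinuousLinearMap_le _ _).trans ?_
  have h1 : ‖(p (n + 1)).curryMid i ((1 : ℂ), (0 : V))‖ ≤ ‖p (n + 1)‖ := by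
    refine (ContinuousLinearMap.le_opNorm _ _).trans ?_
    rw [ContinuousMultilinearMap.norm_curryMid]
    simp [Prod.norm_def]
  refine (mul_le_of_le_one_right (norm_nonneg _) ?_).trans h1
  refine Finset.prod_le_one (fun j _ => norm_nonneg _) fun j _ => ?_
  split_ifs
  exacts [ContinuousLinearMap.norm_id_le, norm_dropFst_le]

/-- The `n + 1` summands cost a factor at most `2 ^ n`, so the radius `r / 2` suffices if `r` is
below the radius of `p`; the constant is `C / r` because degree `n` of the quotient comes from
degree `n + 1` of `p`. -/
lemma divFst_radius_pos (p : FormalMultilinearSeries ℂ (ℂ × V) ℂ) (hp : 0 < p.radius) :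
    0 < (divFst p).radius := by
  obtain ⟨r, hr0, hr⟩ := ENNReal.lt_iff_exists_nnreal_btwn.1 hp
  have hr0' : 0 < (r : ℝ) := by exact_mod_cast hr0
  obtain ⟨C, hC, h⟩ := p.norm_mul_pow_le_of_lt_radius hr
  refine lt_of_lt_of_le ?_ ((divFst p).le_radius_of_bound (C / r) (r := r / 2) fun n => ?_)
  · exact_mod_cast half_pos (by exact_mod_cast hr0')
  · have h1 : ((n : ℝ) + 1) ≤ 2 ^ n := by exact_mod_cast Nat.lt_two_pow_self (n := n)
    rw [le_div_iff₀ hr0']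
    calc ‖divFst p n‖ * ((r / 2 : NNReal) : ℝ) ^ n * r
        ≤ (2 ^ n * ‖p (n + 1)‖) * ((r / 2 : NNReal) : ℝ) ^ n * r := by
          have h2 : ‖divFst p n‖ ≤ 2 ^ n * ‖p (n + 1)‖ :=
            (norm_divFst_le p n).trans (mul_le_mul_of_nonneg_right h1 (norm_nonneg _))
          gcongr
      _ = ‖p (n + 1)‖ * (r : ℝ) ^ (n + 1) := by
          push_cast
          rw [div_pow, pow_succ]
          field_simp
      _ ≤ C := h (n + 1)

/-- An analytic function that vanishes on `z = 0` is divisible by `z`. -/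
lemma exists_analyticAt_eq_fst_mul {f : ℂ × V → ℂ} {v₀ : V} (hf : AnalyticAt ℂ f (0, v₀))
    (h0 : ∀ᶠ y in 𝓝 (((0 : ℂ), v₀) : ℂ × V), y.1 = 0 → f y = 0) :
    ∃ g : ℂ × V → ℂ, AnalyticAt ℂ g (0, v₀) ∧ ∀ᶠ y in 𝓝 (0, v₀), f y = y.1 * g y := by
  obtain ⟨p, hp⟩ := hf
  have hq := (divFst p).hasFPowerSeriesOnBall (divFst_radius_pos p hp.radius_pos)
  refine ⟨fun y => (divFst p).sum (y - (0, v₀)), ?_, ?_⟩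
  · have h := hq.analyticAt
    refine AnalyticAt.fun_comp ?_ (analyticAt_id.sub analyticAt_const)
    simpa using h
  -- The series of `f` is compared at `y` and at the projection of `y` to `z = 0`, where its sum
  -- vanishes. Their difference is `z` times the new series.
  · have hd : Tendsto (fun y : ℂ × V => (0, v₀) + dropFst V (y - (0, v₀))) (𝓝 (0, v₀))
        (𝓝 (0, v₀)) := by
      have : Continuous fun y : ℂ × V => (0, v₀) + dropFst V (y - (0, v₀)) := by fun_prop
      simpa using this.tendsto (0, v₀)
    have hs : Tendsto (fun y : ℂ × V => y - (0, v₀)) (𝓝 (0, v₀)) (𝓝 0) := by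
      have : Continuous fun y : ℂ × V => y - (0, v₀) := by fun_prop
      simpa using this.tendsto (0, v₀)
    have hs' := hs.eventually hq.hasFPowerSeriesAt.eventually_hasSum
    filter_upwards [hp.eventually_hasSum_sub, hd.eventually hp.eventually_hasSum_sub,
      hd.eventually h0, hs'] with y h1 h2 h3 h4
    rw [h3 (by simp [dropFst_apply])] at h2
    simp only [zero_add, add_sub_cancel_left] at h2 h4
    -- The degree-zero terms at `y` and at its projection coincide (`h8`), so the sum may start in
    -- degree one, matching the shift of degree in `fst_mul_divFst`.
    have h5 := ((hasSum_nat_add_iff' 1).2 (h1.sub h2))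
    have h6 := h4.mul_left (y - (0, v₀)).1
    simp_rw [fst_mul_divFst] at h6
    have h7 := h5.unique h6
    have h8 : (p 0 fun _ => y - (0, v₀)) = p 0 fun _ => dropFst V (y - (0, v₀)) := by
      congr 1
      exact Subsingleton.elim _ _
    simpa [h8] using h7

end Division

/-! ### Holomorphic vector fields acting on functions. -/

section VectorFields

variable {B : Type*} [NormedAddCommGroup B] [NormedSpace ℂ B] {H : Type*} [TopologicalSpace H]
  {I : ModelWithCorners ℂ B H} {X : Type*} [TopologicalSpace X] [ChartedSpace H X]
  [IsManifold I ω X]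

lemma HolFunAt.eventually {f : X → ℂ} {x : X} (hf : HolFunAt I f x) :
    ∀ᶠ y in 𝓝 x, HolFunAt I f y :=
  (contMDiffAt_iff_contMDiffAt_nhds (by simp)).1 hf

/-- The derivative of a holomorphic function along a holomorphic vector field is holomorphic. -/
lemma HolFunAt.mvfderiv {f : X → ℂ} {x : X} (hf : HolFunAt I f x)
    {ξ : Π y : X, TangentSpace I y} (hξ : (HolSheaf.tangent I X).HolAt ξ x) :
    HolFunAt I (fun y => mvfderiv I f y (ξ y)) x := by
  obtain ⟨u, hu, huo, hxu⟩ := eventually_nhds_iff.1 hf.eventually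
  have h1 : ContMDiffOn I 𝓘(ℂ, ℂ) ω f u := fun y hy => (hu y hy).contMDiffWithinAt
  -- The function `df(ξ)` is the fibre component of the tangent map composed with `ξ`. No regularity
  -- is lost because `ω + 1 = ω`.
  have h2 := h1.contMDiffOn_tangentMapWithin (m := ω) le_rfl huo.uniqueMDiffOn
  have hξ' : ContMDiffAt I I.tangent ω (fun y => (⟨y, ξ y⟩ : TangentBundle I X)) x := hξ
  have hmem : (π B (TangentSpace I : X → Type _)) ⁻¹' u ∈ 𝓝 (⟨x, ξ x⟩ : TangentBundle I X) :=
    (huo.preimage (FiberBundle.continuous_proj B (TangentSpace I : X → Type _))).mem_nhds hxu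
  have h3 := (h2.contMDiffAt hmem).comp x hξ'
  have h4 := (contMDiff_snd_tangentBundle_modelSpace ℂ 𝓘(ℂ, ℂ) (n := ω)).contMDiffAt.comp x h3
  refine h4.congr_of_eventuallyEq ?_
  filter_upwards [huo.mem_nhds hxu] with y hy
  change mfderiv I 𝓘(ℂ, ℂ) f y (ξ y) = mfderivWithin I 𝓘(ℂ, ℂ) f u y (ξ y)
  rw [mfderivWithin_of_isOpen huo hy]

variable {V : Type*} [NormedAddCommGroup V] [NormedSpace ℂ V]
  {M : Type*} [TopologicalSpace M] [ChartedSpace V M] [IsManifold 𝓘(ℂ, V) ω M]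

lemma pullTangent_holAt_snd {x : OnePoint ℂ × M}
    {ξ : Π y : OnePoint ℂ × M, TangentSpace (sphereModel V) y}
    (hξ : (HolSheaf.tangent (sphereModel V) (OnePoint ℂ × M)).HolAt ξ x) :
    (pullTangent V M).HolAt
      (fun y => mfderiv (sphereModel V) 𝓘(ℂ, V) (Prod.snd : OnePoint ℂ × M → M) y (ξ y)) x := by
  have h := ContMDiff.contMDiff_tangentMap (n := ω) (m := ω)
    (contMDiff_snd (I := 𝓘(ℂ, ℂ)) (J := 𝓘(ℂ, V)) (M := OnePoint ℂ) (N := M)) le_rfl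
  exact h.contMDiffAt.comp (f := fun y => (⟨y, ξ y⟩ : TangentBundle (sphereModel V) _)) x hξ

end VectorFields

/-! ### Extension of `dλ(ξ)/λ` over the divisor for logarithmic fields `ξ`. -/

section LogFields

set_option linter.unusedSectionVars false

variable {V : Type*} [NormedAddCommGroup V] [NormedSpace ℂ V] {M : Type*} [TopologicalSpace M]
  [ChartedSpace V M]

/-- A holomorphic function that vanishes on `{l} × M` is divisible by a coordinate at `l`. -/
lemma exists_holFunAt_eq_chart_mul [IsManifold 𝓘(ℂ, V) ω M] {f : OnePoint ℂ × M → ℂ}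
    {x : OnePoint ℂ × M}
    (hx : extChartAt 𝓘(ℂ, ℂ) x.1 x.1 = 0) (hf : HolFunAt (sphereModel V) f x)
    (h0 : ∀ᶠ y in 𝓝 x, y.1 = x.1 → f y = 0) : ∃ g, HolFunAt (sphereModel V) g x ∧
      ∀ᶠ y in 𝓝 x, f y = extChartAt 𝓘(ℂ, ℂ) x.1 y.1 * g y := by
  let φ := extChartAt (sphereModel V) x
  have hφx : φ x = (0, extChartAt 𝓘(ℂ, V) x.2 x.2) := by
    simp only [φ, extChartAt_prod, PartialEquiv.prod_coe, hx]
  have hfst : ∀ y, (φ y).1 = extChartAt 𝓘(ℂ, ℂ) x.1 y.1 := fun y => by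
    simp only [φ, extChartAt_prod, PartialEquiv.prod_coe]
  have hsymm : Tendsto φ.symm (𝓝 (φ x)) (𝓝 x) := by
    have h := continuousAt_extChartAt_symm (I := sphereModel V) x
    rwa [ContinuousAt, extChartAt_to_inv] at h
  have han : AnalyticAt ℂ (f ∘ φ.symm) (φ x) := by
    have h := (contMDiffAt_iff.1 hf).2
    rw [ModelWithCorners.range_eq_univ, contDiffWithinAt_univ] at h
    have h' : ContDiffAt ℂ ω (f ∘ φ.symm) (φ x) := h
    exact h'.analyticAt
  rw [hφx] at han
  obtain ⟨g, hg, hfg⟩ := exists_analyticAt_eq_fst_mul han (by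
    rw [hφx] at hsymm
    filter_upwards [hsymm.eventually h0] with y hy h
    refine hy ?_
    -- A point with vanishing first coordinate lies on `{x.1} × M`, where `f` vanishes by `h0`.
    have h1 : (φ.symm y).1 = (extChartAt 𝓘(ℂ, ℂ) x.1).symm y.1 := by
      simp only [φ, extChartAt_prod, PartialEquiv.prod_symm, PartialEquiv.prod_coe]
    rw [h1, h, ← hx, extChartAt_to_inv])
  rw [← hφx] at hg hfg
  refine ⟨g ∘ φ, ?_, ?_⟩
  · exact ContMDiffAt.comp x (contMDiffAt_iff_contDiffAt.2 hg.contDiffAt) contMDiffAt_extChartAt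
  · filter_upwards [(continuousAt_extChartAt (I := sphereModel V) x).eventually hfg,
      extChartAt_source_mem_nhds (I := sphereModel V) x] with y hy hys
    have hy' : f (φ.symm (φ y)) = (φ y).1 * g (φ y) := hy
    rw [φ.left_inv hys, hfst] at hy'
    exact hy'

variable [IsManifold 𝓘(ℂ, V) ω M]

/-- Tangency to the divisor makes `dλ(ξ)` vanish on `λ = 0`, so it is divisible by `λ`. -/
lemma exists_dlog_extension_zero {x : OnePoint ℂ × M} (hx : x.1 = ((0 : ℂ) : OnePoint ℂ))
    {ξ : Π y : OnePoint ℂ × M, TangentSpace (sphereModel V) y}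
    (hξ : (HolSheaf.tangent (sphereModel V) (OnePoint ℂ × M)).HolAt ξ x) (hlog : IsLogAt ξ x) :
    ∃ h, HolFunAt (sphereModel V) h x ∧ ∀ᶠ y in 𝓝 x, y ∈ cstar M →
      h y = (lam y)⁻¹ * mvfderiv (sphereModel V) lam y (ξ y) := by
  have hx1 : x.1 ≠ OnePoint.infty := hx ▸ OnePoint.coe_ne_infty _
  have hmem : ∀ᶠ y in 𝓝 x, y.1 ≠ OnePoint.infty :=
    (isOpen_ne.preimage continuous_fst).mem_nhds hx1
  obtain ⟨g, hg, h⟩ := exists_holFunAt_eq_chart_mul (x := x)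
    (f := fun y => mvfderiv (sphereModel V) lam y (ξ y))
    (by rw [hx]; simp [chartAt_coe, chartZero_coe])
    ((holFunAt_lam (V := V) hx1).mvfderiv hξ) (by
      filter_upwards [hlog, hmem] with y hy hy1 hyx
      have h1 := mvfderiv_comp_apply (I := 𝓘(ℂ, ℂ)) (f := (Prod.fst : OnePoint ℂ × M → _))
        (g := coord) y
        (HolFunAt.mdifferentiableAt (holFunAt_coord hy1))
        (contMDiffAt_fst.mdifferentiableAt (by simp : (ω : WithTop ℕ∞) ≠ 0)) (ξ y)
      refine h1.trans ?_
      rw [hy (fun h => h.1 (hyx.trans hx)), map_zero])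
  refine ⟨g, hg, ?_⟩
  filter_upwards [h] with y hy hyc
  rw [hy, hx, ← mul_assoc]
  have : extChartAt 𝓘(ℂ, ℂ) ((0 : ℂ) : OnePoint ℂ) y.1 = lam y := by
    simp [chartAt_coe, chartZero_eq_coord hyc.2, lam]
  rw [this, inv_mul_cancel₀ (lam_ne_zero hyc), one_mul]

lemma mvfderiv_lam_inv {y : OnePoint ℂ × M} (hy : y ∈ cstar M)
    (v : TangentSpace (sphereModel V) y) :
    mvfderiv (sphereModel V) (fun y => (lam y)⁻¹) y v =
      - ((lam y)⁻¹ * ((lam y)⁻¹ * mvfderiv (sphereModel V) lam y v)) := by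
  have h1 := (holFunAt_lam (V := V) hy.2).mdifferentiableAt
  have h2 := (holFunAt_lam_inv (V := V) hy.1).mdifferentiableAt
  have h3 := congrArg (fun L => L v) (mvfderiv_mul h1 h2)
  have h4 : mvfderiv (sphereModel V) (lam * fun y : OnePoint ℂ × M => (lam y)⁻¹) y = 0 := by
    have h5 : (lam * fun y : OnePoint ℂ × M => (lam y)⁻¹) =ᶠ[𝓝 y] fun _ => 1 := by
      filter_upwards [isOpen_cstar.mem_nhds hy] with z hz
      simp [lam_ne_zero hz]
    rw [mvfderiv, h5.mfderiv_eq, mfderiv_const]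
    rfl
  have hl := lam_ne_zero hy
  rw [h4] at h3
  replace h3 : 0 = lam y * mvfderiv (sphereModel V) (fun y => (lam y)⁻¹) y v +
    (lam y)⁻¹ * mvfderiv (sphereModel V) lam y v := h3
  field_simp at h3 ⊢
  linear_combination -h3

/-- With `μ = 1/λ`, the function `dμ(ξ)` vanishes on `μ = 0` and is divisible by `μ`; moreover `dλ/λ
= -dμ/μ`, whence the sign of the witness. -/
lemma exists_dlog_extension_infty {x : OnePoint ℂ × M} (hx : x.1 = OnePoint.infty)
    {ξ : Π y : OnePoint ℂ × M, TangentSpace (sphereModel V) y}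
    (hξ : (HolSheaf.tangent (sphereModel V) (OnePoint ℂ × M)).HolAt ξ x) (hlog : IsLogAt ξ x) :
    ∃ h, HolFunAt (sphereModel V) h x ∧ ∀ᶠ y in 𝓝 x, y ∈ cstar M →
      h y = (lam y)⁻¹ * mvfderiv (sphereModel V) lam y (ξ y) := by
  have hx0 : x.1 ≠ ((0 : ℂ) : OnePoint ℂ) := hx ▸ OnePoint.infty_ne_coe _
  have hmem : ∀ᶠ y in 𝓝 x, y.1 ≠ ((0 : ℂ) : OnePoint ℂ) :=
    (isOpen_ne.preimage continuous_fst).mem_nhds hx0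
  obtain ⟨g, hg, h⟩ := exists_holFunAt_eq_chart_mul (x := x)
    (f := fun y => mvfderiv (sphereModel V) (fun y => (lam y)⁻¹) y (ξ y))
    (by rw [hx]; simp [chartAt_infty, chartInfty_eq_coord_inv, coord_infty])
    ((holFunAt_lam_inv (V := V) hx0).mvfderiv hξ) (by
      filter_upwards [hlog, hmem] with y hy hy1 hyx
      have h1 := mvfderiv_comp_apply (I := 𝓘(ℂ, ℂ)) (f := (Prod.fst : OnePoint ℂ × M → _))
        (g := fun q => (coord q)⁻¹) y
        (HolFunAt.mdifferentiableAt (holFunAt_coord_inv hy1))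
        (contMDiffAt_fst.mdifferentiableAt (by simp : (ω : WithTop ℕ∞) ≠ 0)) (ξ y)
      refine h1.trans ?_
      rw [hy (fun h => h.2 (hyx.trans hx)), map_zero])
  refine ⟨fun y => (-1) * g y, contMDiffAt_const.mul hg, ?_⟩
  filter_upwards [h] with y hy hyc
  rw [hx] at hy
  have h1 : extChartAt 𝓘(ℂ, ℂ) (OnePoint.infty : OnePoint ℂ) y.1 = (lam y)⁻¹ := by
    simp [chartAt_infty, chartInfty_eq_coord_inv hyc.1, lam]
  rw [h1, mvfderiv_lam_inv hyc] at hy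
  have hl := inv_ne_zero (lam_ne_zero hyc)
  refine mul_left_cancel₀ hl ?_
  linear_combination hy

end LogFields

/-! ### Sections, frames and subbundles of `p^*Θ_M`. -/

section PullBack

set_option linter.unusedSectionVars false

variable {V : Type*} [NormedAddCommGroup V] [NormedSpace ℂ V]
  {M : Type*} [TopologicalSpace M] [ChartedSpace V M] [IsManifold 𝓘(ℂ, V) ω M]

/-- The pull-back of a vector field on `M` to a section of `p^* Θ_M`. -/
abbrev pullField (a : Π t : M, TangentSpace 𝓘(ℂ, V) t) (x : OnePoint ℂ × M) :
    TangentSpace 𝓘(ℂ, V) x.2 := a x.2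

lemma pullField_holAt {a : Π t : M, TangentSpace 𝓘(ℂ, V) t} {x : OnePoint ℂ × M}
    (ha : (HolSheaf.tangent 𝓘(ℂ, V) M).HolAt a x.2) : (pullTangent V M).HolAt (pullField a) x := by
  have h : ContMDiffAt 𝓘(ℂ, V) (𝓘(ℂ, V).prod 𝓘(ℂ, V)) ω
    (fun t => TotalSpace.mk' V t (a t)) x.2 := ha
  exact ContMDiffAt.comp x h contMDiffAt_snd

lemma slice_holAt {s : Π x : OnePoint ℂ × M, TangentSpace 𝓘(ℂ, V) x.2} {x : OnePoint ℂ × M}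
    (hs : (pullTangent V M).HolAt s x) :
    (HolSheaf.tangent 𝓘(ℂ, V) M).HolAt (fun t => s (x.1, t)) x.2 := by
  have h : ContMDiffAt (sphereModel V) (𝓘(ℂ, V).prod 𝓘(ℂ, V)) ω
    (fun y : OnePoint ℂ × M => TotalSpace.mk' V y.2 (s y)) x := hs
  exact ContMDiffAt.comp (f := fun t : M => (x.1, t)) x.2 h
    (contMDiffAt_const.prodMk contMDiffAt_id)

/-- The linear isomorphism of the tangent space at `t` with `V` given by a chart at `t₀`. -/
def tangentTriv {t₀ t : M} (h : t ∈ (chartAt V t₀).source) : TangentSpace 𝓘(ℂ, V) t ≃ₗ[ℂ] V :=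
  (trivializationAt V (TangentSpace 𝓘(ℂ, V)) t₀).linearEquivAt ℂ t h

lemma pullTangent_holAt_iff {s : Π x : OnePoint ℂ × M, TangentSpace 𝓘(ℂ, V) x.2}
    {x : OnePoint ℂ × M} {t₀ : M} (h : x.2 ∈ (chartAt V t₀).source) :
    (pullTangent V M).HolAt s x ↔ ContMDiffAt (sphereModel V) 𝓘(ℂ, V) ω
      (fun y => (trivializationAt V (TangentSpace 𝓘(ℂ, V)) t₀ ⟨y.2, s y⟩).2) x := by
  have h1 := (trivializationAt V (TangentSpace 𝓘(ℂ, V)) t₀).contMDiffAt_iff (n := ω)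
    (IB := 𝓘(ℂ, V)) (IM := sphereModel V)
    (f := fun y : OnePoint ℂ × M => (TotalSpace.mk' V y.2 (s y) : TangentBundle 𝓘(ℂ, V) M))
    (x₀ := x) (by rw [Trivialization.mem_source]; exact h)
  exact h1.trans (and_iff_right contMDiffAt_snd)

variable [FiniteDimensional ℂ V]

/-- For fixed `t` the trivialization is a fixed linear isomorphism from `T_t M` to `V`, continuous
together with its inverse by finite dimensionality. So holomorphy in a trivialization is holomorphy
as a map into the fixed space `T_t M`. -/
lemma contMDiffAt_slice {s : Π x : OnePoint ℂ × M, TangentSpace 𝓘(ℂ, V) x.2} {x : OnePoint ℂ × M}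
    (hs : (pullTangent V M).HolAt s x) :
    ContMDiffAt 𝓘(ℂ, ℂ) 𝓘(ℂ, V) ω (fun l : OnePoint ℂ => (s (l, x.2) : V)) x.1 := by
  have hx := mem_chart_source V x.2
  have h1 := (pullTangent_holAt_iff hx).1 hs
  have h2 : ContMDiffAt 𝓘(ℂ, ℂ) 𝓘(ℂ, V) ω (fun l : OnePoint ℂ =>
      (trivializationAt V (TangentSpace 𝓘(ℂ, V)) x.2 ⟨x.2, s (l, x.2)⟩).2) x.1 :=
    ContMDiffAt.comp (f := fun l : OnePoint ℂ => (l, x.2)) x.1 h1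
      (contMDiffAt_id.prodMk contMDiffAt_const)
  let L : V →ₗ[ℂ] V := (tangentTriv hx).symm.toLinearMap
  have h3 : ContMDiffAt 𝓘(ℂ, V) 𝓘(ℂ, V) ω L.toContinuousLinearMap
    (trivializationAt V (TangentSpace 𝓘(ℂ, V)) x.2 ⟨x.2, s x⟩).2 :=
    L.toContinuousLinearMap.contMDiff.contMDiffAt
  refine (ContMDiffAt.comp x.1 h3 h2).congr_of_eventuallyEq (Eventually.of_forall fun l => ?_)
  exact ((tangentTriv hx).symm_apply_apply (s (l, x.2))).symm

lemma exists_pullTangent_frame (x : OnePoint ℂ × M) :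
    ∃ U ∈ 𝓝 x, ∃ e : Fin (Module.finrank ℂ V) → Π x : OnePoint ℂ × M, TangentSpace 𝓘(ℂ, V) x.2,
      (pullTangent V M).IsFrameOn e U := by
  let tr := trivializationAt V (TangentSpace 𝓘(ℂ, V)) x.2
  let b := Module.finBasis ℂ V
  let e : Fin (Module.finrank ℂ V) → Π x : OnePoint ℂ × M, TangentSpace 𝓘(ℂ, V) x.2 :=
    fun i y => tr.symm y.2 (b i)
  let U : Set (OnePoint ℂ × M) := univ ×ˢ (chartAt V x.2).source
  have hUo : IsOpen U := isOpen_univ.prod (chartAt V x.2).open_source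
  have he : ∀ y (hy : y ∈ U) i, e i y = (tangentTriv hy.2).symm (b i) := fun y hy i =>
    rfl
  have hb : ∀ y (hy : y ∈ U), (fun i => e i y) = b.map (tangentTriv hy.2).symm := fun y hy => by
    funext i
    rw [he y hy, Module.Basis.map_apply]
  have hhol : ∀ y ∈ U, ∀ i, (pullTangent V M).HolAt (e i) y := fun y hy i => by
    rw [pullTangent_holAt_iff hy.2]
    refine (contMDiffAt_const (c := b i)).congr_of_eventuallyEq ?_
    filter_upwards [hUo.mem_nhds hy] with z hz
    rw [he z hz]
    exact (tangentTriv hz.2).apply_symm_apply (b i)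
  refine ⟨U, hUo.mem_nhds ⟨mem_univ _, mem_chart_source V x.2⟩, e, fun y hy => ?_, fun y hy => ?_,
    fun y hy s => ⟨fun hs => ?_, ?_⟩⟩
  · rw [hb y hy]
    exact Module.Basis.linearIndependent _
  · rw [hb y hy]
    exact Module.Basis.span_eq _
  · rw [pullTangent_holAt_iff hy.2] at hs
    refine ⟨fun i z => b.repr (tr ⟨z.2, s z⟩).2 i, fun i => ?_, ?_⟩
    · have h : ContMDiffAt 𝓘(ℂ, V) 𝓘(ℂ, ℂ) ω (b.coord i).toContinuousLinearMap
        (tr ⟨y.2, s y⟩).2 := (b.coord i).toContinuousLinearMap.contMDiff.contMDiffAt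
      exact ContMDiffAt.comp y h hs
    · filter_upwards [hUo.mem_nhds hy] with z hz
      apply (tangentTriv hz.2).injective
      rw [map_sum]
      simp_rw [map_smul, he z hz, LinearEquiv.apply_symm_apply]
      exact (b.sum_repr (tangentTriv hz.2 (s z))).symm
  · rintro ⟨c, hc, h⟩
    rw [(pullTangent V M).holAt_congr h]
    exact (pullTangent V M).sum_smul_holAt _ (fun i _ => hc i) fun i _ => hhol y hy i

/-- A frame of `Θ_M` on `N` pulls back to a frame of `p^* Θ_M` on `ℙ¹ × N`. -/
lemma HolSheaf.IsFrameOn.pull {n : ℕ} {e : Fin n → Π t : M, TangentSpace 𝓘(ℂ, V) t}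
    {N : Set M} (he : (HolSheaf.tangent 𝓘(ℂ, V) M).IsFrameOn e N) :
    (pullTangent V M).IsFrameOn (fun i => pullField (e i)) (univ ×ˢ N) := by
  refine ⟨fun x hx => he.linearIndependent x.2 hx.2, fun x hx => he.span_eq_top x.2 hx.2,
    fun x hx => ?_⟩
  obtain ⟨U, hU, f, hf⟩ := exists_pullTangent_frame (V := V) x
  obtain rfl : Module.finrank ℂ V = n :=
    (hf.finrank_eq (mem_of_mem_nhds hU)).symm.trans (he.finrank_eq hx.2)
  -- The coordinate frame of `p^*Θ_M` serves only as a reference: the pulled-back fields are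
  -- holomorphic, independent and of the right number, hence form a frame near each point.
  obtain ⟨U', hU', h⟩ := hf.exists_frame_of_linearIndependent hU
    (fun j => pullField_holAt (he.holAt hx.2 j)) (he.linearIndependent x.2 hx.2)
  exact h.holAt_iff x (mem_of_mem_nhds hU')

lemma HolSheaf.IsSubbundle.pull {W : Π t : M, Submodule ℂ (TangentSpace 𝓘(ℂ, V) t)}
    (hW : (HolSheaf.tangent 𝓘(ℂ, V) M).IsSubbundle W) :
    (pullTangent V M).IsSubbundle (fun x => W x.2) := fun x => by
  obtain ⟨U, hU, n, e, S, he, hS⟩ := hW x.2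
  exact ⟨univ ×ˢ U, univ_prod_mem_nhds hU, n, _, S, he.pull, fun y hy => hS y.2 hy.2⟩

end PullBack

/-! ### The connection on `p^*Θ_M`: explicit form and Leibniz rule. -/

section TrTLEConn

set_option linter.unusedSectionVars false

variable {V : Type*} [NormedAddCommGroup V] [NormedSpace ℂ V] [FiniteDimensional ℂ V]
  {M : Type*} [TopologicalSpace M] [ChartedSpace V M] [IsManifold 𝓘(ℂ, V) ω M]

/-- The component of a tangent vector of `ℙ¹ × M` along `M`. -/
abbrev sndPart {x : OnePoint ℂ × M} (v : TangentSpace (sphereModel V) x) :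
    TangentSpace 𝓘(ℂ, V) x.2 :=
  mfderiv (sphereModel V) 𝓘(ℂ, V) (Prod.snd : OnePoint ℂ × M → M) x v

/-- The component of a tangent vector of `ℙ¹ × M` along `ℙ¹`. -/
abbrev fstPart {x : OnePoint ℂ × M} (v : TangentSpace (sphereModel V) x) :
    TangentSpace 𝓘(ℂ, ℂ) x.1 :=
  mfderiv (sphereModel V) 𝓘(ℂ, ℂ) (Prod.fst : OnePoint ℂ × M → _) x v

lemma mvfderiv_congr {B : Type*} [NormedAddCommGroup B] [NormedSpace ℂ B] {H : Type*}
    [TopologicalSpace H] {I : ModelWithCorners ℂ B H} {X : Type*} [TopologicalSpace X]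
    [ChartedSpace H X] {G : Type*} [NormedAddCommGroup G] [NormedSpace ℂ G] {f g : X → G} {x : X}
    (h : f =ᶠ[𝓝 x] g) (v : TangentSpace I x) : mvfderiv I f x v = mvfderiv I g x v := by
  change mfderiv I 𝓘(ℂ, G) f x v = mfderiv I 𝓘(ℂ, G) g x v
  rw [h.mfderiv_eq]
  rfl

lemma mvfderiv_eq_add {f : OnePoint ℂ × M → ℂ} {x : OnePoint ℂ × M}
    (hf : MDifferentiableAt (sphereModel V) 𝓘(ℂ, ℂ) f x) (v : TangentSpace (sphereModel V) x) :
    mvfderiv (sphereModel V) f x v =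
      mvfderiv 𝓘(ℂ, ℂ) (fun l : OnePoint ℂ => f (l, x.2)) x.1 (fstPart v) +
        mvfderiv 𝓘(ℂ, V) (fun t : M => f (x.1, t)) x.2 (sndPart v) := by
  refine (mfderiv_prod_eq_add_apply hf).trans ?_
  rw [fstPart, sndPart, mfderiv_fst, mfderiv_snd]
  rfl

/-- The derivative of a section of `p^* Θ_M` along `ℙ¹`. -/
def vertDeriv (s : Π x : OnePoint ℂ × M, TangentSpace 𝓘(ℂ, V) x.2) (x : OnePoint ℂ × M) :
    TangentSpace 𝓘(ℂ, ℂ) x.1 →ₗ[ℂ] TangentSpace 𝓘(ℂ, V) x.2 :=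
  (mvfderiv 𝓘(ℂ, ℂ) (fun l : OnePoint ℂ => (s (l, x.2) : V)) x.1).toLinearMap

section

variable {s t : Π x : OnePoint ℂ × M, TangentSpace 𝓘(ℂ, V) x.2} {x : OnePoint ℂ × M}

lemma vertDeriv_congr (h : ∀ᶠ y in 𝓝 x, s y = t y) : vertDeriv s x = vertDeriv t x := by
  have h1 : (fun l : OnePoint ℂ => (s (l, x.2) : V)) =ᶠ[𝓝 x.1] fun l => (t (l, x.2) : V) :=
    (Continuous.prodMk_left x.2).continuousAt.eventually h
  exact LinearMap.ext fun v => mvfderiv_congr h1 v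

lemma vertDeriv_add (hs : (pullTangent V M).HolAt s x) (ht : (pullTangent V M).HolAt t x) :
    vertDeriv (s + t) x = vertDeriv s x + vertDeriv t x := by
  exact LinearMap.ext fun v => congrArg (fun L => L v) (mvfderiv_add
    ((contMDiffAt_slice hs).mdifferentiableAt (by simp))
    ((contMDiffAt_slice ht).mdifferentiableAt (by simp)))

lemma holFunAt_slice_fst {f : OnePoint ℂ × M → ℂ} (hf : HolFunAt (sphereModel V) f x) :
    HolFunAt 𝓘(ℂ, ℂ) (fun l : OnePoint ℂ => f (l, x.2)) x.1 :=
  ContMDiffAt.comp (f := fun l : OnePoint ℂ => (l, x.2)) x.1 hf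
    (contMDiffAt_id.prodMk contMDiffAt_const)

lemma holFunAt_slice_snd {f : OnePoint ℂ × M → ℂ} (hf : HolFunAt (sphereModel V) f x) :
    HolFunAt 𝓘(ℂ, V) (fun t : M => f (x.1, t)) x.2 :=
  ContMDiffAt.comp (f := fun t : M => (x.1, t)) x.2 hf
    (contMDiffAt_const.prodMk contMDiffAt_id)

lemma vertDeriv_smul {f : OnePoint ℂ × M → ℂ} (hf : HolFunAt (sphereModel V) f x)
    (hs : (pullTangent V M).HolAt s x) (v : TangentSpace 𝓘(ℂ, ℂ) x.1) :
    vertDeriv (f • s) x v = f x • vertDeriv s x v +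
      mvfderiv 𝓘(ℂ, ℂ) (fun l : OnePoint ℂ => f (l, x.2)) x.1 v • s x :=
  congrArg (fun L => L v) (mvfderiv_smul (holFunAt_slice_fst hf).mdifferentiableAt
    ((contMDiffAt_slice hs).mdifferentiableAt (by simp)))

lemma vertDeriv_pullField (a : Π t : M, TangentSpace 𝓘(ℂ, V) t) :
    vertDeriv (pullField a) x = 0 := by
  have h := mvfderiv_const (I := 𝓘(ℂ, ℂ)) (M := OnePoint ℂ) (x := x.1) (F := V) (a x.2)
  exact LinearMap.ext fun v => congrArg (fun L => L v) h

end

namespace SaitoStructure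

variable (𝒮 : SaitoStructure V M) (d : ℂ)

lemma trTLEConn_apply (s : Π x : OnePoint ℂ × M, TangentSpace 𝓘(ℂ, V) x.2) (x : OnePoint ℂ × M)
    (v : TangentSpace (sphereModel V) x) :
    𝒮.trTLEConn d s x v = vertDeriv s x (fstPart v)
      + 𝒮.cov (fun t => s (x.1, t)) x.2 (sndPart v)
      + (lam x)⁻¹ • 𝒮.higgs x.2 (sndPart v) (s x)
      - mvfderiv (sphereModel V) lam x v •
        ((lam x)⁻¹ • ((lam x)⁻¹ • 𝒮.higgs x.2 (𝒮.E x.2) (s x) + 𝒮.cov 𝒮.E x.2 (s x)))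
      + mvfderiv (sphereModel V) lam x v • (((2 - d) / 2 * (lam x)⁻¹) • s x) := rfl

lemma trTLEConn_pullField (a : Π t : M, TangentSpace 𝓘(ℂ, V) t) (x : OnePoint ℂ × M)
    (v : TangentSpace (sphereModel V) x) :
    𝒮.trTLEConn d (pullField a) x v =
      𝒮.cov a x.2 (sndPart v) + (lam x)⁻¹ • 𝒮.higgs x.2 (sndPart v) (a x.2)
      - mvfderiv (sphereModel V) lam x v •
        ((lam x)⁻¹ • ((lam x)⁻¹ • 𝒮.higgs x.2 (𝒮.E x.2) (a x.2) + 𝒮.cov 𝒮.E x.2 (a x.2)))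
      + mvfderiv (sphereModel V) lam x v • (((2 - d) / 2 * (lam x)⁻¹) • a x.2) := by
  rw [trTLEConn_apply, vertDeriv_pullField, LinearMap.zero_apply, zero_add]

/-- The extra term vanishes for `d = 2`, so the flatness assumed in a Saito structure is that of one
member of the family `trTLEConn`. -/
lemma hatConn_eq_trTLEConn : hatConn 𝒮.higgs 𝒮.cov 𝒮.E = 𝒮.trTLEConn 2 := by
  funext s x
  ext v
  change _ = hatConn 𝒮.higgs 𝒮.cov 𝒮.E s x v +
    mvfderiv (sphereModel V) lam x v • (((2 - 2) / 2 * (lam x)⁻¹) • s x)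
  simp

lemma trTLEConn_eq_add (s : Π x : OnePoint ℂ × M, TangentSpace 𝓘(ℂ, V) x.2) (x : OnePoint ℂ × M)
    (v : TangentSpace (sphereModel V) x) :
    𝒮.trTLEConn d s x v = 𝒮.trTLEConn 2 s x v +
      ((2 - d) / 2 * (lam x)⁻¹ * mvfderiv (sphereModel V) lam x v) • s x := by
  rw [← hatConn_eq_trTLEConn, mul_comm, mul_smul]
  rfl

/-- Only the two partial derivatives differentiate `s`; the other terms are linear over functions,
so even the value of `λ⁻¹` on the divisor does no harm and `U` is arbitrary. Holomorphy is treated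
separately, since its proof expands sections in a frame by these very rules. -/
lemma isLeibnizOn_trTLEConn (U : Set (OnePoint ℂ × M)) :
    IsLeibnizOn (pullTangent V M) (𝒮.trTLEConn d) U where
  congr := by
    intro x _ s t hs h
    ext v
    have h2 : ∀ᶠ u in 𝓝 x.2, s (x.1, u) = t (x.1, u) :=
      (Continuous.prodMk_right x.1).continuousAt.eventually h
    have h3 := congrArg (fun L => L (sndPart v))
      (𝒮.cov_holomorphic.congr x.2 (mem_univ _) _ _ (slice_holAt hs) h2)
    simp only [ContinuousLinearMap.coe_coe] at h3
    rw [trTLEConn_apply, trTLEConn_apply, h.self_of_nhds, vertDeriv_congr h, h3]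
  add := by
    intro x _ s t hs ht
    ext v
    have h1 := congrArg (fun L => L (sndPart v))
      (𝒮.cov_holomorphic.add x.2 (mem_univ _) _ _ (slice_holAt hs) (slice_holAt ht))
    simp only [ContinuousLinearMap.coe_coe, LinearMap.add_apply] at h1
    have h2 : 𝒮.cov (fun u => (s + t) (x.1, u)) x.2 (sndPart v) =
      𝒮.cov (fun t => s (x.1, t)) x.2 (sndPart v) + 𝒮.cov (fun u => t (x.1, u)) x.2 (sndPart v) := h1
    rw [LinearMap.add_apply, trTLEConn_apply, trTLEConn_apply, trTLEConn_apply, h2,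
      vertDeriv_add hs ht, LinearMap.add_apply, Pi.add_apply, map_add, map_add, map_add]
    module
  leibniz := by
    intro x _ f s hf hs v
    have h1 := 𝒮.cov_holomorphic.leibniz x.2 (mem_univ _) _ _ (holFunAt_slice_snd hf)
      (slice_holAt hs) (sndPart v)
    have h2 : 𝒮.cov (fun u => (f • s) (x.1, u)) x.2 (sndPart v) =
      f x • 𝒮.cov (fun t => s (x.1, t)) x.2 (sndPart v) +
        mvfderiv 𝓘(ℂ, V) (fun t : M => f (x.1, t)) x.2 (sndPart v) • s x := h1
    rw [trTLEConn_apply, trTLEConn_apply, h2, vertDeriv_smul hf hs, Pi.smul_apply', map_smul,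
      map_smul, map_smul, mvfderiv_eq_add hf.mdifferentiableAt]
    module

end SaitoStructure

end TrTLEConn

/-! ### The trTLE-structures on `p^*Θ_M` and on its graded pieces. -/

section TrTLEStructure

set_option linter.unusedSectionVars false

variable {V : Type*} [NormedAddCommGroup V] [NormedSpace ℂ V] [FiniteDimensional ℂ V]
  {M : Type*} [TopologicalSpace M] [ChartedSpace V M] [IsManifold 𝓘(ℂ, V) ω M]

/-- A holomorphic vector bundle map of `Θ_M` to itself maps holomorphic sections of `p^* Θ_M` to
holomorphic sections. -/
lemma pullTangent_map_holAt {x : OnePoint ℂ × M} {N : Set M} (hN : N ∈ 𝓝 x.2) {n : ℕ}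
    {e : Fin n → Π t : M, TangentSpace 𝓘(ℂ, V) t}
    (he : (HolSheaf.tangent 𝓘(ℂ, V) M).IsFrameOn e N)
    (A : Π t : M, TangentSpace 𝓘(ℂ, V) t →ₗ[ℂ] TangentSpace 𝓘(ℂ, V) t)
    (hA : ∀ a, (HolSheaf.tangent 𝓘(ℂ, V) M).HolAt a x.2 →
      (HolSheaf.tangent 𝓘(ℂ, V) M).HolAt (fun t => A t (a t)) x.2)
    {s : Π x : OnePoint ℂ × M, TangentSpace 𝓘(ℂ, V) x.2} (hs : (pullTangent V M).HolAt s x) :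
    (pullTangent V M).HolAt (fun y => A y.2 (s y)) x := by
  have hN' := univ_prod_mem_nhds hN
  have h : ∀ᶠ y in 𝓝 x, A y.2 (s y) = ∑ i, frameCoeff (fun i => pullField (e i)) s i y •
      pullField (fun t => A t (e i t)) y := by
    filter_upwards [he.pull.eventually_sum_coeff hN' s] with y hy
    conv_lhs => rw [hy]
    simp [map_sum]
  rw [(pullTangent V M).holAt_congr h]
  exact (pullTangent V M).sum_smul_holAt _ (fun i _ => he.pull.coeff_holFunAt hN' hs i) fun i _ =>
    pullField_holAt (hA _ (he.holAt (mem_of_mem_nhds hN) i))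

namespace SaitoStructure

variable (𝒮 : SaitoStructure V M) (d : ℂ)

/-- If `κ = ρ / λ` and `h = dλ(ξ) / λ` on `ℂ^* × M`, for functions `ρ`, `κ`, `h` that are holomorphic
near `x`, then `ρ D_ξ s` extends to a holomorphic section near `x`. -/
lemma exists_trTLEConn_extension {x : OnePoint ℂ × M} {N : Set M} (hN : N ∈ 𝓝 x.2) {n : ℕ}
    {e : Fin n → Π t : M, TangentSpace 𝓘(ℂ, V) t}
    (he : (HolSheaf.tangent 𝓘(ℂ, V) M).IsFrameOn e N)
    {s : Π x : OnePoint ℂ × M, TangentSpace 𝓘(ℂ, V) x.2} (hs : (pullTangent V M).HolAt s x)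
    {ξ : Π y : OnePoint ℂ × M, TangentSpace (sphereModel V) y}
    (hξ : (HolSheaf.tangent (sphereModel V) (OnePoint ℂ × M)).HolAt ξ x)
    {ρ κ h : OnePoint ℂ × M → ℂ} (hρ : HolFunAt (sphereModel V) ρ x)
    (hκ : HolFunAt (sphereModel V) κ x) (hh : HolFunAt (sphereModel V) h x)
    (hκρ : ∀ᶠ y in 𝓝 x, y ∈ cstar M → κ y = ρ y * (lam y)⁻¹)
    (hhξ : ∀ᶠ y in 𝓝 x, y ∈ cstar M → h y = (lam y)⁻¹ * mvfderiv (sphereModel V) lam y (ξ y)) :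
    ∃ r, (pullTangent V M).HolAt r x ∧
      ∀ᶠ y in 𝓝 x, y ∈ cstar M → r y = ρ y • 𝒮.trTLEConn d s y (ξ y) := by
  have hx := mem_of_mem_nhds hN
  have hN' := univ_prod_mem_nhds hN
  have hholM : ∀ i, (HolSheaf.tangent 𝓘(ℂ, V) M).HolAt (e i) x.2 := fun i => he.holAt hx i
  have hξ₂ := pullTangent_holAt_snd hξ
  let c := fun i => frameCoeff (fun i => pullField (V := V) (e i)) s i
  have hc : ∀ i, HolFunAt (sphereModel V) (c i) x := fun i => he.pull.coeff_holFunAt hN' hs i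
  have h1 : ∀ i, (pullTangent V M).HolAt (fun y => 𝒮.cov (e i) y.2 (sndPart (ξ y))) x := fun i =>
    pullTangent_map_holAt hN he (fun t => (𝒮.cov (e i) t).toLinearMap)
      (fun a ha => 𝒮.cov_holomorphic.holomorphic x.2 (mem_univ _) _ (hholM i) a ha) hξ₂
  have h2 : ∀ i, (pullTangent V M).HolAt (fun y => 𝒮.higgs y.2 (sndPart (ξ y)) (e i y.2)) x :=
    fun i => pullTangent_map_holAt hN he (fun t => (𝒮.higgs t).flip (e i t))
      (fun a ha => 𝒮.higgs_holomorphic x.2 _ _ ha (hholM i)) hξ₂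
  have h3 : ∀ i, (pullTangent V M).HolAt
      (pullField fun t => 𝒮.higgs t (𝒮.E t) (e i t)) x := fun i =>
    pullField_holAt (𝒮.higgs_holomorphic x.2 _ _ (𝒮.E_holomorphic x.2) (hholM i))
  have h4 : ∀ i, (pullTangent V M).HolAt (pullField fun t => 𝒮.cov 𝒮.E t (e i t)) x := fun i =>
    pullField_holAt (𝒮.cov_holomorphic.holomorphic x.2 (mem_univ _) _ (𝒮.E_holomorphic x.2) _
      (hholM i))
  have h5 : ∀ i, (pullTangent V M).HolAt (pullField (e i)) x := fun i => pullField_holAt (hholM i)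
  -- `T i` is `ρ D_ξ` of the pulled-back `e i`, with `κ` in place of `ρ/λ` and `h` in place of
  -- `dλ(ξ)/λ`; in this form it is holomorphic also on the divisor.
  let T : Fin n → Π x : OnePoint ℂ × M, TangentSpace 𝓘(ℂ, V) x.2 := fun i =>
    ρ • (fun y => 𝒮.cov (e i) y.2 (sndPart (ξ y)))
      + κ • (fun y => 𝒮.higgs y.2 (sndPart (ξ y)) (e i y.2))
      - (h • (κ • (pullField fun t => 𝒮.higgs t (𝒮.E t) (e i t))
          + ρ • (pullField fun t => 𝒮.cov 𝒮.E t (e i t))))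
      + ((2 - d) / 2) • (h • (ρ • pullField (e i)))
  have hT : ∀ i, (pullTangent V M).HolAt (T i) x := fun i => by
    let 𝓗 := pullTangent V M
    refine 𝓗.add_holAt (𝓗.sub_holAt (𝓗.add_holAt (𝓗.smul_holAt hρ (h1 i)) (𝓗.smul_holAt hκ (h2 i)))
      (𝓗.smul_holAt hh (𝓗.add_holAt (𝓗.smul_holAt hκ (h3 i)) (𝓗.smul_holAt hρ (h4 i)))))
      (𝓗.const_smul_holAt _ (𝓗.smul_holAt hh (𝓗.smul_holAt hρ (h5 i))))
  refine ⟨fun y => ∑ i, c i y • T i y +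
    ∑ i, (ρ y * mvfderiv (sphereModel V) (c i) y (ξ y)) • pullField (e i) y, ?_, ?_⟩
  · refine (pullTangent V M).add_holAt (s := fun y => ∑ i, c i y • T i y)
      ((pullTangent V M).sum_smul_holAt _ (fun i _ => hc i) fun i _ => hT i)
      ((pullTangent V M).sum_smul_holAt _ (fun i _ => hρ.mul ((hc i).mvfderiv hξ)) fun i _ => h5 i)
  · filter_upwards [hκρ, hhξ, (pullTangent V M).eventually_holAt hs,
      eventually_mem_nhds_iff.2 hN'] with y hκy hhy hsy hyN hyc
    have hD := (𝒮.isLeibnizOn_trTLEConn d (cstar M)).eq_sum hyc Finset.univ hsy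
      (fun i _ => he.pull.coeff_holFunAt hyN hsy i)
      (fun i _ => he.pull.holAt (mem_of_mem_nhds hyN) i)
      (he.pull.eventually_sum_coeff hyN s) (ξ y)
    rw [hD, ← Finset.sum_add_distrib, Finset.smul_sum]
    refine Finset.sum_congr rfl fun i _ => ?_
    rw [trTLEConn_pullField]
    simp only [T, Pi.add_apply, Pi.sub_apply, Pi.smul_apply, Pi.smul_apply']
    rw [hκy hyc, hhy hyc]
    module

variable {𝒮}

lemma trTLEConn_isConnectionOn (hframe : ∀ t : M, ∃ N ∈ 𝓝 t, ∃ (n : ℕ)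
    (e : Fin n → Π t : M, TangentSpace 𝓘(ℂ, V) t),
      (HolSheaf.tangent 𝓘(ℂ, V) M).IsFrameOn e N) :
    IsConnectionOn (pullTangent V M) (𝒮.trTLEConn d) (cstar M) where
  congr := (𝒮.isLeibnizOn_trTLEConn d _).congr
  add := (𝒮.isLeibnizOn_trTLEConn d _).add
  leibniz := (𝒮.isLeibnizOn_trTLEConn d _).leibniz
  holomorphic := by
    intro x hx s hs ξ hξ
    obtain ⟨N, hN, n, e, he⟩ := hframe x.2
    have hl := holFunAt_lam_inv (V := V) hx.1
    obtain ⟨r, hr, h⟩ := 𝒮.exists_trTLEConn_extension d hN he hs hξ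
      (ρ := fun _ => 1) (κ := fun y => (lam y)⁻¹)
      (h := fun y => (lam y)⁻¹ * mvfderiv (sphereModel V) lam y (ξ y))
      contMDiffAt_const hl (hl.mul ((holFunAt_lam hx.2).mvfderiv hξ))
      (Eventually.of_forall fun y _ => (one_mul _).symm) (Eventually.of_forall fun y _ => rfl)
    refine (pullTangent V M).congr_holAt hr ?_
    filter_upwards [h, isOpen_cstar.mem_nhds hx] with y hy hyc
    rw [hy hyc, one_smul]

/-- Near a point of `ℂ^* × M`, the connections for different `d` are conjugate by a nowhere vanishing
function. -/
lemma exists_conjugation {x : OnePoint ℂ × M} (hx : x ∈ cstar M) : ∃ f : OnePoint ℂ × M → ℂ,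
    ∀ᶠ y in 𝓝 x, y ∈ cstar M ∧ f y ≠ 0 ∧ HolFunAt (sphereModel V) f y ∧
      ∀ s, (pullTangent V M).HolAt s y → ∀ v : TangentSpace (sphereModel V) y,
        𝒮.trTLEConn 2 (f • s) y v = f y • 𝒮.trTLEConn d s y v := by
  have hl := lam_ne_zero hx
  let c : ℂ := (2 - d) / 2
  -- A solution of `dφ = c φ dλ/λ`. Dividing by `lam x` moves the base point to `1`, where the
  -- principal branch of the power is analytic.
  let φ : ℂ → ℂ := fun z => (z / lam x) ^ c
  have hcont : ContinuousAt (fun y : OnePoint ℂ × M => lam y / lam x) x := by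
    have := (holFunAt_lam (V := V) hx.2).continuousAt
    exact this.div_const _
  have hslit : ∀ᶠ y in 𝓝 x, lam y / lam x ∈ Complex.slitPlane :=
    hcont.eventually (Complex.isOpen_slitPlane.mem_nhds (by
      simp only [div_self hl]
      exact Complex.one_mem_slitPlane))
  refine ⟨fun y => φ (lam y), ?_⟩
  filter_upwards [hslit, isOpen_cstar.mem_nhds hx] with y hy hyc
  have hy0 := lam_ne_zero hyc
  have hne : lam y / lam x ≠ 0 := div_ne_zero hy0 hl
  have hφ : HasDerivAt φ (c * (lam y / lam x) ^ (c - 1) * (lam x)⁻¹) (lam y) := by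
    have h := ((hasDerivAt_id (lam y)).div_const (lam x)).cpow_const (c := c) hy
    simpa [φ, div_eq_mul_inv] using h
  have hφa : ContDiffAt ℂ ω φ (lam y) := by
    have h : AnalyticAt ℂ φ (lam y) :=
      AnalyticAt.cpow (analyticAt_id.div analyticAt_const hl) analyticAt_const hy
    exact h.contDiffAt
  have hf : HolFunAt (sphereModel V) (fun y : OnePoint ℂ × M => φ (lam y)) y :=
    ContMDiffAt.comp y (contMDiffAt_iff_contDiffAt.2 hφa) (holFunAt_lam hyc.2)
  refine ⟨hyc, ?_, hf, fun s hs v => ?_⟩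
  · simp [φ, Complex.cpow_eq_zero_iff, hne]
  · have hd : mvfderiv (sphereModel V) (fun y : OnePoint ℂ × M => φ (lam y)) y v =
        φ (lam y) * (c * (lam y)⁻¹ * mvfderiv (sphereModel V) lam y v) := by
      have h1 : mvfderiv (sphereModel V) (φ ∘ (lam : OnePoint ℂ × M → ℂ)) y v =
          mvfderiv 𝓘(ℂ, ℂ) φ (lam y) (mfderiv (sphereModel V) 𝓘(ℂ, ℂ) lam y v) :=
        mvfderiv_comp_apply y (hφ.differentiableAt.mdifferentiableAt)
          (holFunAt_lam hyc.2).mdifferentiableAt v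
      have h2 : mvfderiv 𝓘(ℂ, ℂ) φ (lam y) (mfderiv (sphereModel V) 𝓘(ℂ, ℂ) lam y v) =
          mvfderiv (sphereModel V) lam y v * (c * (lam y / lam x) ^ (c - 1) * (lam x)⁻¹) := by
        change mfderiv 𝓘(ℂ, ℂ) 𝓘(ℂ, ℂ) φ (lam y) _ = _
        rw [mfderiv_eq_fderiv, hφ.hasFDerivAt.fderiv]
        rfl
      refine h1.trans (h2.trans ?_)
      simp only [φ]
      rw [Complex.cpow_sub _ _ hne, Complex.cpow_one]
      field_simp
    rw [(𝒮.isLeibnizOn_trTLEConn 2 (cstar M)).leibniz y hyc _ s hf hs v, hd,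
      𝒮.trTLEConn_eq_add d]
    module

/-- Two applications of the conjugation show that the curvature for `d = 2` on `f • s` is `f` times
the curvature for `d` on `s`. The former vanishes by `hat_flat`, and `f x ≠ 0`. -/
lemma trTLEConn_isFlatOn (hD : ∀ d, IsConnectionOn (pullTangent V M) (𝒮.trTLEConn d) (cstar M)) :
    IsFlatOn (pullTangent V M) (𝒮.trTLEConn d) (cstar M) := by
  intro x hx s hs ξ η hξ hη
  obtain ⟨f, hf⟩ := 𝒮.exists_conjugation d hx
  obtain ⟨-, hf0, hfx, hconj⟩ := hf.self_of_nhds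
  have key : ∀ ζ : Π y : OnePoint ℂ × M, TangentSpace (sphereModel V) y,
      (HolSheaf.tangent (sphereModel V) (OnePoint ℂ × M)).HolAt ζ x →
      ∀ v : TangentSpace (sphereModel V) x,
        𝒮.trTLEConn 2 (fun y => 𝒮.trTLEConn 2 (f • s) y (ζ y)) x v =
          f x • 𝒮.trTLEConn d (fun y => 𝒮.trTLEConn d s y (ζ y)) x v := by
    intro ζ hζ v
    have hA := (hD d).holomorphic x hx s hs ζ hζ
    have h1 := (hD 2).congr x hx (f • fun y => 𝒮.trTLEConn d s y (ζ y))
      (fun y => 𝒮.trTLEConn 2 (f • s) y (ζ y)) ((pullTangent V M).smul_holAt hfx hA) (by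
        filter_upwards [hf, (pullTangent V M).eventually_holAt hs] with y hy hsy
        exact (hy.2.2.2 s hsy (ζ y)).symm)
    rw [← h1, hconj _ hA]
  have h := 𝒮.hat_flat x hx (f • s) ((pullTangent V M).smul_holAt hfx hs) ξ η hξ hη
  rw [hatConn_eq_trTLEConn, key η hη, key ξ hξ, hconj s hs, ← smul_sub, ← smul_sub] at h
  exact (smul_eq_zero.1 h).resolve_left hf0

lemma trTLEConn_isTrTLE (hframe : ∀ t : M, ∃ N ∈ 𝓝 t, ∃ (n : ℕ)
    (e : Fin n → Π t : M, TangentSpace 𝓘(ℂ, V) t),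
      (HolSheaf.tangent 𝓘(ℂ, V) M).IsFrameOn e N) :
    IsTrTLE (pullTangent V M) (𝒮.trTLEConn d) := by
  have hpull : ∀ t : M, ∃ N ∈ 𝓝 t, ∃ (n : ℕ)
      (e : Fin n → Π x : OnePoint ℂ × M, TangentSpace 𝓘(ℂ, V) x.2),
      (pullTangent V M).IsFrameOn e (univ ×ˢ N) := fun t => by
    obtain ⟨N, hN, n, e, he⟩ := hframe t
    exact ⟨N, hN, n, _, he.pull⟩
  refine ⟨isVectorBundle_of_frames hpull, isAdjointIso_of_frames hpull,
    trTLEConn_isConnectionOn d hframe,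
    trTLEConn_isFlatOn d fun d => trTLEConn_isConnectionOn d hframe, ?_, ?_⟩
  · intro x hx s hs ξ hξ hlog
    obtain ⟨N, hN, n, e, he⟩ := hframe x.2
    obtain ⟨h, hh, hhξ⟩ := exists_dlog_extension_zero hx hξ hlog
    -- At `λ = 0` the factor `ρ = λ` absorbs the remaining `λ⁻¹`, so `κ = 1`; at `λ = ∞` no factor
    -- is needed, as `κ = λ⁻¹` is itself holomorphic.
    exact 𝒮.exists_trTLEConn_extension d hN he hs hξ (ρ := lam) (κ := fun _ => 1) (h := h)
      (holFunAt_lam (hx ▸ OnePoint.coe_ne_infty _)) contMDiffAt_const hh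
      (Eventually.of_forall fun y hy => (mul_inv_cancel₀ (lam_ne_zero hy)).symm) hhξ
  · intro x hx s hs ξ hξ hlog
    obtain ⟨N, hN, n, e, he⟩ := hframe x.2
    obtain ⟨h, hh, hhξ⟩ := exists_dlog_extension_infty hx hξ hlog
    obtain ⟨r, hr, hrD⟩ := 𝒮.exists_trTLEConn_extension d hN he hs hξ (ρ := fun _ => 1)
      (κ := fun y => (lam y)⁻¹) (h := h) contMDiffAt_const
      (holFunAt_lam_inv (hx ▸ OnePoint.infty_ne_coe _)) hh
      (Eventually.of_forall fun y hy => (one_mul _).symm) hhξ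
    refine ⟨r, hr, ?_⟩
    filter_upwards [hrD] with y hy hyc
    rw [hy hyc, one_smul]

end SaitoStructure

/-! ### Stability of the filtration under the connection. -/

namespace MixedFrobeniusStructure

variable {d : ℂ} (𝓕 : MixedFrobeniusStructure V M d)

lemma exists_frame {d : ℂ} (𝓕 : MixedFrobeniusStructure V M d) (t : M) : ∃ N ∈ 𝓝 t, ∃ (n : ℕ)
    (e : Fin n → Π t : M, TangentSpace 𝓘(ℂ, V) t),
      (HolSheaf.tangent 𝓘(ℂ, V) M).IsFrameOn e N := by
  obtain ⟨N, hN, n, e, -, he, -⟩ := 𝓕.subbundle 0 t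
  exact ⟨N, hN, n, e, he⟩

/-- A vector of `𝓘_k` extends to a holomorphic section of `𝓘_k`. -/
lemma exists_section (k : ℤ) {t : M} {v : TangentSpace 𝓘(ℂ, V) t} (hv : v ∈ 𝓕.fil k t) :
    ∃ a : Π t : M, TangentSpace 𝓘(ℂ, V) t, (HolSheaf.tangent 𝓘(ℂ, V) M).HolAt a t ∧
      (∀ᶠ u in 𝓝 t, a u ∈ 𝓕.fil k u) ∧ a t = v := by
  classical
  obtain ⟨N, hN, n, e, S, he, hS⟩ := 𝓕.subbundle k t
  have ht := mem_of_mem_nhds hN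
  obtain ⟨s, rfl⟩ : ∃ s : Π t : M, TangentSpace 𝓘(ℂ, V) t, s t = v :=
    ⟨Function.update 0 t v, by simp⟩
  rw [hS t ht, he.mem_span_iff ht] at hv
  -- The coefficients are frozen at `t`. Those outside `S` vanish there, so the section stays in
  -- `𝓘_k` near `t`.
  refine ⟨fun u => ∑ i, frameCoeff e s i t • e i u,
    (HolSheaf.tangent 𝓘(ℂ, V) M).sum_smul_holAt _ (fun i _ => contMDiffAt_const)
      fun i _ => he.holAt ht i, ?_, he.sum_coeff ht s⟩
  filter_upwards [hN] with u hu
  rw [hS u hu]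
  refine sum_mem fun i _ => ?_
  by_cases hi : i ∈ S
  · exact Submodule.smul_mem _ _ (Submodule.subset_span ⟨i, hi, rfl⟩)
  · simp [hv i hi]

/-- By torsion-freeness `∇_a E = ∇_E a - [E, a]`; the first term lies in `𝓘_k` by flatness of `𝓘_k`,
the second by `E`-closedness. -/
lemma cov_E_mem (k : ℤ) {t : M} {v : TangentSpace 𝓘(ℂ, V) t} (hv : v ∈ 𝓕.fil k t) :
    𝓕.cov 𝓕.E t v ∈ 𝓕.fil k t := by
  obtain ⟨a, ha, hak, rfl⟩ := 𝓕.exists_section k hv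
  have h := 𝓕.torsion_free t 𝓕.E a (𝓕.E_holomorphic t) ha
  have h1 : 𝓕.cov a t (𝓕.E t) ∈ 𝓕.fil k t := 𝓕.cov_invariant k t (mem_univ _) a ha hak (𝓕.E t)
  have h2 := 𝓕.E_closed k t a ha hak
  rw [← h] at h2
  have h3 := sub_mem h1 h2
  rwa [sub_sub_cancel] at h3

lemma weight_isSubbundle (k : ℤ) : (pullTangent V M).IsSubbundle (𝓕.weight k) :=
  (𝓕.subbundle k).pull

lemma trTLEConn_isConnectionOn :
    IsConnectionOn (pullTangent V M) (𝓕.toSaitoStructure.trTLEConn d) (cstar M) :=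
  SaitoStructure.trTLEConn_isConnectionOn d 𝓕.exists_frame

lemma trTLEConn_pullField_mem (k : ℤ) {x : OnePoint ℂ × M}
    {a : Π t : M, TangentSpace 𝓘(ℂ, V) t} (ha : (HolSheaf.tangent 𝓘(ℂ, V) M).HolAt a x.2)
    (hak : ∀ᶠ u in 𝓝 x.2, a u ∈ 𝓕.fil k u) (v : TangentSpace (sphereModel V) x) :
    𝓕.toSaitoStructure.trTLEConn d (pullField a) x v ∈ 𝓕.fil k x.2 := by
  have ha' := hak.self_of_nhds
  rw [SaitoStructure.trTLEConn_pullField]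
  refine add_mem (sub_mem (add_mem ?_ ?_) ?_) ?_
  · exact 𝓕.cov_invariant k x.2 (mem_univ _) a ha hak (sndPart v)
  · exact Submodule.smul_mem _ _ (𝓕.higgs_invariant k _ _ _ ha')
  · exact Submodule.smul_mem _ _ (Submodule.smul_mem _ _ (add_mem
      (Submodule.smul_mem _ _ (𝓕.higgs_invariant k _ _ _ ha')) (𝓕.cov_E_mem k ha')))
  · exact Submodule.smul_mem _ _ (Submodule.smul_mem _ _ ha')

lemma weight_isFlatSubbundleOn (k : ℤ) : IsFlatSubbundleOn (pullTangent V M)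
    (𝓕.toSaitoStructure.trTLEConn d) (𝓕.weight k) (cstar M) := by
  intro x hx s hs hsW v
  obtain ⟨N, hN, n, e, S, he, hS⟩ := 𝓕.subbundle k x.2
  have hN' := univ_prod_mem_nhds hN
  have ht := mem_of_mem_nhds hN
  have hD := (𝓕.toSaitoStructure.isLeibnizOn_trTLEConn d (cstar M)).eq_sum hx Finset.univ hs
    (fun i _ => he.pull.coeff_holFunAt hN' hs i)
    (fun i _ => he.pull.holAt (mem_of_mem_nhds hN') i) (he.pull.eventually_sum_coeff hN' s) v
  -- These coefficients vanish on a neighbourhood and not only at `x`, so their derivatives in the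
  -- Leibniz expansion vanish too.
  have hzero : ∀ i ∉ S, frameCoeff (fun i => pullField (V := V) (e i)) s i =ᶠ[𝓝 x] fun _ => 0 := by
    intro i hi
    filter_upwards [hN', hsW] with y hy hsy
    have h : s y ∈ 𝓕.fil k y.2 := hsy
    rw [hS y.2 hy.2] at h
    exact (he.pull.mem_span_iff hy S s).1 h i hi
  rw [hD]
  refine sum_mem fun i _ => ?_
  by_cases hi : i ∈ S
  · have hmem : ∀ᶠ u in 𝓝 x.2, e i u ∈ 𝓕.fil k u := by
      filter_upwards [hN] with u hu
      rw [hS u hu]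
      exact Submodule.subset_span ⟨i, hi, rfl⟩
    exact add_mem (Submodule.smul_mem _ _ (𝓕.trTLEConn_pullField_mem k (he.holAt ht i) hmem v))
      (Submodule.smul_mem _ _ hmem.self_of_nhds)
  · rw [(hzero i hi).self_of_nhds, mvfderiv_congr (hzero i hi), mvfderiv_const]
    simp

lemma gr_isTrTLE (k : ℤ) (hframe : ∀ t : M, ∃ N ∈ 𝓝 t, ∃ (n : ℕ)
    (e : Fin n → Π x : OnePoint ℂ × M, Gr 𝓕.weight k x),
      ((pullTangent V M).gr 𝓕.weight k).IsFrameOn e (univ ×ˢ N)) :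
    IsTrTLE ((pullTangent V M).gr 𝓕.weight k)
      (grConn (pullTangent V M) (𝓕.toSaitoStructure.trTLEConn d) 𝓕.weight k) := by
  have hT : IsTrTLE (pullTangent V M) (𝓕.toSaitoStructure.trTLEConn d) :=
    SaitoStructure.trTLEConn_isTrTLE d 𝓕.exists_frame
  have hW := 𝓕.weight_isFlatSubbundleOn k
  have hW' := 𝓕.weight_isFlatSubbundleOn (k - 1)
  refine ⟨isVectorBundle_of_frames hframe, isAdjointIso_of_frames hframe,
    grConn_isConnectionOn isOpen_cstar hT.connection hW hW',
    grConn_isFlatOn isOpen_cstar hT.connection hT.flat hW hW', ?_, ?_⟩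
  · rintro x hx q ⟨s, hs⟩ ξ hξ hlog
    exact exists_gr_extension hT.connection hW hW' (𝓕.weight_isSubbundle k) hs lam ξ
      (hT.pole_zero x hx s hs.1 ξ hξ hlog)
  · rintro x hx q ⟨s, hs⟩ ξ hξ hlog
    obtain ⟨r, hr, h⟩ := hT.log_infty x hx s hs.1 ξ hξ hlog
    obtain ⟨r', hr', h'⟩ := exists_gr_extension hT.connection hW hW' (𝓕.weight_isSubbundle k) hs
      (fun _ => 1) ξ ⟨r, hr, h.mono fun y hy hyc => by rw [hy hyc, one_smul]⟩
    exact ⟨r', hr', h'.mono fun y hy hyc => by rw [hy hyc, one_smul]⟩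

end MixedFrobeniusStructure

end TrTLEStructure

/-! ### The pairings: reduction to frames, flatness, symmetry and non-degeneracy. -/

section Pairings

set_option linter.unusedSectionVars false

lemma mvfderiv_finset_sum {B : Type*} [NormedAddCommGroup B] [NormedSpace ℂ B] {H : Type*}
    [TopologicalSpace H] {I : ModelWithCorners ℂ B H} {X : Type*} [TopologicalSpace X]
    [ChartedSpace H X] {ι : Type*} (u : Finset ι) {f : ι → X → ℂ} {x : X}
    (hf : ∀ i ∈ u, HolFunAt I (f i) x) (v : TangentSpace I x) :
    mvfderiv I (fun y => ∑ i ∈ u, f i y) x v = ∑ i ∈ u, mvfderiv I (f i) x v := by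
  classical
  induction u using Finset.induction_on with
  | empty => simp [mvfderiv_const]
  | insert a u ha ih =>
    have h := fun i hi => hf i (Finset.mem_insert_of_mem hi)
    simp_rw [Finset.sum_insert ha]
    rw [mvfderiv_fun_add (hf a (Finset.mem_insert_self a u)).mdifferentiableAt
      (HolFunAt.mdifferentiableAt (contMDiffAt_finsetSum h)), ← ih h]
    rfl

lemma mvfderiv_fun_mul_apply {B : Type*} [NormedAddCommGroup B] [NormedSpace ℂ B] {H : Type*}
    [TopologicalSpace H] {I : ModelWithCorners ℂ B H} {X : Type*} [TopologicalSpace X]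
    [ChartedSpace H X] {f g : X → ℂ} {x : X} (hf : HolFunAt I f x) (hg : HolFunAt I g x)
    (v : TangentSpace I x) : mvfderiv I (fun y => f y * g y) x v =
      f x * mvfderiv I g x v + g x * mvfderiv I f x v := by
  rw [mvfderiv_fun_mul hf.mdifferentiableAt hg.mdifferentiableAt]
  rfl

variable {V : Type*} [NormedAddCommGroup V] [NormedSpace ℂ V] {M : Type*} [TopologicalSpace M]
  [ChartedSpace V M]

section Frame

variable {F : OnePoint ℂ × M → Type*} [∀ x, AddCommGroup (F x)] [∀ x, Module ℂ (F x)]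
  {𝓗 : HolSheaf (sphereModel V) F} {P : Π x, F x →ₗ[ℂ] F (invol x) →ₗ[ℂ] ℂ} {n : ℕ}
  {e : Fin n → Π x, F x} {U : Set (OnePoint ℂ × M)} {x : OnePoint ℂ × M} {s s' : Π x, F x}

lemma eventually_pairing_eq_sum (he : 𝓗.IsFrameOn e U) (hx : U ∈ 𝓝 x) (hx' : U ∈ 𝓝 (invol x)) :
    (fun y => P y (s y) (s' (invol y))) =ᶠ[𝓝 x] fun y => ∑ i, ∑ j, frameCoeff e s i y *
      (frameCoeff e s' j (invol y) * P y (e i y) (e j (invol y))) := by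
  filter_upwards [he.eventually_sum_coeff hx s, (contMDiff_invol (V := V)).continuous.continuousAt.eventually
    (he.eventually_sum_coeff hx' s')] with y hy hy'
  conv_lhs => rw [hy, hy']
  simp only [map_sum, map_smul, LinearMap.sum_apply, LinearMap.smul_apply, smul_eq_mul,
    Finset.mul_sum]
  rw [Finset.sum_comm]
  exact Finset.sum_congr rfl fun i _ => Finset.sum_congr rfl fun j _ => by ring

lemma holFunAt_comp_invol {f : OnePoint ℂ × M → ℂ} (hf : HolFunAt (sphereModel V) f (invol x)) :
    HolFunAt (sphereModel V) (fun y => f (invol y)) x :=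
  ContMDiffAt.comp x hf contMDiff_invol.contMDiffAt

/-- A pairing is holomorphic if it is so on a frame. -/
lemma pairing_holFunAt_of_frame (he : 𝓗.IsFrameOn e U) (hx : U ∈ 𝓝 x) (hx' : U ∈ 𝓝 (invol x))
    (hP : ∀ i j, HolFunAt (sphereModel V) (fun y => P y (e i y) (e j (invol y))) x)
    (hs : 𝓗.HolAt s x) (hs' : 𝓗.HolAt s' (invol x)) :
    HolFunAt (sphereModel V) (fun y => P y (s y) (s' (invol y))) x := by
  refine ContMDiffAt.congr_of_eventuallyEq ?_ (eventually_pairing_eq_sum he hx hx')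
  exact contMDiffAt_finsetSum fun i _ => contMDiffAt_finsetSum fun j _ =>
    (he.coeff_holFunAt hx hs i).mul
      ((holFunAt_comp_invol (he.coeff_holFunAt hx' hs' j)).mul (hP i j))

variable [IsManifold 𝓘(ℂ, V) ω M]

/-- A pairing is flat if it is so on a frame. -/
lemma pairing_flat_of_frame {D : ConnOp (sphereModel V) F} (hD : IsLeibnizOn 𝓗 D (cstar M))
    (hxc : x ∈ cstar M) (he : 𝓗.IsFrameOn e U) (hx : U ∈ 𝓝 x) (hx' : U ∈ 𝓝 (invol x))
    (hP : ∀ i j, HolFunAt (sphereModel V) (fun y => P y (e i y) (e j (invol y))) x)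
    (hs : 𝓗.HolAt s x) (hs' : 𝓗.HolAt s' (invol x)) (v : TangentSpace (sphereModel V) x)
    (hflat : ∀ i j, mvfderiv (sphereModel V) (fun y => P y (e i y) (e j (invol y))) x v =
      P x (D (e i) x v) (e j (invol x)) + P x (e i x)
        (D (e j) (invol x) (mfderiv (sphereModel V) (sphereModel V) invol x v))) :
    mvfderiv (sphereModel V) (fun y => P y (s y) (s' (invol y))) x v =
      P x (D s x v) (s' (invol x)) + P x (s x)
        (D s' (invol x) (mfderiv (sphereModel V) (sphereModel V) invol x v)) := by
  set w := mfderiv (sphereModel V) (sphereModel V) invol x v with hw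
  have hc := fun i => he.coeff_holFunAt hx hs i
  have hc' := fun j => he.coeff_holFunAt hx' hs' j
  have hcj := fun j => holFunAt_comp_invol (hc' j)
  have hdc : ∀ j, mvfderiv (sphereModel V) (fun y => frameCoeff e s' j (invol y)) x v =
      mvfderiv (sphereModel V) (frameCoeff e s' j) (invol x) w := fun j =>
    mvfderiv_comp_apply x (hc' j).mdifferentiableAt
      (contMDiff_invol.contMDiffAt.mdifferentiableAt (by simp)) v
  have hxU := mem_of_mem_nhds hx
  have hxU' := mem_of_mem_nhds hx'
  have hterm : ∀ i j, HolFunAt (sphereModel V) (fun y => frameCoeff e s' j (invol y) *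
      P y (e i y) (e j (invol y))) x := fun i j => (hcj j).mul (hP i j)
  have hterm' : ∀ i j, HolFunAt (sphereModel V) (fun y => frameCoeff e s i y *
      (frameCoeff e s' j (invol y) * P y (e i y) (e j (invol y)))) x :=
    fun i j => (hc i).mul (hterm i j)
  have hrow : ∀ i, HolFunAt (sphereModel V) (fun y => ∑ j, frameCoeff e s i y *
      (frameCoeff e s' j (invol y) * P y (e i y) (e j (invol y)))) x :=
    fun i => contMDiffAt_finsetSum fun j _ => hterm' i j
  rw [mvfderiv_congr (eventually_pairing_eq_sum he hx hx') v,
    mvfderiv_finset_sum _ (fun i _ => hrow i),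
    hD.eq_sum hxc Finset.univ hs (fun i _ => hc i) (fun i _ => he.holAt hxU i)
      (he.eventually_sum_coeff hx s) v,
    hD.eq_sum (invol_mem_cstar hxc) Finset.univ hs' (fun i _ => hc' i)
      (fun i _ => he.holAt hxU' i) (he.eventually_sum_coeff hx' s') w]
  conv_rhs => rw [← he.sum_coeff hxU s, ← he.sum_coeff hxU' s']
  simp only [map_sum, LinearMap.sum_apply, ← Finset.sum_add_distrib]
  rw [Finset.sum_comm]
  refine Finset.sum_congr rfl fun j _ => ?_
  rw [mvfderiv_finset_sum _ (fun l _ => hterm' j l)]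
  refine Finset.sum_congr rfl fun l _ => ?_
  rw [mvfderiv_fun_mul_apply (hc j) (hterm j l), mvfderiv_fun_mul_apply (hcj l) (hP j l), hdc, hflat]
  simp only [map_add, map_smul, LinearMap.add_apply, LinearMap.smul_apply, smul_eq_mul]
  ring

end Frame

variable [IsManifold 𝓘(ℂ, V) ω M]

/-- Together with `lam_invol` this shows that `dλ/λ` is invariant under `j`, while `λ⁻¹` changes
sign. -/
lemma mvfderiv_lam_invol {x : OnePoint ℂ × M} (hx : x ∈ cstar M)
    (v : TangentSpace (sphereModel V) x) : mvfderiv (sphereModel V) lam (invol x)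
      (mfderiv (sphereModel V) (sphereModel V) invol x v) = - mvfderiv (sphereModel V) lam x v := by
  have h : mvfderiv (sphereModel V) (lam ∘ (invol : OnePoint ℂ × M → _)) x v = mvfderiv
      (sphereModel V) lam (invol x) (mfderiv (sphereModel V) (sphereModel V) invol x v) :=
    mvfderiv_comp_apply x (holFunAt_lam (invol_mem_cstar hx).2).mdifferentiableAt
      (contMDiff_invol.contMDiffAt.mdifferentiableAt (by simp)) v
  have h' : mvfderiv (sphereModel V) (lam ∘ (invol : OnePoint ℂ × M → _)) x v =
      mvfderiv (sphereModel V) (fun y => -lam y) x v :=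
    mvfderiv_congr (Eventually.of_forall lam_invol) v
  rw [← h, h', mvfderiv_fun_neg]
  rfl

lemma sndPart_invol (x : OnePoint ℂ × M) (v : TangentSpace (sphereModel V) x) :
    sndPart (mfderiv (sphereModel V) (sphereModel V) invol x v) = sndPart v :=
  (mfderiv_comp_apply (I := sphereModel V) (I' := sphereModel V) (I'' := 𝓘(ℂ, V))
    (f := (invol : OnePoint ℂ × M → _)) (g := Prod.snd) x mdifferentiableAt_snd
    (contMDiff_invol.contMDiffAt.mdifferentiableAt (by simp)) v).symm

lemma holFunAt_lam_zpow {x : OnePoint ℂ × M} (hx : x ∈ cstar M) (m : ℤ) :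
    HolFunAt (sphereModel V) (fun y => lam y ^ m) x := by
  have h : AnalyticAt ℂ (fun z : ℂ => z ^ m) (lam x) := analyticAt_id.zpow (lam_ne_zero hx)
  exact ContMDiffAt.comp (g := fun z : ℂ => z ^ m) x (contMDiffAt_iff_contDiffAt.2 h.contDiffAt)
    (holFunAt_lam hx.2)

lemma mvfderiv_lam_zpow {x : OnePoint ℂ × M} (hx : x ∈ cstar M) (m : ℤ)
    (v : TangentSpace (sphereModel V) x) :
    mvfderiv (sphereModel V) (fun y => lam y ^ m) x v =
      m * lam x ^ (m - 1) * mvfderiv (sphereModel V) lam x v := by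
  have hd := hasDerivAt_zpow m (lam x) (Or.inl (lam_ne_zero hx))
  have h1 : mvfderiv (sphereModel V) ((fun z : ℂ => z ^ m) ∘ (lam : OnePoint ℂ × M → ℂ)) x v =
      mvfderiv 𝓘(ℂ, ℂ) (fun z : ℂ => z ^ m) (lam x) (mfderiv (sphereModel V) 𝓘(ℂ, ℂ) lam x v) :=
    mvfderiv_comp_apply x hd.differentiableAt.mdifferentiableAt
      (holFunAt_lam hx.2).mdifferentiableAt v
  refine h1.trans ?_
  change mfderiv 𝓘(ℂ, ℂ) 𝓘(ℂ, ℂ) (fun z : ℂ => z ^ m) (lam x) _ = _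
  rw [mfderiv_eq_fderiv, hd.hasFDerivAt.fderiv]
  exact mul_comm (mvfderiv (sphereModel V) lam x v) _

lemma holFunAt_comp_snd {f : M → ℂ} {x : OnePoint ℂ × M} (hf : HolFunAt 𝓘(ℂ, V) f x.2) :
    HolFunAt (sphereModel V) (fun y : OnePoint ℂ × M => f y.2) x :=
  ContMDiffAt.comp x hf contMDiffAt_snd

lemma mvfderiv_comp_snd {f : M → ℂ} {x : OnePoint ℂ × M} (hf : HolFunAt 𝓘(ℂ, V) f x.2)
    (v : TangentSpace (sphereModel V) x) :
    mvfderiv (sphereModel V) (fun y : OnePoint ℂ × M => f y.2) x v =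
      mvfderiv 𝓘(ℂ, V) f x.2 (sndPart v) :=
  mvfderiv_comp_apply (f := (Prod.snd : OnePoint ℂ × M → M)) x hf.mdifferentiableAt
    mdifferentiableAt_snd v

namespace MixedFrobeniusStructure

variable [FiniteDimensional ℂ V] {d : ℂ} (𝓕 : MixedFrobeniusStructure V M d)

/-- Locally, the graded pieces of the filtration and of its pull-back to `ℙ¹ × M` have a frame that
consists of the classes of holomorphic vector fields on `M`. -/
lemma exists_gr_frame (k : ℤ) (t : M) : ∃ N : Set M, IsOpen N ∧ t ∈ N ∧ ∃ (r : ℕ)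
    (e : Fin r → Π t : M, TangentSpace 𝓘(ℂ, V) t),
    (∀ u ∈ N, ∀ a, (HolSheaf.tangent 𝓘(ℂ, V) M).HolAt (e a) u ∧ e a u ∈ 𝓕.fil k u) ∧
    ((pullTangent V M).gr 𝓕.weight k).IsFrameOn
      (fun a y => toGr 𝓕.weight k y (pullField (e a) y)) (univ ×ˢ N) := by
  have hle : ∀ u, 𝓕.fil (k - 1) u ≤ 𝓕.fil k u := fun u => by
    have h := 𝓕.increasing (k - 1) u
    rwa [sub_add_cancel] at h
  obtain ⟨N, hN, ht, n, e, T, S, he, hT, hS⟩ :=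
    HolSheaf.IsSubbundle.exists_adapted_frame (𝓕.subbundle (k - 1)) (𝓕.subbundle k) hle t
  have : Fintype ↥(S \ T) := Fintype.ofFinite _
  refine ⟨N, hN, ht, _, fun a => e ((Fintype.equivFin ↥(S \ T)).symm a), fun u hu a =>
    ⟨he.holAt hu _, ?_⟩, ?_⟩
  · rw [hS u hu]
    exact Submodule.subset_span ⟨_, ((Fintype.equivFin ↥(S \ T)).symm a).2.1, rfl⟩
  · exact he.pull.gr (isOpen_univ.prod hN) (fun y hy => hT y.2 hy.2) (fun y hy => hS y.2 hy.2) _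

/-- `g(∇_a E, b) + g(a, ∇_b E) = (2 - d + k) g(a, b)`. -/
lemma g_cov_E (k : ℤ) {t : M} {a b : TangentSpace 𝓘(ℂ, V) t} (ha : a ∈ 𝓕.fil k t)
    (hb : b ∈ 𝓕.fil k t) :
    𝓕.g k t (toGr 𝓕.fil k t (𝓕.cov 𝓕.E t a)) (toGr 𝓕.fil k t b) +
      𝓕.g k t (toGr 𝓕.fil k t a) (toGr 𝓕.fil k t (𝓕.cov 𝓕.E t b)) =
        (2 - d + k) * 𝓕.g k t (toGr 𝓕.fil k t a) (toGr 𝓕.fil k t b) := by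
  obtain ⟨A, hA, hAk, rfl⟩ := 𝓕.exists_section k ha
  obtain ⟨B, hB, hBk, rfl⟩ := 𝓕.exists_section k hb
  -- Flatness of `g` expands `E(g(A, B))`, and torsion-freeness rewrites the brackets `[E, A]` and
  -- `[E, B]`. The terms with `∇_E A` and `∇_E B` cancel.
  have h := 𝓕.g_lie k t A B hA hB hAk hBk
  rw [𝓕.g_flat k t A B hA hB hAk hBk (𝓕.E t),
    ← 𝓕.torsion_free t 𝓕.E A (𝓕.E_holomorphic t) hA,
    ← 𝓕.torsion_free t 𝓕.E B (𝓕.E_holomorphic t) hB,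
    toGr_sub (v := 𝓕.cov A t (𝓕.E t)) (𝓕.cov_invariant k t (mem_univ _) A hA hAk (𝓕.E t))
      (𝓕.cov_E_mem k ha),
    toGr_sub (v := 𝓕.cov B t (𝓕.E t)) (𝓕.cov_invariant k t (mem_univ _) B hB hBk (𝓕.E t))
      (𝓕.cov_E_mem k hb),
    map_sub, map_sub, LinearMap.sub_apply] at h
  rw [← h]
  ring

lemma g_bijective (k : ℤ) (t : M) : Function.Bijective (𝓕.g k t) := by
  have : FiniteDimensional ℂ (TangentSpace 𝓘(ℂ, V) t) := inferInstanceAs (FiniteDimensional ℂ V)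
  have hi : Function.Injective (𝓕.g k t) :=
    LinearMap.ker_eq_bot.1 (LinearMap.separatingLeft_iff_ker_eq_bot.1 (𝓕.g_nondegenerate k t).1)
  exact ⟨hi, (LinearMap.injective_iff_surjective_of_finrank_eq_finrank
    Subspace.dual_finrank_eq.symm).1 hi⟩

lemma pairing_symm (k : ℤ) (x : OnePoint ℂ × M) (s s' : Π y, Gr 𝓕.weight k y) :
    𝓕.pairing k (invol x) (s' (invol x)) (s (invol (invol x))) =
      (-1) ^ (-k) * 𝓕.pairing k x (s x) (s' (invol x)) := by
  -- Fibres depend only on the point of `M`, so values at `j (j x)` and at `x` lie in the same space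
  -- and can be compared.
  have h : (s (invol (invol x)) : Gr 𝓕.fil k x.2) = s x :=
    congrArg (β := Gr 𝓕.fil k x.2) (fun l => s (l, x.2)) (map_neg_map_neg x.1)
  have h1 : 𝓕.pairing k (invol x) (s' (invol x)) (s (invol (invol x))) =
      lam (invol x) ^ (-k) * 𝓕.g k x.2 (s' (invol x)) (s x) :=
    congrArg (fun q => lam (invol x) ^ (-k) * 𝓕.g k x.2 (s' (invol x)) q) h
  have h2 : ∀ q q' : Gr 𝓕.fil k x.2, lam (invol x) ^ (-k) * 𝓕.g k x.2 q' q =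
      (-1) ^ (-k) * (lam x ^ (-k) * 𝓕.g k x.2 q q') := fun q q' => by
    rw [lam_invol, 𝓕.g_symm, ← neg_one_mul, mul_zpow, mul_assoc]
  exact h1.trans (h2 (s x) (s' (invol x)))

lemma g_holFunAt (k : ℤ) {t : M} {a b : Π t : M, TangentSpace 𝓘(ℂ, V) t}
    (ha : (HolSheaf.tangent 𝓘(ℂ, V) M).HolAt a t) (hb : (HolSheaf.tangent 𝓘(ℂ, V) M).HolAt b t)
    (hak : ∀ᶠ u in 𝓝 t, a u ∈ 𝓕.fil k u) (hbk : ∀ᶠ u in 𝓝 t, b u ∈ 𝓕.fil k u) :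
    HolFunAt 𝓘(ℂ, V) (fun u => 𝓕.g k u (toGr 𝓕.fil k u (a u)) (toGr 𝓕.fil k u (b u))) t :=
  𝓕.g_holomorphic k t _ _ ⟨a, ha, hak.mono fun _ h => ⟨h, rfl⟩⟩
    ⟨b, hb, hbk.mono fun _ h => ⟨h, rfl⟩⟩

/-- The pairing with the class of `(∇̂ + (2 - d)/2 dλ/λ)_v a`, for a section `a` of `𝓘_k`. -/
lemma g_trTLEConn (k : ℤ) {x : OnePoint ℂ × M} {a : Π t : M, TangentSpace 𝓘(ℂ, V) t}
    (ha : (HolSheaf.tangent 𝓘(ℂ, V) M).HolAt a x.2) (hak : ∀ᶠ u in 𝓝 x.2, a u ∈ 𝓕.fil k u)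
    (v : TangentSpace (sphereModel V) x) (L : Gr 𝓕.fil k x.2 →ₗ[ℂ] ℂ) :
    L (toGr 𝓕.fil k x.2 (𝓕.toSaitoStructure.trTLEConn d (pullField a) x v)) =
      L (toGr 𝓕.fil k x.2 (𝓕.cov a x.2 (sndPart v))) +
      (lam x)⁻¹ * L (toGr 𝓕.fil k x.2 (𝓕.higgs x.2 (sndPart v) (a x.2))) -
      mvfderiv (sphereModel V) lam x v * ((lam x)⁻¹ *
        ((lam x)⁻¹ * L (toGr 𝓕.fil k x.2 (𝓕.higgs x.2 (𝓕.E x.2) (a x.2))) +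
          L (toGr 𝓕.fil k x.2 (𝓕.cov 𝓕.E x.2 (a x.2))))) +
      mvfderiv (sphereModel V) lam x v * ((2 - d) / 2 * (lam x)⁻¹ *
        L (toGr 𝓕.fil k x.2 (a x.2))) := by
  have h0 := hak.self_of_nhds
  have h1 : 𝓕.cov a x.2 (sndPart v) ∈ 𝓕.fil k x.2 :=
    𝓕.cov_invariant k x.2 (mem_univ _) a ha hak (sndPart v)
  have h2 := fun w => 𝓕.higgs_invariant k x.2 w _ h0
  have h3 := 𝓕.cov_E_mem k h0
  have hs : ∀ (c : ℂ) {w}, w ∈ 𝓕.fil k x.2 → c • w ∈ 𝓕.fil k x.2 :=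
    fun c _ hw => Submodule.smul_mem _ c hw
  rw [SaitoStructure.trTLEConn_pullField,
    toGr_add (sub_mem (add_mem h1 (hs _ (h2 _))) (hs _ (hs _ (add_mem (hs _ (h2 _)) h3))))
      (hs _ (hs _ h0)),
    toGr_sub (add_mem h1 (hs _ (h2 _))) (hs _ (hs _ (add_mem (hs _ (h2 _)) h3))),
    toGr_add h1 (hs _ (h2 _)), toGr_smul _ (h2 _),
    toGr_smul _ (hs _ (add_mem (hs _ (h2 _)) h3)), toGr_smul _ (add_mem (hs _ (h2 _)) h3),
    toGr_add (hs _ (h2 _)) h3, toGr_smul _ (h2 _), toGr_smul _ (hs _ h0), toGr_smul _ h0]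
  simp only [map_add, map_sub, map_smul, smul_eq_mul]

/-- Flatness of the pairing on classes of vector fields on `M`. -/
lemma pairing_flat_toGr (k : ℤ) {x : OnePoint ℂ × M} (hx : x ∈ cstar M)
    {a b : Π t : M, TangentSpace 𝓘(ℂ, V) t}
    (ha : (HolSheaf.tangent 𝓘(ℂ, V) M).HolAt a x.2) (hb : (HolSheaf.tangent 𝓘(ℂ, V) M).HolAt b x.2)
    (hak : ∀ᶠ u in 𝓝 x.2, a u ∈ 𝓕.fil k u) (hbk : ∀ᶠ u in 𝓝 x.2, b u ∈ 𝓕.fil k u)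
    (v : TangentSpace (sphereModel V) x) :
    mvfderiv (sphereModel V) (fun y : OnePoint ℂ × M => lam y ^ (-k) *
        𝓕.g k y.2 (toGr 𝓕.fil k y.2 (a y.2)) (toGr 𝓕.fil k y.2 (b y.2))) x v =
      lam x ^ (-k) * 𝓕.g k x.2 (toGr 𝓕.fil k x.2
        (𝓕.toSaitoStructure.trTLEConn d (pullField a) x v)) (toGr 𝓕.fil k x.2 (b x.2)) +
      lam x ^ (-k) * 𝓕.g k x.2 (toGr 𝓕.fil k x.2 (a x.2)) (toGr 𝓕.fil k x.2
        (𝓕.toSaitoStructure.trTLEConn d (pullField b) (invol x)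
          (mfderiv (sphereModel V) (sphereModel V) invol x v))) := by
  have hg := 𝓕.g_holFunAt k ha hb hak hbk
  have hl := lam_ne_zero hx
  have h1 := 𝓕.g_trTLEConn k ha hak v ((𝓕.g k x.2).flip (toGr 𝓕.fil k x.2 (b x.2)))
  have h2 := 𝓕.g_trTLEConn k (x := invol x) hb hbk
    (mfderiv (sphereModel V) (sphereModel V) invol x v)
    (𝓕.g k x.2 (toGr 𝓕.fil k x.2 (a x.2)))
  rw [sndPart_invol, mvfderiv_lam_invol hx, lam_invol] at h2
  -- This is `h2` with the base point of `j x` in `M` written as that of `x`, so that both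
  -- expansions involve the same terms.
  have h3 : 𝓕.g k x.2 (toGr 𝓕.fil k x.2 (a x.2)) (toGr 𝓕.fil k x.2
        (𝓕.toSaitoStructure.trTLEConn d (pullField b) (invol x)
          (mfderiv (sphereModel V) (sphereModel V) invol x v))) =
      𝓕.g k x.2 (toGr 𝓕.fil k x.2 (a x.2)) (toGr 𝓕.fil k x.2 (𝓕.cov b x.2 (sndPart v))) +
      (-lam x)⁻¹ * 𝓕.g k x.2 (toGr 𝓕.fil k x.2 (a x.2))
        (toGr 𝓕.fil k x.2 (𝓕.higgs x.2 (sndPart v) (b x.2))) -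
      -mvfderiv (sphereModel V) lam x v * ((-lam x)⁻¹ * ((-lam x)⁻¹ *
          𝓕.g k x.2 (toGr 𝓕.fil k x.2 (a x.2))
            (toGr 𝓕.fil k x.2 (𝓕.higgs x.2 (𝓕.E x.2) (b x.2))) +
          𝓕.g k x.2 (toGr 𝓕.fil k x.2 (a x.2)) (toGr 𝓕.fil k x.2 (𝓕.cov 𝓕.E x.2 (b x.2))))) +
      -mvfderiv (sphereModel V) lam x v * ((2 - d) / 2 * (-lam x)⁻¹ *
        𝓕.g k x.2 (toGr 𝓕.fil k x.2 (a x.2)) (toGr 𝓕.fil k x.2 (b x.2))) := h2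
  simp only [LinearMap.flip_apply] at h1
  rw [mvfderiv_fun_mul_apply (holFunAt_lam_zpow hx _) (holFunAt_comp_snd hg),
    mvfderiv_lam_zpow hx, mvfderiv_comp_snd hg, 𝓕.g_flat k x.2 a b ha hb hak hbk, h1, h3]
  have hE := 𝓕.g_cov_E k hak.self_of_nhds hbk.self_of_nhds
  have hh := fun w => 𝓕.g_higgs k x.2 w _ hak.self_of_nhds _ hbk.self_of_nhds
  -- After moving `θ` to the second argument, the terms in `θ_v` cancel by the sign of `λ⁻¹`, and
  -- those in `θ_E` because `dλ` changes sign under `j` while `λ⁻²` does not. What remains is a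
  -- multiple of `hE`.
  rw [hh, hh, zpow_sub_one₀ hl, inv_neg]
  push_cast
  linear_combination lam x ^ (-k) * (lam x)⁻¹ * mvfderiv (sphereModel V) lam x v * hE

lemma gr_isTrTLEP (k : ℤ) : IsTrTLEP (-k) ((pullTangent V M).gr 𝓕.weight k)
    (grConn (pullTangent V M) (𝓕.toSaitoStructure.trTLEConn d) 𝓕.weight k) (𝓕.pairing k) := by
  have hT : IsTrTLE ((pullTangent V M).gr 𝓕.weight k)
      (grConn (pullTangent V M) (𝓕.toSaitoStructure.trTLEConn d) 𝓕.weight k) :=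
    𝓕.gr_isTrTLE k fun t => by
      obtain ⟨N, hN, ht, r, e, -, hf⟩ := 𝓕.exists_gr_frame k t
      exact ⟨N, hN.mem_nhds ht, r, _, hf⟩
  have hD := 𝓕.trTLEConn_isConnectionOn
  have hW := 𝓕.weight_isFlatSubbundleOn k
  have hW' := 𝓕.weight_isFlatSubbundleOn (k - 1)
  refine ⟨hT, ?_, fun x _ s s' => 𝓕.pairing_symm k x s s',
    -- The extension of `λ^k P` to all of `ℙ¹ × M` is `p^*g_k`, constant along `ℙ¹`.
    fun x => (𝓕.g k x.2 : Gr 𝓕.fil k x.2 →ₗ[ℂ] Gr 𝓕.fil k x.2 →ₗ[ℂ] ℂ), ?_, ?_,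
    fun x => 𝓕.g_bijective k x.2⟩
  · intro x hx s s' hs hs' v
    obtain ⟨N, hN, ht, r, e, he, hf⟩ := 𝓕.exists_gr_frame k x.2
    have hNx := univ_prod_mem_nhds (x := x) (hN.mem_nhds ht)
    have hNx' := univ_prod_mem_nhds (x := invol x) (hN.mem_nhds ht)
    have hmem : ∀ i, ∀ᶠ u in 𝓝 x.2, e i u ∈ 𝓕.fil k u := fun i => by
      filter_upwards [hN.mem_nhds ht] with u hu
      exact (he u hu i).2
    have hhol := fun i => (he x.2 ht i).1
    refine pairing_flat_of_frame hT.connection.isLeibnizOn hx hf hNx hNx' (fun i j => ?_) hs hs' v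
      fun i j => ?_
    · exact (holFunAt_lam_zpow hx (-k)).mul
        (holFunAt_comp_snd (𝓕.g_holFunAt k (hhol i) (hhol j) (hmem i) (hmem j)))
    -- The same vector field on `M` lifts the frame section at `x` and at `j x`, so both induced
    -- derivatives are given by the explicit formula on pulled-back fields.
    · have hlift : ∀ (y : OnePoint ℂ × M), y.2 = x.2 → ∀ i, IsLiftAt (pullTangent V M) 𝓕.weight k
          (fun y => toGr 𝓕.weight k y (pullField (e i) y)) (pullField (e i)) y := fun y hy i => by
        refine ⟨pullField_holAt (hy ▸ hhol i), ?_⟩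
        have h : ∀ᶠ u in 𝓝 y.2, e i u ∈ 𝓕.fil k u := hy ▸ hmem i
        exact ((continuous_snd.tendsto y).eventually h).mono fun z hz => ⟨hz, rfl⟩
      rw [(grConn_apply hD hW hW' hx (hlift x rfl i) v).2,
        (grConn_apply hD hW hW' (invol_mem_cstar hx) (hlift (invol x) rfl j) _).2]
      exact 𝓕.pairing_flat_toGr k hx (hhol i) (hhol j) (hmem i) (hmem j) v
  · intro x hx
    have hl := lam_ne_zero hx
    refine LinearMap.ext fun q => LinearMap.ext fun q' => ?_
    have h : ∀ q q' : Gr 𝓕.fil k x.2,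
        𝓕.g k x.2 q q' = lam x ^ (- -k) * (lam x ^ (-k) * 𝓕.g k x.2 q q') := fun q q' => by
      rw [← mul_assoc, ← zpow_add₀ hl, neg_add_cancel, zpow_zero, one_mul]
    exact h q q'
  · intro x s s' hs hs'
    obtain ⟨N, hN, ht, r, e, he, hf⟩ := 𝓕.exists_gr_frame k x.2
    have hmem : ∀ i, ∀ᶠ u in 𝓝 x.2, e i u ∈ 𝓕.fil k u := fun i => by
      filter_upwards [hN.mem_nhds ht] with u hu
      exact (he u hu i).2
    have hhol := fun i => (he x.2 ht i).1
    exact pairing_holFunAt_of_frame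
      (P := fun x => (𝓕.g k x.2 : Gr 𝓕.fil k x.2 →ₗ[ℂ] Gr 𝓕.fil k x.2 →ₗ[ℂ] ℂ)) hf
      (univ_prod_mem_nhds (x := x) (hN.mem_nhds ht))
      (univ_prod_mem_nhds (x := invol x) (hN.mem_nhds ht))
      (fun i j => holFunAt_comp_snd (𝓕.g_holFunAt k (hhol i) (hhol j) (hmem i) (hmem j))) hs hs'

end MixedFrobeniusStructure

end Pairings

end MixedFrob

end

theorem mainTheorem8 {V : Type*} [NormedAddCommGroup V] [NormedSpace ℂ V] [FiniteDimensional ℂ V]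
    {M : Type*} [TopologicalSpace M] [ChartedSpace V M] [IsManifold 𝓘(ℂ, V) ω M] (d : ℂ)
    (𝓕 : MixedFrob.MixedFrobeniusStructure V M d) :
    MixedFrob.IsMixedTrTLEP (MixedFrob.pullTangent V M) (𝓕.toSaitoStructure.trTLEConn d) 𝓕.weight
      𝓕.pairing where
  trTLE := MixedFrob.SaitoStructure.trTLEConn_isTrTLE d 𝓕.exists_frame
  increasing k x := 𝓕.increasing k x.2
  exhaustive x v := 𝓕.exhaustive x.2 v
  subbundle := 𝓕.weight_isSubbundle
  flat := 𝓕.weight_isFlatSubbundleOn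
  graded := 𝓕.gr_isTrTLEP
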